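/- Let $k$ be an arbitrary field, $R=k[X_1,\ldots,X_n]$ a polynomial ring, and let $f,g,h\in R$ be three cubic forms (homogeneous polynomials of degree $3$) which minimally generate an ideal $(f,g,h)$ of height two. Suppose that $(f,g,h)$ has a primary component (in a minimal primary decomposition) which is primary to an ideal $P=(x,y)$ generated by two linearly independent linear forms $x,y\in R$, and that the localization $(R/(f,g,h))_P$ has length at least $2$ as an $R_P$-module. Then the projective dimension of $R/(f,g,h)$ over $R$ satisfies $\operatorname{pd}_R\bigl(R/(f,g,h)\bigr)\le 36$. -/

import Mathlib

open CategoryTheory TensorProduct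

universe u

/-! Write the cubics as `aᵢ x + bᵢ y` with quadrics `aᵢ`, `bᵢ`. If some 2 × 2 minor of this matrix
were outside `P`, Cramer's rule would put `x` and `y` into the localized ideal, and the localization
would have length at most one. So the matrix has rank at most one modulo `P`, over the polynomial
ring `R/P`.

Projective dimension is bounded in two ways. (1) If quadrics `q₁, …, q_s` form a regular sequence
modulo a space `W` of linear forms, then `R` is flat over the polynomial ring on a basis of `W` and
the `qᵢ`. By Hilbert's syzygy theorem, ideals with generators in that subalgebra have projective
dimension at most `dim W + s` (`PDLT_of_regular_mod`). When regularity fails, a combination of the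
quadrics, or each of them, lies in an ideal of few linear forms. A quadric in an ideal of `d` linear
forms is a polynomial in `2d` of them, so `W` can be enlarged and a quadric dropped. For three
quadrics this rests on `RegularModulo.triple`. The largest count that occurs is 36. (2) The
sequences `0 → R/(J : a) → R/J → R/(J + (a)) → 0`, together with the bound 2 for quotients by
two-generated ideals.

A nonzero matrix of rank one over the factorial ring `R/P` has one of three shapes. The rows may be
linear multiples of a coprime pair of linear forms, in which case 19 linear forms suffice. They may
be constant multiples of a coprime pair of quadrics, in which case two quadrics and 8 linear forms
suffice. Otherwise the columns satisfy a constant relation, and a change of `x`, `y` gives cubics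
`lᵢ x² + y bᵢ` (`PDLT_of_square_pencil`); the zero matrix also falls here.

For such a square pencil, (1) settles everything except one situation: two of the `bᵢ` are
polynomials in `W`, and the third is a sum of outer variables times elements of `W` spanning at
least three dimensions, up to a polynomial in `W` (`IsWide`). By McCoy's theorem its cubic `f` is
then regular modulo each ideal that is defined over `W`, has `y` regular, and has no nonzero class
killed by three independent linear forms (`IsWide.regular`). This applies because two-generated
ideals have that last property. It makes the relevant colon ideals explicit, and (2) gives
projective dimension at most 3. The remaining degenerate configurations again involve few linear
forms. Height two enters only to exclude that all three cubics are divisible by one linear form. -/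

/-- `M` has projective dimension less than `n` over `R`. -/
abbrev PDLT (R : Type u) [CommRing R] (M : Type u) [AddCommGroup M] [Module R M] (n : ℕ) : Prop :=
  HasProjectiveDimensionLT (ModuleCat.of R M) n

/-! ### Projective dimension in short exact sequences and under flat base change -/

namespace PDLT

variable {R : Type u} [CommRing R] {M M₁ M₂ M₃ : Type u} [AddCommGroup M] [Module R M]
  [AddCommGroup M₁] [Module R M₁] [AddCommGroup M₂] [Module R M₂] [AddCommGroup M₃] [Module R M₃]

theorem mono {m n : ℕ} (hmn : m ≤ n) (h : PDLT R M m) : PDLT R M n :=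
  hasProjectiveDimensionLT_of_ge _ m n hmn

theorem congr {n : ℕ} (e : M₁ ≃ₗ[R] M₂) (h : PDLT R M₁ n) : PDLT R M₂ n :=
  hasProjectiveDimensionLT_of_iso e.toModuleIso n

theorem of_projective [Module.Projective R M] : PDLT R M 1 := by
  have : Projective (ModuleCat.of R M) := (IsProjective.iff_projective M).1 inferInstance
  exact projective_iff_hasProjectiveDimensionLT_one.1 this

theorem projective (h : PDLT R M 1) : Module.Projective R M :=
  (IsProjective.iff_projective M).2 (projective_iff_hasProjectiveDimensionLT_one.2 h)

theorem of_subsingleton [Subsingleton M] (n : ℕ) : PDLT R M n :=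
  mono (Nat.zero_le n) (ModuleCat.isZero_of_subsingleton _).hasProjectiveDimensionLT_zero

theorem subsingleton (h : PDLT R M 0) : Subsingleton M :=
  ModuleCat.isZero_iff_subsingleton.1
    ((hasProjectiveDimensionLT_zero_iff_isZero (ModuleCat.of R M)).1 h)

theorem shortExact (f : M₁ →ₗ[R] M₂) (g : M₂ →ₗ[R] M₃) (hf : Function.Injective f)
    (hfg : Function.Exact f g) (hg : Function.Surjective g) :
    (ShortComplex.mk (ModuleCat.ofHom f) (ModuleCat.ofHom g)
      (by ext x; exact hfg.apply_apply_eq_zero x)).ShortExact where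
  exact := by
    rw [ShortComplex.ShortExact.moduleCat_exact_iff_function_exact]
    exact hfg
  mono_f := (ModuleCat.mono_iff_injective _).2 hf
  epi_g := (ModuleCat.epi_iff_surjective _).2 hg

theorem middle (f : M₁ →ₗ[R] M₂) (g : M₂ →ₗ[R] M₃)
    (hf : Function.Injective f) (hfg : Function.Exact f g) (hg : Function.Surjective g) {n : ℕ}
    (h₁ : PDLT R M₁ n) (h₃ : PDLT R M₃ n) : PDLT R M₂ n :=
  (shortExact f g hf hfg hg).hasProjectiveDimensionLT_X₂ n h₁ h₃

theorem right (f : M₁ →ₗ[R] M₂) (g : M₂ →ₗ[R] M₃)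
    (hf : Function.Injective f) (hfg : Function.Exact f g) (hg : Function.Surjective g) {n : ℕ}
    (h₁ : PDLT R M₁ n) (h₂ : PDLT R M₂ (n + 1)) : PDLT R M₃ (n + 1) :=
  (shortExact f g hf hfg hg).hasProjectiveDimensionLT_X₃ n h₁ h₂

theorem left (f : M₁ →ₗ[R] M₂) (g : M₂ →ₗ[R] M₃)
    (hf : Function.Injective f) (hfg : Function.Exact f g) (hg : Function.Surjective g) {n : ℕ}
    (h₂ : PDLT R M₂ n) (h₃ : PDLT R M₃ (n + 1)) : PDLT R M₁ n :=
  (shortExact f g hf hfg hg).hasProjectiveDimensionLT_X₁ n h₂ h₃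

theorem exists_projective_cover (M : Type u) [AddCommGroup M] [Module R M] :
    ∃ (F : Type u) (_ : AddCommGroup F) (_ : Module R F) (_ : Module.Projective R F)
      (π : F →ₗ[R] M), Function.Surjective π :=
  ⟨M →₀ R, inferInstance, inferInstance, inferInstance, Finsupp.linearCombination R id,
    Finsupp.linearCombination_id_surjective R M⟩

/-- Dimension shifting: the kernel of a projective cover has smaller dimension, and flatness keeps
the sequence exact. Bounds 0 and 1 are the base cases, since shifting only starts at bound 2. -/
theorem baseChange (S : Type u) [CommRing S] [Algebra R S] [Module.Flat R S] {n : ℕ}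
    (h : PDLT R M n) : PDLT S (S ⊗[R] M) n := by
  induction n generalizing M with
  | zero =>
    have := h.subsingleton
    exact of_subsingleton 0
  | succ n ih =>
    cases n with
    | zero =>
      have := h.projective
      exact of_projective
    | succ n =>
      obtain ⟨F, _, _, _, π, hπ⟩ := exists_projective_cover (R := R) M
      have hex : Function.Exact (LinearMap.ker π).subtype π := LinearMap.exact_subtype_ker_map π
      have hker : PDLT R (LinearMap.ker π) (n + 1) :=
        left _ _ (LinearMap.ker π).injective_subtype hex hπ (mono (by omega) of_projective) h
      refine right ((LinearMap.ker π).subtype.baseChange S) (π.baseChange S) ?_ ?_ ?_ (ih hker)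
        (mono (by omega) of_projective)
      · exact Module.Flat.lTensor_preserves_injective_linearMap _ (LinearMap.ker π).injective_subtype
      · exact lTensor_exact S hex hπ
      · exact LinearMap.lTensor_surjective S hπ

end PDLT

/-! ### Global dimension and Hilbert's syzygy theorem -/

/-- Every `R`-module has projective dimension less than `n`. -/
def GlobalDimLT (R : Type u) [CommRing R] (n : ℕ) : Prop :=
  ∀ (M : Type u) [AddCommGroup M] [Module R M], PDLT R M n

theorem GlobalDimLT.of_ringEquiv {R S : Type u} [CommRing R] [CommRing S] (e : R ≃+* S) {n : ℕ}
    (h : GlobalDimLT R (n + 1)) : GlobalDimLT S (n + 1) := by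
  intro M _ _
  let : Module R M := Module.compHom M e.toRingHom
  have := h M
  let := RingHomInvPair.of_ringEquiv e
  let := (RingHomInvPair.of_ringEquiv e).symm
  let e' : (ModuleCat.of R M) ≃ₛₗ[RingHomClass.toRingHom e] (ModuleCat.of S M) :=
    { AddEquiv.refl M with
      map_smul' := fun r m => rfl }
  have h' : HasProjectiveDimensionLE (ModuleCat.of R M) n := h M
  exact ModuleCat.hasProjectiveDimensionLE_of_semiLinearEquiv e e' n

theorem GlobalDimLT.of_field (k : Type u) [Field k] : GlobalDimLT k 1 :=
  fun _ _ _ => PDLT.of_projective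

section polynomial

open Polynomial

variable {R : Type u} [CommRing R] (M : Type u) [AddCommGroup M] [Module R M] [Module R[X] M]
  [IsScalarTower R R[X] M]

/-- The multiplication map `R[X] ⊗ M → M`. -/
noncomputable def polyMul : R[X] ⊗[R] M →ₗ[R[X]] M :=
  LinearMap.liftBaseChange R[X] (LinearMap.id : M →ₗ[R] M)

/-- The endomorphism `p ⊗ m ↦ pX ⊗ m - p ⊗ Xm` of `R[X] ⊗ M`. -/
noncomputable def polyDiff : R[X] ⊗[R] M →ₗ[R[X]] R[X] ⊗[R] M :=
  LinearMap.liftBaseChange R[X] (TensorProduct.mk R R[X] M X -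
    (TensorProduct.mk R R[X] M 1) ∘ₗ (LinearMap.lsmul R[X] M X).restrictScalars R)

/-- The contracting homotopy `Xⁿ ⊗ m ↦ ∑ Xⁱ ⊗ Xⁿ⁻¹⁻ⁱ m`. -/
noncomputable def polyHomotopy : R[X] ⊗[R] M →ₗ[R] R[X] ⊗[R] M :=
  TensorProduct.lift ((Polynomial.basisMonomials R).constr R fun n =>
    ∑ i ∈ Finset.range n, (TensorProduct.mk R R[X] M (X ^ i)) ∘ₗ
      (LinearMap.lsmul R[X] M (X ^ (n - 1 - i))).restrictScalars R)

variable {M}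

theorem polyTensor_ext {N : Type*} [AddCommGroup N] [Module R N] {f g : R[X] ⊗[R] M →ₗ[R] N}
    (h : ∀ n m, f (((X : R[X]) ^ n) ⊗ₜ[R] m) = g (((X : R[X]) ^ n) ⊗ₜ[R] m)) : f = g := by
  apply TensorProduct.ext
  apply (Polynomial.basisMonomials R).ext
  intro n
  ext m
  simpa [Polynomial.X_pow_eq_monomial] using h n m

theorem polyMul_tmul (p : R[X]) (m : M) : polyMul M (p ⊗ₜ[R] m) = p • m := by
  simp [polyMul]

theorem polyDiff_tmul (p : R[X]) (m : M) :
    polyDiff M (p ⊗ₜ[R] m) = (p * X) ⊗ₜ[R] m - p ⊗ₜ[R] ((X : R[X]) • m) := by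
  simp [polyDiff, smul_sub, TensorProduct.smul_tmul']

theorem polyHomotopy_tmul (n : ℕ) (m : M) :
    polyHomotopy M (((X : R[X]) ^ n) ⊗ₜ[R] m) =
      ∑ i ∈ Finset.range n, ((X : R[X]) ^ i) ⊗ₜ[R] ((X : R[X]) ^ (n - 1 - i) • m) := by
  have : (X : R[X]) ^ n = Polynomial.basisMonomials R n := by
    simp [Polynomial.X_pow_eq_monomial]
  rw [polyHomotopy, TensorProduct.lift.tmul, this, Module.Basis.constr_basis]
  simp [LinearMap.sum_apply]

theorem polyHomotopy_polyDiff (t : R[X] ⊗[R] M) : polyHomotopy M (polyDiff M t) = t := by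
  suffices h : polyHomotopy M ∘ₗ (polyDiff M).restrictScalars R = LinearMap.id from
    LinearMap.congr_fun h t
  apply polyTensor_ext
  intro n m
  simp only [LinearMap.coe_comp, Function.comp_apply, LinearMap.coe_restrictScalars, polyDiff_tmul,
    map_sub, LinearMap.id_coe, id_eq, ← pow_succ, polyHomotopy_tmul, Finset.sum_range_succ]
  simp only [add_tsub_cancel_right, tsub_self, pow_zero, one_smul, ← mul_smul, ← pow_succ]
  rw [sub_eq_iff_eq_add, add_comm, add_right_inj]
  refine Finset.sum_congr rfl fun i hi => ?_
  rw [Finset.mem_range] at hi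
  congr 3
  omega

theorem polyDiff_polyHomotopy (t : R[X] ⊗[R] M) :
    polyDiff M (polyHomotopy M t) = t - 1 ⊗ₜ[R] polyMul M t := by
  suffices h : (polyDiff M).restrictScalars R ∘ₗ polyHomotopy M =
      LinearMap.id - (TensorProduct.mk R R[X] M 1) ∘ₗ (polyMul M).restrictScalars R from
    LinearMap.congr_fun h t
  apply polyTensor_ext
  intro n m
  simp only [LinearMap.coe_comp, Function.comp_apply, LinearMap.coe_restrictScalars,
    polyHomotopy_tmul, map_sum, polyDiff_tmul, LinearMap.sub_apply, LinearMap.id_coe, id_eq,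
    TensorProduct.mk_apply, polyMul_tmul, ← pow_succ, ← mul_smul, ← pow_succ']
  -- The image of the homotopy telescopes to its two end terms.
  have := Finset.sum_range_sub (fun i => ((X : R[X]) ^ i) ⊗ₜ[R] ((X : R[X]) ^ (n - i) • m)) n
  simp only [tsub_self, pow_zero, one_smul, tsub_zero] at this
  rw [← this]
  refine Finset.sum_congr rfl fun i hi => ?_
  rw [Finset.mem_range] at hi
  rw [show n - (i + 1) = n - 1 - i by omega, show n - 1 - i + 1 = n - i by omega]

/-- The sequence `0 → R[X] ⊗ M → R[X] ⊗ M → M → 0` with maps `polyDiff` and `polyMul` is exact, and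
the base-changed terms keep the dimension of `M` over `R`. The contracting homotopy proves
injectivity and exactness in the middle. -/
theorem PDLT.of_polynomial {n : ℕ} (h : PDLT R M n) : PDLT R[X] M (n + 1) := by
  refine PDLT.right (polyDiff M) (polyMul M) ?_ ?_ ?_ (h.baseChange R[X])
    (PDLT.mono (Nat.le_succ n) (h.baseChange R[X]))
  · exact Function.LeftInverse.injective polyHomotopy_polyDiff
  · intro t
    constructor
    · intro ht
      exact ⟨polyHomotopy M t, by rw [polyDiff_polyHomotopy, ht, tmul_zero, sub_zero]⟩
    · rintro ⟨s, rfl⟩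
      induction s with
      | zero => simp
      | tmul p m => simp [polyDiff_tmul, polyMul_tmul, mul_smul]
      | add a b ha hb => simp [ha, hb]
  · intro m
    exact ⟨1 ⊗ₜ[R] m, by simp [polyMul_tmul]⟩

end polynomial

theorem GlobalDimLT.polynomial {R : Type u} [CommRing R] {n : ℕ} (h : GlobalDimLT R n) :
    GlobalDimLT (Polynomial R) (n + 1) := by
  intro M _ _
  let : Module R M := Module.compHom M (algebraMap R (Polynomial R))
  have : IsScalarTower R (Polynomial R) M := ⟨fun r p m => by
    rw [Algebra.smul_def, mul_smul]; rfl⟩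
  exact (h M).of_polynomial

/-- Hilbert's syzygy theorem. -/
theorem GlobalDimLT.mvPolynomial_fin (k : Type u) [Field k] (n : ℕ) :
    GlobalDimLT (MvPolynomial (Fin n) k) (n + 1) := by
  induction n with
  | zero =>
    exact (GlobalDimLT.of_field k).of_ringEquiv
      (MvPolynomial.isEmptyAlgEquiv k (Fin 0)).symm.toRingEquiv
  | succ n ih =>
    exact ih.polynomial.of_ringEquiv (MvPolynomial.finSuccEquiv k n).symm.toRingEquiv

/-! ### Cyclic modules and colon ideals -/

section quotients

variable {R : Type u} [CommRing R]

theorem PDLT.self : PDLT R R 1 := PDLT.of_projective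

/-- `K` is the colon ideal `J : a`, and multiplication by `a` identifies `R/K` with the kernel of
`R/J → R/(J + (a))`. The next three lemmas bound one term of this sequence by the other two. -/
theorem Ideal.shortExact_colon {J K : Ideal R} {a : R} (hK : ∀ r, r ∈ K ↔ r * a ∈ J) :
    ∃ (f : (R ⧸ K) →ₗ[R] (R ⧸ J)) (g : (R ⧸ J) →ₗ[R] (R ⧸ (J ⊔ Ideal.span {a}))),
      Function.Injective f ∧ Function.Exact f g ∧ Function.Surjective g := by
  let f : (R ⧸ K) →ₗ[R] (R ⧸ J) := Submodule.mapQ K J (LinearMap.toSpanSingleton R R a)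
    (fun r hr => by simpa using (hK r).1 hr)
  let g : (R ⧸ J) →ₗ[R] (R ⧸ (J ⊔ Ideal.span {a})) := Submodule.factor le_sup_left
  refine ⟨f, g, ?_, ?_, Submodule.factor_surjective _⟩
  · rw [injective_iff_map_eq_zero]
    intro t ht
    obtain ⟨r, rfl⟩ := Submodule.Quotient.mk_surjective _ t
    have : r * a ∈ J := by
      rw [Submodule.mapQ_apply, Submodule.Quotient.mk_eq_zero] at ht
      simpa using ht
    exact (Submodule.Quotient.mk_eq_zero _).2 ((hK r).2 this)
  · intro t
    obtain ⟨r, rfl⟩ := Submodule.Quotient.mk_surjective _ t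
    constructor
    · intro h
      have h : r ∈ J ⊔ Ideal.span {a} := (Submodule.Quotient.mk_eq_zero _).1 h
      obtain ⟨j, hj, s, hs, rfl⟩ := Submodule.mem_sup.1 h
      obtain ⟨c, rfl⟩ := Ideal.mem_span_singleton'.1 hs
      refine ⟨Submodule.Quotient.mk c, ?_⟩
      simp only [f, Submodule.mapQ_apply, LinearMap.toSpanSingleton_apply, smul_eq_mul]
      rw [Submodule.Quotient.eq]
      simpa using hj
    · rintro ⟨s, hs⟩
      obtain ⟨c, rfl⟩ := Submodule.Quotient.mk_surjective _ s
      rw [← hs]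
      simp only [f, g, Submodule.mapQ_apply, LinearMap.toSpanSingleton_apply, smul_eq_mul]
      rw [Submodule.Quotient.mk_eq_zero]
      exact (le_sup_right : Ideal.span {a} ≤ _) (Ideal.mul_mem_left _ c (Ideal.mem_span_singleton_self a))

theorem PDLT.of_colon {J K : Ideal R} {a : R} (hK : ∀ r, r ∈ K ↔ r * a ∈ J) {n : ℕ}
    (h₁ : PDLT R (R ⧸ K) n) (h₂ : PDLT R (R ⧸ (J ⊔ Ideal.span {a})) n) : PDLT R (R ⧸ J) n := by
  obtain ⟨f, g, hf, hfg, hg⟩ := Ideal.shortExact_colon hK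
  exact PDLT.middle f g hf hfg hg h₁ h₂

theorem PDLT.sup_of_colon {J K : Ideal R} {a : R} (hK : ∀ r, r ∈ K ↔ r * a ∈ J) {n : ℕ}
    (h₁ : PDLT R (R ⧸ K) n) (h₂ : PDLT R (R ⧸ J) (n + 1)) :
    PDLT R (R ⧸ (J ⊔ Ideal.span {a})) (n + 1) := by
  obtain ⟨f, g, hf, hfg, hg⟩ := Ideal.shortExact_colon hK
  exact PDLT.right f g hf hfg hg h₁ h₂

theorem PDLT.colon {J K : Ideal R} {a : R} (hK : ∀ r, r ∈ K ↔ r * a ∈ J) {n : ℕ}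
    (h₁ : PDLT R (R ⧸ J) n) (h₂ : PDLT R (R ⧸ (J ⊔ Ideal.span {a})) (n + 1)) :
    PDLT R (R ⧸ K) n := by
  obtain ⟨f, g, hf, hfg, hg⟩ := Ideal.shortExact_colon hK
  exact PDLT.left f g hf hfg hg h₁ h₂

theorem PDLT.sup_of_regular {J : Ideal R} {a : R} (ha : ∀ r, r * a ∈ J → r ∈ J) {n : ℕ}
    (h : PDLT R (R ⧸ J) n) : PDLT R (R ⧸ (J ⊔ Ideal.span {a})) (n + 1) :=
  PDLT.sup_of_colon (K := J) (fun r => ⟨fun hr => Ideal.mul_mem_right _ _ hr, ha r⟩) h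
    (h.mono (Nat.le_succ n))

theorem PDLT.quotient_bot : PDLT R (R ⧸ (⊥ : Ideal R)) 1 :=
  PDLT.congr (Submodule.quotEquivOfEqBot ⊥ rfl).symm PDLT.self

theorem PDLT.quotient_span_singleton [IsDomain R] (a : R) : PDLT R (R ⧸ Ideal.span {a}) 2 := by
  rcases eq_or_ne a 0 with rfl | ha
  · rw [Ideal.span_singleton_eq_bot.2 rfl]
    exact PDLT.quotient_bot.mono (by norm_num)
  · rw [← bot_sup_eq (Ideal.span {a})]
    refine PDLT.sup_of_regular (fun r hr => ?_) PDLT.quotient_bot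
    simpa [ha] using hr

/-- After extraction of a greatest common divisor, `(d a') : d b'` is the principal ideal `(a')`.
Hence the bound holds whatever the height of the ideal. -/
theorem PDLT.quotient_span_pair [IsDomain R] [UniqueFactorizationMonoid R] (a b : R) :
    PDLT R (R ⧸ Ideal.span {a, b}) 3 := by
  rcases eq_or_ne a 0 with rfl | ha
  · have : Ideal.span {0, b} = Ideal.span {b} := by simp
    rw [this]
    exact (PDLT.quotient_span_singleton b).mono (by norm_num)
  · rcases eq_or_ne b 0 with rfl | hb
    · rw [show Ideal.span {a, (0 : R)} = Ideal.span {a} by rw [Set.pair_comm]; simp]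
      exact (PDLT.quotient_span_singleton a).mono (by norm_num)
    · obtain ⟨a', b', d, hab, rfl, rfl⟩ := UniqueFactorizationMonoid.exists_reduced_factors a ha b
      rw [Ideal.span_insert]
      refine PDLT.sup_of_colon (K := Ideal.span {a'}) (fun r => ?_)
        (PDLT.quotient_span_singleton a') ((PDLT.quotient_span_singleton _).mono (by norm_num))
      rw [Ideal.mem_span_singleton, Ideal.mem_span_singleton]
      have hd : d ≠ 0 := left_ne_zero_of_mul ha
      rw [mul_left_comm, mul_dvd_mul_iff_left hd]
      constructor
      · exact fun h => Dvd.dvd.mul_right h _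
      · exact fun h => hab.dvd_of_dvd_mul_right h

end quotients

/-! ### Flatness of quotients by elements that are regular on fibres -/

/-- An element of the kernel of `b ⊗ Q → Q` lifts to `b ⊗ N`, and its image in `b N` is some `φ m`.
By hypothesis `m` lies in `b N`, so by flatness of `N` the lift comes from `b ⊗ N` through `φ` and
dies in `b ⊗ Q`. -/
theorem Module.Flat.of_exact_of_regular {A N Q : Type*} [CommRing A] [AddCommGroup N] [Module A N]
    [AddCommGroup Q] [Module A Q] [Module.Flat A N] (φ : N →ₗ[A] N) (ρ : N →ₗ[A] Q)
    (hex : Function.Exact φ ρ) (hρ : Function.Surjective ρ)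
    (hφ : ∀ (b : Ideal A) (n : N), φ n ∈ b • (⊤ : Submodule A N) → n ∈ b • (⊤ : Submodule A N)) :
    Module.Flat A Q := by
  rw [Module.Flat.iff_rTensor_injective']
  intro b
  rw [injective_iff_map_eq_zero]
  intro t ht
  obtain ⟨t', rfl⟩ := LinearMap.lTensor_surjective b hρ t
  have hN := Module.Flat.iff_rTensor_injective'.1 ‹Module.Flat A N› b
  let e := TensorProduct.lid A N
  have hrange : ∀ s : b ⊗[A] N, e (LinearMap.rTensor N b.subtype s) ∈ b • (⊤ : Submodule A N) := by
    intro s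
    induction s with
    | zero => simp
    | tmul r n => exact Submodule.smul_mem_smul r.2 trivial
    | add x y hx hy => rw [map_add, map_add]; exact Submodule.add_mem _ hx hy
  have hsurj : ∀ n ∈ b • (⊤ : Submodule A N), ∃ s : b ⊗[A] N,
      e (LinearMap.rTensor N b.subtype s) = n := by
    intro n hn
    induction hn using Submodule.smul_induction_on' with
    | smul r hr n hn => exact ⟨⟨r, hr⟩ ⊗ₜ n, by simp [e]⟩
    | add x _ y _ hx hy =>
      obtain ⟨s, rfl⟩ := hx
      obtain ⟨s', rfl⟩ := hy
      exact ⟨s + s', by simp⟩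
  have h1 : ρ (e (LinearMap.rTensor N b.subtype t')) = 0 := by
    have : ∀ s : b ⊗[A] N, ρ (e (LinearMap.rTensor N b.subtype s)) =
        TensorProduct.lid A Q (LinearMap.rTensor Q b.subtype (LinearMap.lTensor b ρ s)) := by
      intro s
      induction s with
      | zero => simp
      | tmul r n => simp [e]
      | add x y hx hy => simp only [map_add, hx, hy]
    rw [this, ht, map_zero]
  obtain ⟨m, hm⟩ := (hex _).1 h1
  obtain ⟨s, rfl⟩ := hsurj m (hφ b m (hm ▸ hrange t'))
  have h2 : t' = LinearMap.lTensor b φ s := by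
    apply hN
    apply e.injective
    rw [← hm]
    clear hm
    induction s with
    | zero => simp
    | tmul r n => simp [e]
    | add x y hx hy => simp only [map_add, hx, hy]
  rw [h2]
  exact (_root_.lTensor_exact b hex hρ).apply_apply_eq_zero s

/-- The quotient of `S/I` by `b (S/I)` is `S/(I + bS)`, so the hypothesis is the injectivity
condition of `of_exact_of_regular` for multiplication by `F`. -/
theorem Module.Flat.quotient_sup_of_regular {A S : Type*} [CommRing A] [CommRing S] [Algebra A S]
    {I : Ideal S} [Module.Flat A (S ⧸ I)] (F : S)
    (hF : ∀ (b : Ideal A) (a : S), a * F ∈ I ⊔ b.map (algebraMap A S) →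
      a ∈ I ⊔ b.map (algebraMap A S)) :
    Module.Flat A (S ⧸ (I ⊔ Ideal.span {F})) := by
  have hI : ∀ r, r ∈ I ↔ r * F ∈ I := fun r =>
    ⟨fun h => Ideal.mul_mem_right _ _ h, fun h => by simpa using hF ⊥ r (by simpa using h)⟩
  have hmem : ∀ (b : Ideal A) (s : S), (Ideal.Quotient.mk I s) ∈ b • (⊤ : Submodule A (S ⧸ I)) ↔
      s ∈ I ⊔ b.map (algebraMap A S) := by
    intro b s
    rw [Ideal.smul_top_eq_map, Submodule.restrictScalars_mem, IsScalarTower.algebraMap_eq A S (S ⧸ I),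
      ← Ideal.map_map, Ideal.Quotient.algebraMap_eq, Ideal.mem_quotient_iff_mem_sup, sup_comm]
  let φ : (S ⧸ I) →ₗ[A] (S ⧸ I) := LinearMap.mulLeft A (Ideal.Quotient.mk I F)
  let ρ : (S ⧸ I) →ₗ[A] (S ⧸ (I ⊔ Ideal.span {F})) :=
    (Ideal.Quotient.factorₐ A (le_sup_left : I ≤ I ⊔ Ideal.span {F})).toLinearMap
  refine Module.Flat.of_exact_of_regular φ ρ ?_ (Ideal.Quotient.factor_surjective le_sup_left) ?_
  · intro t
    obtain ⟨r, rfl⟩ := Ideal.Quotient.mk_surjective t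
    have hρ : ρ (Ideal.Quotient.mk I r) = Ideal.Quotient.mk _ r := rfl
    rw [hρ, Ideal.Quotient.eq_zero_iff_mem]
    constructor
    · intro h
      obtain ⟨j, hj, s, hs, rfl⟩ := Submodule.mem_sup.1 h
      obtain ⟨c, rfl⟩ := Ideal.mem_span_singleton'.1 hs
      refine ⟨Ideal.Quotient.mk I c, ?_⟩
      simp only [φ, LinearMap.mulLeft_apply, ← map_mul]
      rw [eq_comm, Ideal.Quotient.mk_eq_mk_iff_sub_mem]
      simpa [mul_comm] using hj
    · rintro ⟨s, hs⟩
      obtain ⟨c, rfl⟩ := Ideal.Quotient.mk_surjective s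
      simp only [φ, LinearMap.mulLeft_apply, ← map_mul] at hs
      rw [eq_comm, Ideal.Quotient.mk_eq_mk_iff_sub_mem] at hs
      have h2 : F * c ∈ I ⊔ Ideal.span {F} :=
        Ideal.mul_mem_right _ _ (Ideal.mem_sup_right (Ideal.mem_span_singleton_self F))
      simpa using add_mem (Ideal.mem_sup_left (T := Ideal.span {F}) hs) h2
  · intro b t ht
    obtain ⟨r, rfl⟩ := Ideal.Quotient.mk_surjective t
    simp only [φ, LinearMap.mulLeft_apply, ← map_mul] at ht
    rw [hmem] at ht ⊢
    exact hF b r (by rwa [mul_comm])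

/-- Regularity modulo an ideal is preserved by flat extensions. -/
theorem Ideal.regular_map_of_flat {S S' : Type*} [CommRing S] [CommRing S'] [Algebra S S']
    [Module.Flat S S'] {I : Ideal S} {q : S} (hq : ∀ a, a * q ∈ I → a ∈ I) (a : S')
    (ha : a * algebraMap S S' q ∈ I.map (algebraMap S S')) : a ∈ I.map (algebraMap S S') := by
  have h1 : IsSMulRegular (S ⧸ I) q := by
    intro x y hxy
    obtain ⟨x, rfl⟩ := Ideal.Quotient.mk_surjective x
    obtain ⟨y, rfl⟩ := Ideal.Quotient.mk_surjective y
    simp only [Algebra.smul_def, Ideal.Quotient.algebraMap_eq, ← map_mul] at hxy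
    rw [Ideal.Quotient.mk_eq_mk_iff_sub_mem] at hxy ⊢
    exact hq _ (by rwa [sub_mul, mul_comm x, mul_comm y])
  have h2 : IsSMulRegular (S' ⧸ (I • (⊤ : Submodule S S'))) q :=
    ((TensorProduct.tensorQuotEquivQuotSMul S' I).isSMulRegular_congr q).1 (h1.lTensor S')
  have hmem : ∀ s : S', Submodule.Quotient.mk (p := I • (⊤ : Submodule S S')) s = 0 ↔
      s ∈ I.map (algebraMap S S') := by
    intro s
    rw [Submodule.Quotient.mk_eq_zero, Ideal.smul_top_eq_map, Submodule.restrictScalars_mem]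
  rw [← hmem] at ha ⊢
  rw [mul_comm, ← Algebra.smul_def, Submodule.Quotient.mk_smul] at ha
  exact h2 (by simpa using ha)

namespace MvPolynomial

attribute [local instance] MvPolynomial.algebraMvPolynomial

theorem regular_map_of_field {k C τ : Type*} [Field k] [CommRing C] [Algebra k C]
    {I : Ideal (MvPolynomial τ k)} {q : MvPolynomial τ k} (hq : ∀ a, a * q ∈ I → a ∈ I)
    (a : MvPolynomial τ C) (ha : a * map (algebraMap k C) q ∈ I.map (map (algebraMap k C))) :
    a ∈ I.map (map (algebraMap k C)) := by
  have : Module.Flat (MvPolynomial τ k) (MvPolynomial τ C) :=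
    Module.Flat.isBaseChange k (MvPolynomial τ k) C (MvPolynomial τ C)
      (Algebra.IsPushout.out (R := k) (S := MvPolynomial τ k) (R' := C) (S' := MvPolynomial τ C))
  exact Ideal.regular_map_of_flat hq a ha


/-! ### Ideals of top-degree forms -/

section initial

variable {C τ : Type*} [CommRing C]

theorem homogeneousComponent_mul_of_totalDegree_le {a b : MvPolynomial τ C} {d e : ℕ}
    (ha : a.totalDegree ≤ d) (hb : b.totalDegree ≤ e) :
    homogeneousComponent (d + e) (a * b) = homogeneousComponent d a * homogeneousComponent e b := by
  classical
  ext m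
  rw [coeff_homogeneousComponent]
  have hle : ∀ {p : MvPolynomial τ C} {n : ℕ}, p.totalDegree ≤ n → ∀ u, coeff u p ≠ 0 →
      u.degree ≤ n := fun hp u hu =>
    (le_totalDegree (mem_support_iff.2 hu)).trans hp
  split_ifs with hm
  · rw [coeff_mul, coeff_mul]
    refine Finset.sum_congr rfl fun x hx => ?_
    rw [Finset.HasAntidiagonal.mem_antidiagonal] at hx
    have hdeg : x.1.degree + x.2.degree = d + e := by rw [← hm, ← hx, map_add]
    rw [coeff_homogeneousComponent, coeff_homogeneousComponent]
    by_cases h1 : x.1.degree = d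
    · rw [if_pos h1, if_pos (by omega)]
    · rw [if_neg h1, zero_mul]
      by_contra hne
      have h2 := hle ha _ (left_ne_zero_of_mul hne)
      have h3 := hle hb _ (right_ne_zero_of_mul hne)
      omega
  · symm
    apply ((homogeneousComponent_isHomogeneous d a).mul
      (homogeneousComponent_isHomogeneous e b)).coeff_eq_zero
    exact hm

theorem totalDegree_le_of_homogeneousComponent_eq_zero {a : MvPolynomial τ C} {d : ℕ}
    (ha : a.totalDegree ≤ d + 1) (h : homogeneousComponent (d + 1) a = 0) : a.totalDegree ≤ d := by
  refine Finset.sup_le fun u hu => ?_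
  have h1 : u.degree ≤ d + 1 := (le_totalDegree hu).trans ha
  have h2 : u.degree ≠ d + 1 := by
    intro h2
    have := congrArg (coeff u) h
    rw [coeff_homogeneousComponent, if_pos h2, coeff_zero] at this
    exact mem_support_iff.1 hu this
  change u.degree ≤ d
  omega

theorem eq_zero_of_homogeneousComponent_zero_eq_zero {a : MvPolynomial τ C}
    (ha : a.totalDegree ≤ 0) (h : homogeneousComponent 0 a = 0) : a = 0 := by
  rw [homogeneousComponent_zero, ← totalDegree_eq_zero_iff_eq_C.1 (Nat.le_zero.1 ha)] at h
  exact h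

theorem homogeneousComponent_idem (a : MvPolynomial τ C) (d : ℕ) :
    homogeneousComponent d (homogeneousComponent d a) = homogeneousComponent d a :=
  homogeneousComponent_eq_self (homogeneousComponent_isHomogeneous d a)

theorem homogeneousComponent_mul_isHomogeneous_eq_sum (a : MvPolynomial τ C) {t : MvPolynomial τ C}
    {e : ℕ} (ht : t.IsHomogeneous e) (d : ℕ) : homogeneousComponent d (a * t) =
      ∑ i ∈ Finset.range (a.totalDegree + 1), if d = i + e then homogeneousComponent i a * t else 0 := by
  conv_lhs => rw [← sum_homogeneousComponent a, Finset.sum_mul, map_sum]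
  exact Finset.sum_congr rfl fun i _ =>
    homogeneousComponent_of_mem ((homogeneousComponent_isHomogeneous i a).mul ht)

theorem homogeneousComponent_mul_isHomogeneous (a : MvPolynomial τ C) {t : MvPolynomial τ C}
    {e : ℕ} (ht : t.IsHomogeneous e) (c : ℕ) :
    homogeneousComponent (c + e) (a * t) = homogeneousComponent c a * t := by
  rw [homogeneousComponent_mul_isHomogeneous_eq_sum a ht]
  simp only [add_left_inj, Finset.sum_ite_eq, Finset.mem_range]
  split_ifs with h
  · rfl
  · rw [homogeneousComponent_eq_zero _ _ (by omega), zero_mul]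

theorem homogeneousComponent_mul_isHomogeneous_of_lt (a : MvPolynomial τ C) {t : MvPolynomial τ C}
    {e d : ℕ} (ht : t.IsHomogeneous e) (h : d < e) : homogeneousComponent d (a * t) = 0 := by
  rw [homogeneousComponent_mul_isHomogeneous_eq_sum a ht]
  exact Finset.sum_eq_zero fun i _ => if_neg (by omega)

/-- `J` is the ideal of top-degree forms of elements of `I`. -/
structure IsTopIdeal (I J : Ideal (MvPolynomial τ C)) : Prop where
  top_mem : ∀ p ∈ I, ∀ d, p.totalDegree ≤ d → homogeneousComponent d p ∈ J
  lift : ∀ q ∈ J, ∀ d, ∃ p ∈ I, p.totalDegree ≤ d ∧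
    homogeneousComponent d p = homogeneousComponent d q

namespace IsTopIdeal

theorem bot : IsTopIdeal (⊥ : Ideal (MvPolynomial τ C)) ⊥ where
  top_mem p hp d _ := by
    rw [Ideal.mem_bot] at hp ⊢
    rw [hp, map_zero]
  lift q hq d := ⟨0, zero_mem _, by simp, by rw [Ideal.mem_bot.1 hq]⟩

variable {I J : Ideal (MvPolynomial τ C)} {F t : MvPolynomial τ C} {e : ℕ}

/-- The top form of `a` times `t` lies in `J`, hence so does the top form of `a`. Subtracting an
element of `I` with the same top form lowers the degree. Since `d` only bounds the degree, vanishing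
components do no harm. -/
theorem regular (h : IsTopIdeal I J) (hF : F.totalDegree ≤ e) (ht : homogeneousComponent e F = t)
    (hreg : ∀ a, a * t ∈ J → a ∈ J) (a : MvPolynomial τ C) (ha : a * F ∈ I) : a ∈ I := by
  suffices H : ∀ d a, a.totalDegree ≤ d → a * F ∈ I → a ∈ I from H _ a le_rfl ha
  intro d
  induction d with
  | zero =>
    intro a had ha
    have h1 : homogeneousComponent 0 a ∈ J := by
      apply hreg
      rw [← ht, ← homogeneousComponent_mul_of_totalDegree_le had hF]
      exact h.top_mem _ ha _ ((totalDegree_mul _ _).trans (add_le_add had hF))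
    obtain ⟨p, hp, hpd, hpa⟩ := h.lift _ h1 0
    rw [homogeneousComponent_idem] at hpa
    have : a - p = 0 := eq_zero_of_homogeneousComponent_zero_eq_zero
      ((totalDegree_sub _ _).trans (max_le had hpd)) (by rw [map_sub, hpa, sub_self])
    rwa [sub_eq_zero.1 this]
  | succ d ih =>
    intro a had ha
    have h1 : homogeneousComponent (d + 1) a ∈ J := by
      apply hreg
      rw [← ht, ← homogeneousComponent_mul_of_totalDegree_le had hF]
      exact h.top_mem _ ha _ ((totalDegree_mul _ _).trans (add_le_add had hF))
    obtain ⟨p, hp, hpd, hpa⟩ := h.lift _ h1 (d + 1)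
    rw [homogeneousComponent_idem] at hpa
    have h2 : (a - p).totalDegree ≤ d := totalDegree_le_of_homogeneousComponent_eq_zero
      ((totalDegree_sub _ _).trans (max_le had hpd)) (by rw [map_sub, hpa, sub_self])
    have h3 := ih (a - p) h2 (by
      rw [sub_mul]
      exact sub_mem ha (Ideal.mul_mem_right _ _ hp))
    simpa using add_mem h3 hp

/-- The only danger is cancellation in `i + a * F`. If the top of `a * F` cancels, then `t` times
the top form of `a` lies in `J`, so that form lies in `J` and the corresponding part of `a * F` can
be moved into `I`. This is an induction on the degree of `a`. -/
theorem sup (h : IsTopIdeal I J) (hF : F.totalDegree ≤ e) (ht : homogeneousComponent e F = t)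
    (hreg : ∀ a, a * t ∈ J → a ∈ J) :
    IsTopIdeal (I ⊔ Ideal.span {F}) (J ⊔ Ideal.span {t}) where
  top_mem p hp d hpd := by
    obtain ⟨i, hi, s, hs, rfl⟩ := Submodule.mem_sup.1 hp
    obtain ⟨a, rfl⟩ := Ideal.mem_span_singleton'.1 hs
    have key : ∀ N i a, i ∈ I → (i + a * F).totalDegree ≤ d → a.totalDegree ≤ N →
        homogeneousComponent d (i + a * F) ∈ J ⊔ Ideal.span {t} := by
      intro N
      induction N with
      | zero =>
        intro i a hi hd ha
        by_cases hed : e ≤ d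
        · have haF : (a * F).totalDegree ≤ d :=
            (totalDegree_mul _ _).trans (by omega)
          have hid : i.totalDegree ≤ d := by
            have : i = (i + a * F) - a * F := by ring
            rw [this]
            exact (totalDegree_sub _ _).trans (max_le hd haF)
          rw [map_add]
          refine add_mem (Ideal.mem_sup_left (h.top_mem i hi d hid)) (Ideal.mem_sup_right ?_)
          obtain ⟨c, rfl⟩ := Nat.exists_eq_add_of_le' hed
          rw [homogeneousComponent_mul_of_totalDegree_le (by omega) hF, ht]
          exact Ideal.mul_mem_left _ _ (Ideal.mem_span_singleton_self t)
        · have haF : (a * F).totalDegree ≤ 0 + e :=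
            (totalDegree_mul _ _).trans (by omega)
          have hid : i.totalDegree ≤ 0 + e := by
            have : i = (i + a * F) - a * F := by ring
            rw [this]
            exact (totalDegree_sub _ _).trans (max_le (by omega) haF)
          have h1 : homogeneousComponent 0 a ∈ J := by
            apply hreg
            rw [← ht, ← homogeneousComponent_mul_of_totalDegree_le ha hF]
            have h0 : homogeneousComponent (0 + e) (i + a * F) = 0 :=
              homogeneousComponent_eq_zero _ _ (by omega)
            rw [map_add, add_comm] at h0
            rw [eq_neg_of_add_eq_zero_left h0]
            exact neg_mem (h.top_mem i hi _ hid)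
          obtain ⟨p, hp, hpd, hpa⟩ := h.lift _ h1 0
          rw [homogeneousComponent_idem] at hpa
          have : a - p = 0 := eq_zero_of_homogeneousComponent_zero_eq_zero
            ((totalDegree_sub _ _).trans (max_le ha hpd)) (by rw [map_sub, hpa, sub_self])
          refine Ideal.mem_sup_left (h.top_mem _ (add_mem hi (Ideal.mul_mem_right _ _ ?_)) d hd)
          rwa [sub_eq_zero.1 this]
      | succ N ih =>
        intro i a hi hd ha
        by_cases hed : N + 1 + e ≤ d
        · have haF : (a * F).totalDegree ≤ d :=
            (totalDegree_mul _ _).trans (by omega)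
          have hid : i.totalDegree ≤ d := by
            have : i = (i + a * F) - a * F := by ring
            rw [this]
            exact (totalDegree_sub _ _).trans (max_le hd haF)
          rw [map_add]
          refine add_mem (Ideal.mem_sup_left (h.top_mem i hi d hid)) (Ideal.mem_sup_right ?_)
          obtain ⟨c, rfl⟩ := Nat.exists_eq_add_of_le' (show e ≤ d by omega)
          rw [homogeneousComponent_mul_of_totalDegree_le (by omega) hF, ht]
          exact Ideal.mul_mem_left _ _ (Ideal.mem_span_singleton_self t)
        · have haF : (a * F).totalDegree ≤ N + 1 + e :=
            (totalDegree_mul _ _).trans (by omega)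
          have hid : i.totalDegree ≤ N + 1 + e := by
            have : i = (i + a * F) - a * F := by ring
            rw [this]
            exact (totalDegree_sub _ _).trans (max_le (by omega) haF)
          have h1 : homogeneousComponent (N + 1) a ∈ J := by
            apply hreg
            rw [← ht, ← homogeneousComponent_mul_of_totalDegree_le ha hF]
            have h0 : homogeneousComponent (N + 1 + e) (i + a * F) = 0 :=
              homogeneousComponent_eq_zero _ _ (by omega)
            rw [map_add, add_comm] at h0
            rw [eq_neg_of_add_eq_zero_left h0]
            exact neg_mem (h.top_mem i hi _ hid)
          obtain ⟨p, hp, hpd, hpa⟩ := h.lift _ h1 (N + 1)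
          rw [homogeneousComponent_idem] at hpa
          have h2 : (a - p).totalDegree ≤ N := totalDegree_le_of_homogeneousComponent_eq_zero
            ((totalDegree_sub _ _).trans (max_le ha hpd)) (by rw [map_sub, hpa, sub_self])
          have h3 : i + a * F = (i + p * F) + (a - p) * F := by ring
          rw [h3] at hd ⊢
          exact ih _ _ (add_mem hi (Ideal.mul_mem_right _ _ hp)) hd h2
    exact key _ i a hi hpd le_rfl
  lift q hq d := by
    obtain ⟨i, hi, s, hs, rfl⟩ := Submodule.mem_sup.1 hq
    obtain ⟨a, rfl⟩ := Ideal.mem_span_singleton'.1 hs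
    obtain ⟨p, hp, hpd, hpi⟩ := h.lift i hi d
    by_cases hed : e ≤ d
    · obtain ⟨c, rfl⟩ := Nat.exists_eq_add_of_le' hed
      have hc : (homogeneousComponent c a).totalDegree ≤ c :=
        (homogeneousComponent_isHomogeneous c a).totalDegree_le
      refine ⟨p + homogeneousComponent c a * F, ?_, ?_, ?_⟩
      · exact add_mem (Ideal.mem_sup_left hp) (Ideal.mem_sup_right
          (Ideal.mul_mem_left _ _ (Ideal.mem_span_singleton_self F)))
      · exact (totalDegree_add _ _).trans (max_le hpd ((totalDegree_mul _ _).trans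
          (add_le_add hc hF)))
      · rw [map_add, map_add, hpi, homogeneousComponent_mul_of_totalDegree_le hc hF, ht,
          homogeneousComponent_idem]
        have htt : t.IsHomogeneous e := ht ▸ homogeneousComponent_isHomogeneous e F
        rw [homogeneousComponent_mul_isHomogeneous a htt]
    · refine ⟨p, Ideal.mem_sup_left hp, hpd, ?_⟩
      have htt : t.IsHomogeneous e := ht ▸ homogeneousComponent_isHomogeneous e F
      rw [map_add, hpi, homogeneousComponent_mul_isHomogeneous_of_lt a htt (by omega), add_zero]

end IsTopIdeal

end initial

/-! ### Flatness of polynomial substitutions -/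

/-- Each element of the list is regular modulo `I` and its predecessors. -/
def RegularModulo {S : Type*} [CommRing S] (I : Ideal S) : List S → Prop
  | [] => True
  | q :: qs => (∀ a, a * q ∈ I → a ∈ I) ∧ RegularModulo (I ⊔ Ideal.span {q}) qs

/-- Regularity of the top forms over the field `k` persists over every `A ⧸ b`, and then passes to
the `Fs` themselves by `IsTopIdeal.regular`. The hypothesis on top ideals ranges over all `b`
because the flatness criterion tests regularity modulo every ideal of the base. -/
theorem flat_quotient_of_top_regular {k A τ : Type*} [Field k] [CommRing A] [Algebra k A]
    {e : ℕ} (Fs : List (MvPolynomial τ A)) (qs : List (MvPolynomial τ k))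
    (hdeg : ∀ F ∈ Fs, F.totalDegree ≤ e)
    (htop : Fs.map (homogeneousComponent e) = qs.map (map (algebraMap k A)))
    (I : Ideal (MvPolynomial τ A)) (J : Ideal (MvPolynomial τ k))
    (hIJ : ∀ b : Ideal A, IsTopIdeal (I.map (map (Ideal.Quotient.mk b)))
      (J.map (map (algebraMap k (A ⧸ b)))))
    (hflat : Module.Flat A (MvPolynomial τ A ⧸ I)) (hreg : RegularModulo J qs) :
    Module.Flat A (MvPolynomial τ A ⧸ (I ⊔ Ideal.ofList Fs)) := by
  induction Fs generalizing qs I J with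
  | nil =>
    rw [show I ⊔ Ideal.ofList ([] : List (MvPolynomial τ A)) = I by simp]
    exact hflat
  | cons F Fs ih =>
    cases qs with
    | nil => simp at htop
    | cons q qs =>
      simp only [List.map_cons, List.cons.injEq] at htop
      obtain ⟨hreg1, hreg2⟩ := hreg
      have hF := hdeg F (by simp)
      rw [Ideal.ofList_cons, ← sup_assoc]
      have hdegb : ∀ b : Ideal A, (map (Ideal.Quotient.mk b) F).totalDegree ≤ e := fun b =>
        (Finset.sup_mono (support_map_subset _ _)).trans hF
      have htopb : ∀ b : Ideal A, homogeneousComponent e (map (Ideal.Quotient.mk b) F) =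
          map (algebraMap k (A ⧸ b)) q := by
        intro b
        ext m
        have := congrArg (coeff m) htop.1
        rw [coeff_homogeneousComponent] at this ⊢
        rw [coeff_map] at this
        rw [coeff_map, coeff_map, IsScalarTower.algebraMap_apply k A (A ⧸ b), ← this,
          Ideal.Quotient.algebraMap_eq]
        split_ifs <;> simp
      have hregb : ∀ b : Ideal A, ∀ a, a * map (algebraMap k (A ⧸ b)) q ∈
          J.map (map (algebraMap k (A ⧸ b))) → a ∈ J.map (map (algebraMap k (A ⧸ b))) :=
        fun b => regular_map_of_field hreg1
      refine ih qs (fun G hG => hdeg G (by simp [hG])) htop.2 (I ⊔ Ideal.span {F})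
        (J ⊔ Ideal.span {q}) (fun b => ?_) ?_ hreg2
      · rw [Ideal.map_sup, Ideal.map_span, Set.image_singleton, Ideal.map_sup, Ideal.map_span,
          Set.image_singleton]
        exact (hIJ b).sup (hdegb b) (htopb b) (hregb b)
      · refine Module.Flat.quotient_sup_of_regular F fun b a ha => ?_
        have hker : b.map (algebraMap A (MvPolynomial τ A)) =
            RingHom.ker (map (σ := τ) (Ideal.Quotient.mk b)) := by
          rw [ker_map, Ideal.mk_ker, algebraMap_eq]
        have hsurj : Function.Surjective (map (σ := τ) (Ideal.Quotient.mk b)) :=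
          map_surjective _ Ideal.Quotient.mk_surjective
        have hmem : ∀ x, x ∈ I ⊔ b.map (algebraMap A (MvPolynomial τ A)) ↔
            map (Ideal.Quotient.mk b) x ∈ I.map (map (Ideal.Quotient.mk b)) := by
          intro x
          rw [hker, ← Ideal.mem_comap, Ideal.comap_map_of_surjective' _ hsurj]
        rw [hmem, map_mul] at ha
        rw [hmem]
        exact (hIJ b).regular (hdegb b) (htopb b) (hregb b) _ ha

theorem eval_comp_map_C {B τ : Type*} [CommRing B] {s : ℕ} (q : Fin s → MvPolynomial τ B) :
    (eval₂Hom (aeval (R := B) q).toRingHom X :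
      MvPolynomial τ (MvPolynomial (Fin s) B) →+* MvPolynomial τ B).comp (map C) =
      RingHom.id _ := by
  ext i
  · simp
  · simp

/-- This is the ideal of the graph of the substitution: modulo the listed relations `X i` equals `q
i`, so `map C` inverts evaluation. -/
theorem ker_eval_eq_span {B τ : Type*} [CommRing B] {s : ℕ} (q : Fin s → MvPolynomial τ B) :
    RingHom.ker (eval₂Hom (aeval (R := B) q).toRingHom X :
      MvPolynomial τ (MvPolynomial (Fin s) B) →+* MvPolynomial τ B) =
    Ideal.ofList (List.ofFn fun i => map C (q i) - C (X i)) := by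
  set φ : MvPolynomial τ (MvPolynomial (Fin s) B) →+* MvPolynomial τ B :=
    eval₂Hom (aeval (R := B) q).toRingHom X with hφ
  set J : Ideal (MvPolynomial τ (MvPolynomial (Fin s) B)) :=
    Ideal.ofList (List.ofFn fun i => map C (q i) - C (X i)) with hJ
  have hgen : ∀ i, map C (q i) - C (X i) ∈ J := fun i =>
    Ideal.subset_span ((List.mem_ofFn' _ _).2 ⟨i, rfl⟩)
  have hφC : φ.comp (map C) = RingHom.id _ := eval_comp_map_C q
  apply le_antisymm
  · intro p hp
    have h1 : (Ideal.Quotient.mk J).comp ((map C).comp φ) = Ideal.Quotient.mk J := by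
      apply MvPolynomial.ringHom_ext'
      · apply MvPolynomial.ringHom_ext'
        · ext b
          simp [hφ]
        · intro i
          simp only [hφ, RingHom.coe_comp, Function.comp_apply, eval₂Hom_C]
          rw [Ideal.Quotient.mk_eq_mk_iff_sub_mem]
          simpa using hgen i
      · intro i
        simp [hφ]
    have h2 := RingHom.congr_fun h1 p
    simp only [RingHom.coe_comp, Function.comp_apply, RingHom.mem_ker.1 hp, map_zero] at h2
    exact Ideal.Quotient.eq_zero_iff_mem.1 h2.symm
  · rw [hJ, Ideal.ofList, Ideal.span_le]
    intro x hx
    obtain ⟨i, rfl⟩ := (List.mem_ofFn' _ _).1 hx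
    have := RingHom.congr_fun hφC (q i)
    simp only [RingHom.coe_comp, Function.comp_apply, RingHom.id_apply] at this
    simp [this]
    simp [hφ]

/-- Substituting polynomials whose top forms in the remaining variables form a regular sequence over
the base field is a flat map. -/
theorem flat_aeval_of_top_regular {k B τ : Type*} [Field k] [CommRing B] [Algebra k B]
    {e : ℕ} (he : 0 < e) {s : ℕ} (q : Fin s → MvPolynomial τ B) (qb : Fin s → MvPolynomial τ k)
    (hdeg : ∀ i, (q i).totalDegree ≤ e)
    (htop : ∀ i, homogeneousComponent e (q i) = map (algebraMap k B) (qb i))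
    (hreg : RegularModulo ⊥ (List.ofFn qb)) :
    (aeval (R := B) q : MvPolynomial (Fin s) B →ₐ[B] MvPolynomial τ B).toRingHom.Flat := by
  set A := MvPolynomial (Fin s) B with hA
  set φ : MvPolynomial τ A →+* MvPolynomial τ B := eval₂Hom (aeval (R := B) q).toRingHom X with hφ
  -- The target is the quotient of `A[τ]` by the graph relations `q i - X i`. Here `X i` is a scalar
  -- of `A`, of degree 0 in the variables `τ`. As `e` is positive, it does not affect the top form,
  -- which is `qb i`.
  have hflat : Module.Flat A (MvPolynomial τ A ⧸ (⊥ ⊔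
      Ideal.ofList (List.ofFn fun i => map C (q i) - C (X i)) : Ideal (MvPolynomial τ A))) := by
    refine flat_quotient_of_top_regular (k := k) (e := e) _ (List.ofFn qb) ?_ ?_ ⊥ ⊥ ?_ ?_ hreg
    · intro F hF
      obtain ⟨i, rfl⟩ := (List.mem_ofFn' _ _).1 hF
      refine (totalDegree_sub _ _).trans (max_le ?_ (by simp))
      exact (Finset.sup_mono (support_map_subset _ _)).trans (hdeg i)
    · rw [List.map_ofFn, List.map_ofFn]
      congr 1
      funext i
      simp only [Function.comp_apply, map_sub]
      have h1 : homogeneousComponent e (C (X i) : MvPolynomial τ A) = 0 :=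
        homogeneousComponent_eq_zero _ _ (by simpa using he)
      rw [h1, sub_zero]
      ext m
      have := congrArg (coeff m) (htop i)
      rw [coeff_homogeneousComponent] at this ⊢
      rw [coeff_map] at this
      rw [coeff_map, coeff_map, IsScalarTower.algebraMap_apply k B A, ← this]
      split_ifs
      · rfl
      · rw [map_zero]
    · intro b
      rw [Ideal.map_bot, Ideal.map_bot]
      exact IsTopIdeal.bot
    · exact Module.Flat.of_linearEquiv (N := MvPolynomial τ A ⧸ (⊥ : Ideal (MvPolynomial τ A)))
        (M := MvPolynomial τ A) ((Submodule.quotEquivOfEqBot ⊥ rfl).restrictScalars A)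
  rw [bot_sup_eq, ← ker_eval_eq_span] at hflat
  have hsurj : Function.Surjective φ := fun p =>
    ⟨map C p, RingHom.congr_fun (eval_comp_map_C q) p⟩
  algebraize [(aeval (R := B) q : MvPolynomial (Fin s) B →ₐ[B] MvPolynomial τ B).toRingHom]
  let ε := RingHom.quotientKerEquivOfSurjective hsurj
  let e' : (MvPolynomial τ A ⧸ RingHom.ker φ) ≃ₗ[A] MvPolynomial τ B :=
    { ε with
      map_smul' := fun a x => by
        obtain ⟨x, rfl⟩ := Ideal.Quotient.mk_surjective x
        have h1 : a • (Ideal.Quotient.mk (RingHom.ker φ) x) =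
            Ideal.Quotient.mk (RingHom.ker φ) (C a * x) := by
          rw [← smul_eq_C_mul]
          rfl
        have h2 : ε (Ideal.Quotient.mk (RingHom.ker φ) (C a * x)) = φ (C a * x) := rfl
        have h3 : ε (Ideal.Quotient.mk (RingHom.ker φ) x) = φ x := rfl
        have h4 : φ (C a) = algebraMap A (MvPolynomial τ B) a := eval₂Hom_C _ _ _
        change ε (a • (Ideal.Quotient.mk (RingHom.ker φ) x)) =
          a • ε (Ideal.Quotient.mk (RingHom.ker φ) x)
        rw [h1, h2, h3, map_mul, Algebra.smul_def, h4] }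
  exact Module.Flat.of_linearEquiv e'.symm

end MvPolynomial

/-! ### Linear coordinates and flat subalgebras generated by forms -/

namespace MvPolynomial

variable {k : Type u} [Field k] {n : ℕ}

/-- The space of linear forms. -/
abbrev linForms (k : Type u) [Field k] (n : ℕ) : Submodule k (MvPolynomial (Fin n) k) :=
  homogeneousSubmodule (Fin n) k 1

/-- Coordinates on a polynomial ring adapted to a space `W` of linear forms: the inner variables
form a basis of `W`. -/
structure LinCoords (W : Submodule k (MvPolynomial (Fin n) k)) where
  m : ℕ
  t : ℕ
  e : MvPolynomial (Fin t) (MvPolynomial (Fin m) k) ≃ₐ[k] MvPolynomial (Fin n) k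
  finrank_eq : Module.finrank k W = m
  span_eq : Submodule.span k (Set.range fun i => e (C (X i))) = W
  lin : ∀ j, e (X j) ∈ linForms k n
  lin_le : linForms k n ≤ Submodule.span k (Set.range fun j => e (X j)) ⊔ W

instance : FiniteDimensional k (linForms k n) := by
  rw [linForms, homogeneousSubmodule_one_eq_span_X]
  exact FiniteDimensional.span_of_finite k (Set.finite_range _)

theorem finiteDimensional_of_le_linForms {W : Submodule k (MvPolynomial (Fin n) k)}
    (hW : W ≤ linForms k n) : FiniteDimensional k W :=
  Submodule.finiteDimensional_of_le hW

theorem exists_algEquiv_of_basis {ι : Type*} (β : Module.Basis ι k (linForms k n)) :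
    ∃ f : MvPolynomial ι k ≃ₐ[k] MvPolynomial (Fin n) k, ∀ i, f (X i) = β i := by
  let f : MvPolynomial ι k →ₐ[k] MvPolynomial (Fin n) k :=
    aeval fun i => (β i : MvPolynomial (Fin n) k)
  let Λ : (ι →₀ k) →ₗ[k] MvPolynomial ι k := Finsupp.linearCombination k X
  have hX : ∀ i : Fin n, (X i : MvPolynomial (Fin n) k) ∈ linForms k n := fun i =>
    isHomogeneous_X k i
  let g : MvPolynomial (Fin n) k →ₐ[k] MvPolynomial ι k :=
    aeval fun i => Λ (β.repr ⟨X i, hX i⟩)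
  have hg : ∀ l : linForms k n, g l = Λ (β.repr l) := by
    intro l
    obtain ⟨l, hl⟩ := l
    have hl' := hl
    rw [linForms, homogeneousSubmodule_one_eq_span_X] at hl'
    induction hl' using Submodule.span_induction with
    | mem x hx =>
      obtain ⟨i, rfl⟩ := hx
      simp [g]
    | zero =>
      rw [show (⟨0, hl⟩ : linForms k n) = 0 from rfl]
      simp
    | add x y hx hy ihx ihy =>
      have hx' : x ∈ linForms k n := by rwa [linForms, homogeneousSubmodule_one_eq_span_X]
      have hy' : y ∈ linForms k n := by rwa [linForms, homogeneousSubmodule_one_eq_span_X]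
      rw [show (⟨x + y, hl⟩ : linForms k n) = ⟨x, hx'⟩ + ⟨y, hy'⟩ from rfl]
      have h1 := ihx hx'
      have h2 := ihy hy'
      simp only [map_add, Submodule.coe_add] at h1 h2 ⊢
      rw [h1, h2]
    | smul c x hx ihx =>
      have hx' : x ∈ linForms k n := by rwa [linForms, homogeneousSubmodule_one_eq_span_X]
      rw [show (⟨c • x, hl⟩ : linForms k n) = c • ⟨x, hx'⟩ from rfl]
      have h1 := ihx hx'
      simp only [map_smul, Submodule.coe_smul] at h1 ⊢
      rw [h1]
  have hfΛ : ∀ v : ι →₀ k, f (Λ v) = ((β.repr.symm v : linForms k n) : MvPolynomial (Fin n) k) := by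
    intro v
    rw [Module.Basis.repr_symm_apply, Finsupp.linearCombination_apply,
      Finsupp.linearCombination_apply, Finsupp.sum, Finsupp.sum, map_sum, Submodule.coe_sum]
    exact Finset.sum_congr rfl fun i _ => by simp [f]
  refine ⟨AlgEquiv.ofAlgHom f g ?_ ?_, fun i => by simp [f]⟩
  · ext1 i
    simp only [AlgHom.coe_comp, Function.comp_apply, g, aeval_X, hfΛ]
    simp
  · ext1 i
    simp only [AlgHom.coe_comp, Function.comp_apply, AlgHom.coe_id, id_eq]
    rw [show f (X i) = β i by simp [f], hg, Module.Basis.repr_self]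
    simp [Λ]

theorem _root_.Submodule.exists_basis_sum {k V : Type*} [Field k] [AddCommGroup V] [Module k V]
    [FiniteDimensional k V] (W : Submodule k V) :
    ∃ (t : ℕ) (β : Module.Basis (Fin t ⊕ Fin (Module.finrank k W)) k V),
      Submodule.span k (Set.range fun i => β (Sum.inr i)) = W := by
  obtain ⟨W₂, h⟩ := Submodule.exists_isCompl W
  let b₁ := Module.finBasis k W
  let b₂ := Module.finBasis k W₂
  refine ⟨Module.finrank k W₂, (b₂.prod b₁).map (Submodule.prodEquivOfIsCompl W₂ W h.symm), ?_⟩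
  have : (Set.range fun i => ((b₂.prod b₁).map (Submodule.prodEquivOfIsCompl W₂ W h.symm))
      (Sum.inr i)) = W.subtype '' Set.range b₁ := by
    rw [← Set.range_comp]
    congr 1
    funext i
    simp
  rw [this, Submodule.span_image, b₁.span_eq, Submodule.map_top, Submodule.range_subtype]

theorem exists_linCoords {W : Submodule k (MvPolynomial (Fin n) k)} (hW : W ≤ linForms k n) :
    Nonempty (LinCoords W) := by
  have := finiteDimensional_of_le_linForms hW
  let W₁ : Submodule k (linForms k n) := W.comap (linForms k n).subtype
  obtain ⟨t, β, hβ⟩ := Submodule.exists_basis_sum W₁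
  obtain ⟨f, hf⟩ := exists_algEquiv_of_basis β
  have hW₁ : Submodule.map (linForms k n).subtype W₁ = W := by
    rw [Submodule.map_comap_subtype, inf_eq_right.2 hW]
  have hspan₁ : Submodule.span k (Set.range fun i => (β (Sum.inr i) : MvPolynomial (Fin n) k)) =
      W := by
    have h1 : (Set.range fun i => (β (Sum.inr i) : MvPolynomial (Fin n) k)) =
        (linForms k n).subtype '' (Set.range fun i => β (Sum.inr i)) := by
      rw [← Set.range_comp]
      rfl
    rw [h1, Submodule.span_image, hβ, hW₁]
  refine ⟨⟨Module.finrank k W₁, t, (sumAlgEquiv k _ _).symm.trans f, ?_, ?_, ?_, ?_⟩⟩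
  · conv_lhs => rw [← hW₁]
    exact LinearEquiv.finrank_eq
      (Submodule.equivMapOfInjective _ (Submodule.injective_subtype _) W₁).symm
  · rw [← hspan₁]
    congr 2
    funext i
    rw [AlgEquiv.trans_apply, sumAlgEquiv_symm_C_X, hf]
  · intro j
    rw [AlgEquiv.trans_apply, sumAlgEquiv_symm_X, hf]
    exact (β _).2
  · intro l hl
    have h2 : (⟨l, hl⟩ : linForms k n) ∈ Submodule.span k (Set.range β) := by
      rw [β.span_eq]
      trivial
    have h3 : l ∈ Submodule.span k ((linForms k n).subtype '' Set.range β) := by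
      rw [Submodule.span_image]
      exact ⟨_, h2, rfl⟩
    rw [← hspan₁, ← Submodule.span_union]
    refine Submodule.span_mono ?_ h3
    rintro _ ⟨_, ⟨i, rfl⟩, rfl⟩
    rcases i with j | i
    · left
      refine ⟨j, ?_⟩
      simp only [AlgEquiv.trans_apply, sumAlgEquiv_symm_X, hf]
      rfl
    · right
      exact ⟨i, rfl⟩

namespace LinCoords

variable {W : Submodule k (MvPolynomial (Fin n) k)} (c : LinCoords W)

/-- The quotient map killing `W`. -/
noncomputable def proj : MvPolynomial (Fin n) k →ₐ[k] MvPolynomial (Fin c.t) k :=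
  (mapAlgHom (aeval fun _ => (0 : k))).comp c.e.symm.toAlgHom

/-- The section of `proj`. -/
noncomputable def lift : MvPolynomial (Fin c.t) k →ₐ[k] MvPolynomial (Fin n) k :=
  aeval fun j => c.e (X j)

theorem proj_e_X (j : Fin c.t) : c.proj (c.e (X j)) = X j := by
  simp [proj]

theorem proj_e_C_X (i : Fin c.m) : c.proj (c.e (C (X i))) = 0 := by
  simp [proj]

theorem proj_lift (p : MvPolynomial (Fin c.t) k) : c.proj (c.lift p) = p := by
  have : c.proj.comp c.lift = AlgHom.id k _ := by
    ext1 j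
    simp [lift, proj_e_X]
  exact AlgHom.congr_fun this p

theorem proj_eq_zero_of_mem {w : MvPolynomial (Fin n) k} (hw : w ∈ W) : c.proj w = 0 := by
  rw [← c.span_eq] at hw
  induction hw using Submodule.span_induction with
  | mem x hx =>
    obtain ⟨i, rfl⟩ := hx
    exact c.proj_e_C_X i
  | zero => simp
  | add x y _ _ hx hy => simp [hx, hy]
  | smul a x _ hx => simp [hx]

theorem e_C_X_mem (i : Fin c.m) : c.e (C (X i)) ∈ W := by
  have : c.e (C (X i)) ∈ Submodule.span k (Set.range fun i => c.e (C (X i))) :=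
    Submodule.subset_span ⟨i, rfl⟩
  rwa [c.span_eq] at this

theorem sub_lift_proj_mem (p : MvPolynomial (Fin n) k) :
    p - c.lift (c.proj p) ∈ Ideal.span (W : Set (MvPolynomial (Fin n) k)) := by
  set I := Ideal.span (W : Set (MvPolynomial (Fin n) k))
  rw [← Ideal.Quotient.mk_eq_mk_iff_sub_mem]
  obtain ⟨P, rfl⟩ := c.e.surjective p
  induction P using MvPolynomial.induction_on with
  | C b =>
    induction b using MvPolynomial.induction_on with
    | C a =>
      have : c.e (C (C a)) = C a := c.e.commutes a
      simp [this, algHom_C]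
    | add x y hx hy => simp only [map_add, hx, hy]
    | mul_X x i hx =>
      have : c.e (C (X i)) ∈ I := Ideal.subset_span (c.e_C_X_mem i)
      simp only [map_mul, proj_e_C_X, map_zero, mul_zero, Ideal.Quotient.eq_zero_iff_mem.2 this]
  | add x y hx hy => simp only [map_add, hx, hy]
  | mul_X x j hx => simp [map_mul, hx, proj_e_X, lift]

theorem proj_eq_zero_iff {p : MvPolynomial (Fin n) k} :
    c.proj p = 0 ↔ p ∈ Ideal.span (W : Set (MvPolynomial (Fin n) k)) := by
  constructor
  · intro h
    simpa [h] using c.sub_lift_proj_mem p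
  · intro h
    have : Ideal.span (W : Set (MvPolynomial (Fin n) k)) ≤ RingHom.ker c.proj :=
      Ideal.span_le.2 fun w hw => c.proj_eq_zero_of_mem hw
    exact this h

theorem isHomogeneous_lift {p : MvPolynomial (Fin c.t) k} {d : ℕ} (hp : p.IsHomogeneous d) :
    (c.lift p).IsHomogeneous d := by
  have := hp.aeval (fun j => c.e (X j)) (n := 1) c.lin
  simpa [lift] using this

/-- The top-degree part of a form in the outer variables is its image under `proj`. -/
theorem top_of_isHomogeneous {p : MvPolynomial (Fin n) k} {d : ℕ} (hp : p.IsHomogeneous d) :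
    (c.e.symm p).totalDegree ≤ d ∧ homogeneousComponent d (c.e.symm p) =
      map (algebraMap k (MvPolynomial (Fin c.m) k)) (c.proj p) := by
  have hlin : ∀ l ∈ linForms k n, (c.e.symm l).totalDegree ≤ 1 ∧
      homogeneousComponent 1 (c.e.symm l) =
        map (algebraMap k (MvPolynomial (Fin c.m) k)) (c.proj l) := by
    intro l hl
    obtain ⟨u, hu, w, hw, rfl⟩ := Submodule.mem_sup.1 (c.lin_le hl)
    clear hl
    have hsmul : ∀ (a : k) x, c.e.symm (a • x) = C (C a) * c.e.symm x := by
      intro a x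
      have : c.e.symm (C a) = C (C a) := c.e.symm.commutes a
      rw [smul_eq_C_mul, map_mul, this]
    have hw1 : (c.e.symm w).totalDegree ≤ 1 ∧ homogeneousComponent 1 (c.e.symm w) = 0 := by
      rw [← c.span_eq] at hw
      induction hw using Submodule.span_induction with
      | mem x hx =>
        obtain ⟨i, rfl⟩ := hx
        simp only [AlgEquiv.symm_apply_apply, totalDegree_C, zero_le, true_and]
        exact homogeneousComponent_eq_zero _ _ (by simp)
      | zero => simp
      | add x y _ _ hx hy =>
        rw [map_add, map_add, hx.2, hy.2, add_zero]
        exact ⟨(totalDegree_add _ _).trans (max_le hx.1 hy.1), rfl⟩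
      | smul a x _ hx =>
        rw [hsmul, homogeneousComponent_C_mul, hx.2, mul_zero]
        exact ⟨(totalDegree_mul _ _).trans (by rw [totalDegree_C, zero_add]; exact hx.1), rfl⟩
    have hu1 : (c.e.symm u).totalDegree ≤ 1 ∧ homogeneousComponent 1 (c.e.symm u) =
        map (algebraMap k (MvPolynomial (Fin c.m) k)) (c.proj u) := by
      induction hu using Submodule.span_induction with
      | mem x hx =>
        obtain ⟨j, rfl⟩ := hx
        simp only [AlgEquiv.symm_apply_apply, totalDegree_X, le_refl, proj_e_X, map_X, true_and]
        exact homogeneousComponent_eq_self (isHomogeneous_X _ j)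
      | zero => simp
      | add x y _ _ hx hy =>
        rw [map_add, map_add, map_add, map_add, hx.2, hy.2]
        exact ⟨(totalDegree_add _ _).trans (max_le hx.1 hy.1), rfl⟩
      | smul a x _ hx =>
        rw [hsmul, homogeneousComponent_C_mul, hx.2, map_smul, smul_eq_C_mul, map_mul, map_C]
        exact ⟨(totalDegree_mul _ _).trans (by rw [totalDegree_C, zero_add]; exact hx.1), rfl⟩
    rw [map_add, map_add, map_add, map_add, hw1.2, hu1.2, c.proj_eq_zero_of_mem hw, map_zero]
    exact ⟨(totalDegree_add _ _).trans (max_le hu1.1 hw1.1), rfl⟩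
  -- Forms of degree `d` are spanned by products of `d` linear forms. For a linear form the claim
  -- holds because its part in `W` is constant in the outer variables.
  have hp' : p ∈ linForms k n ^ d := by
    rw [linForms, homogeneousSubmodule_one_pow]
    exact hp
  clear hp
  induction hp' using Submodule.pow_induction_on_left' with
  | algebraMap r =>
    have : c.e.symm (algebraMap k _ r) = C (C r) := c.e.symm.commutes r
    rw [this]
    simp [homogeneousComponent_zero, algebraMap_eq, algHom_C]
  | add x y i _ _ hx hy =>
    rw [map_add, map_add, map_add, map_add, hx.2, hy.2]
    exact ⟨(totalDegree_add _ _).trans (max_le hx.1 hy.1), rfl⟩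
  | mem_mul l hl i x _ hx =>
    have h1 := hlin l hl
    rw [map_mul c.e.symm, map_mul c.proj, map_mul (map _), Nat.succ_eq_add_one, add_comm i 1,
      homogeneousComponent_mul_of_totalDegree_le h1.1 hx.1, h1.2, hx.2]
    exact ⟨(totalDegree_mul _ _).trans (add_le_add h1.1 hx.1), rfl⟩

theorem isHomogeneous_proj {p : MvPolynomial (Fin n) k} {d : ℕ} (hp : p.IsHomogeneous d) :
    (c.proj p).IsHomogeneous d := by
  refine IsHomogeneous.of_map (f := algebraMap k (MvPolynomial (Fin c.m) k))
    (FaithfulSMul.algebraMap_injective _ _) ?_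
  rw [← (c.top_of_isHomogeneous hp).2]
  exact homogeneousComponent_isHomogeneous _ _

theorem mem_range_of_mem_adjoin {s : ℕ} (q : Fin s → MvPolynomial (Fin n) k)
    {p : MvPolynomial (Fin n) k} (hp : p ∈ Algebra.adjoin k ((W : Set _) ∪ Set.range q)) :
    ∃ a : MvPolynomial (Fin s) (MvPolynomial (Fin c.m) k),
      c.e (aeval (fun i => c.e.symm (q i)) a) = p := by
  let Φ : MvPolynomial (Fin s) (MvPolynomial (Fin c.m) k) →ₐ[k] MvPolynomial (Fin n) k :=
    c.e.toAlgHom.comp ((aeval (R := MvPolynomial (Fin c.m) k)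
      (fun i => c.e.symm (q i))).restrictScalars k)
  suffices h : Algebra.adjoin k ((W : Set _) ∪ Set.range q) ≤ Φ.range from h hp
  rw [Algebra.adjoin_le_iff]
  rintro x (hx | ⟨i, rfl⟩)
  · rw [← c.span_eq] at hx
    have : Submodule.span k (Set.range fun i => c.e (C (X i))) ≤ Subalgebra.toSubmodule Φ.range := by
      rw [Submodule.span_le]
      rintro _ ⟨i, rfl⟩
      exact ⟨C (X i), by simp [Φ]⟩
    exact this hx
  · exact ⟨X i, by simp [Φ]⟩

end LinCoords

theorem _root_.PDLT.of_flat_map {A R : Type u} [CommRing A] [CommRing R] (φ : A →+* R) (hφ : φ.Flat)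
    (J : Ideal A) {N : ℕ} (h : PDLT A (A ⧸ J) N) : PDLT R (R ⧸ J.map φ) N := by
  algebraize [φ]
  exact (h.baseChange R).congr (Algebra.TensorProduct.quotIdealMapEquivTensorQuot R J).symm.toLinearEquiv

/-- Ideals with generators in an algebra generated by linear forms `W` and forms `q i` that are
regular modulo `W` have bounded projective dimension. -/
theorem PDLT_of_regular_mod {W : Submodule k (MvPolynomial (Fin n) k)} (c : LinCoords W) {s e : ℕ}
    (he : 0 < e) (q : Fin s → MvPolynomial (Fin n) k) (hq : ∀ i, (q i).IsHomogeneous e)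
    (hreg : RegularModulo ⊥ (List.ofFn fun i => c.proj (q i)))
    (G : Set (MvPolynomial (Fin n) k)) (hG : G ⊆ Algebra.adjoin k ((W : Set _) ∪ Set.range q)) :
    PDLT (MvPolynomial (Fin n) k) (MvPolynomial (Fin n) k ⧸ Ideal.span G)
      (Module.finrank k W + s + 1) := by
  -- Top forms in the outer variables are the images modulo `W`, so regularity modulo `W` gives
  -- flatness over a polynomial ring in `finrank W + s` variables. The ideal is extended from that
  -- ring, where Hilbert's theorem gives the bound.
  have hflat := flat_aeval_of_top_regular (k := k) he (fun i => c.e.symm (q i))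
    (fun i => c.proj (q i)) (fun i => (c.top_of_isHomogeneous (hq i)).1)
    (fun i => (c.top_of_isHomogeneous (hq i)).2) hreg
  let φ : MvPolynomial (Fin s) (MvPolynomial (Fin c.m) k) →+* MvPolynomial (Fin n) k :=
    (c.e : _ →+* MvPolynomial (Fin n) k).comp (aeval (R := MvPolynomial (Fin c.m) k)
      fun i => c.e.symm (q i)).toRingHom
  have hφ : φ.Flat := RingHom.Flat.comp hflat (RingHom.Flat.of_bijective c.e.bijective)
  have hGφ : Ideal.span G = (Ideal.span (φ ⁻¹' G)).map φ := by
    rw [Ideal.map_span, Set.image_preimage_eq_of_subset]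
    intro p hp
    exact c.mem_range_of_mem_adjoin q (hG hp)
  rw [hGφ]
  refine PDLT.of_flat_map φ hφ _ ?_
  have hgd : GlobalDimLT (MvPolynomial (Fin s) (MvPolynomial (Fin c.m) k)) (s + c.m + 1) := by
    have e₁ : MvPolynomial (Fin (s + c.m)) k ≃ₐ[k] MvPolynomial (Fin s) (MvPolynomial (Fin c.m) k) :=
      (renameEquiv k finSumFinEquiv.symm).trans (sumAlgEquiv k (Fin s) (Fin c.m))
    exact (GlobalDimLT.mvPolynomial_fin k (s + c.m)).of_ringEquiv e₁.toRingEquiv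
  rw [c.finrank_eq, add_comm c.m s]
  exact hgd _

end MvPolynomial

/-! ### Ideals generated by linear forms -/

namespace MvPolynomial

/-- Arbitrary coefficients may be replaced by their components of degree `d`. -/
theorem exists_isHomogeneous_coeffs {k σ ι : Type*} [CommRing k] [Fintype ι]
    {z : ι → MvPolynomial σ k} (hz : ∀ i, (z i).IsHomogeneous 1) {p : MvPolynomial σ k} {d : ℕ}
    (hp : p.IsHomogeneous (d + 1)) (h : p ∈ Ideal.span (Set.range z)) :
    ∃ a : ι → MvPolynomial σ k, (∀ i, (a i).IsHomogeneous d) ∧ p = ∑ i, a i * z i := by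
  obtain ⟨a, rfl⟩ := Ideal.mem_span_range_iff_exists_fun.1 h
  refine ⟨fun i => homogeneousComponent d (a i), fun i => homogeneousComponent_isHomogeneous _ _, ?_⟩
  rw [← homogeneousComponent_eq_self hp, map_sum]
  exact Finset.sum_congr rfl fun i _ => homogeneousComponent_mul_isHomogeneous _ (hz i) d

theorem exists_isHomogeneous_pair {k σ : Type*} [CommRing k] {x y p : MvPolynomial σ k} {d : ℕ}
    (hx : x.IsHomogeneous 1) (hy : y.IsHomogeneous 1) (hp : p.IsHomogeneous (d + 1))
    (h : p ∈ Ideal.span {x, y}) :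
    ∃ a b : MvPolynomial σ k, a.IsHomogeneous d ∧ b.IsHomogeneous d ∧ p = a * x + b * y := by
  have h1 : Set.range ![x, y] = {x, y} := by
    rw [Matrix.range_cons, Matrix.range_cons, Matrix.range_empty, Set.union_empty]
    rfl
  obtain ⟨a, ha, rfl⟩ := exists_isHomogeneous_coeffs (z := ![x, y])
    (Fin.forall_fin_two.2 ⟨hx, hy⟩) hp (h1 ▸ h)
  exact ⟨a 0, a 1, ha 0, ha 1, by simp⟩

theorem exists_isHomogeneous_triple {k σ : Type*} [CommRing k] {x y z p : MvPolynomial σ k} {d : ℕ}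
    (hx : x.IsHomogeneous 1) (hy : y.IsHomogeneous 1) (hz : z.IsHomogeneous 1)
    (hp : p.IsHomogeneous (d + 1)) (h : p ∈ Ideal.span {x, y, z}) :
    ∃ a b c : MvPolynomial σ k, a.IsHomogeneous d ∧ b.IsHomogeneous d ∧ c.IsHomogeneous d ∧
      p = a * x + b * y + c * z := by
  have h1 : Set.range ![x, y, z] = {x, y, z} := by
    rw [Matrix.range_cons, Matrix.range_cons, Matrix.range_cons, Matrix.range_empty, Set.union_empty]
    rfl
  obtain ⟨a, ha, rfl⟩ := exists_isHomogeneous_coeffs (z := ![x, y, z])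
    (by intro i; fin_cases i; exacts [hx, hy, hz]) hp (h1 ▸ h)
  exact ⟨a 0, a 1, a 2, ha 0, ha 1, ha 2, by simp [Fin.sum_univ_three]⟩

theorem exists_isHomogeneous_of_dvd {k σ : Type*} [CommRing k] {l p : MvPolynomial σ k} {d e : ℕ}
    (hl : l.IsHomogeneous e) (hp : p.IsHomogeneous (d + e)) (h : l ∣ p) :
    ∃ a : MvPolynomial σ k, a.IsHomogeneous d ∧ p = a * l := by
  obtain ⟨a, rfl⟩ := h
  refine ⟨homogeneousComponent d a, homogeneousComponent_isHomogeneous _ _, ?_⟩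
  rw [← homogeneousComponent_mul_isHomogeneous _ hl, mul_comm a, homogeneousComponent_eq_self hp]

theorem IsHomogeneous.exists_eq_C {k σ : Type*} [CommRing k] {p : MvPolynomial σ k}
    (hp : p.IsHomogeneous 0) : ∃ c : k, p = C c :=
  ⟨coeff 0 p, totalDegree_eq_zero_iff_eq_C.1 (Nat.le_zero.1 hp.totalDegree_le)⟩

variable {k : Type u} [Field k] {n : ℕ}

theorem mem_of_mem_ideal_span {W : Submodule k (MvPolynomial (Fin n) k)} (hW : W ≤ linForms k n)
    {l : MvPolynomial (Fin n) k} (hl : l.IsHomogeneous 1)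
    (h : l ∈ Ideal.span (W : Set (MvPolynomial (Fin n) k))) : l ∈ W := by
  -- The multiplier `a` makes the claim stable under scalar multiplication in the ideal. On
  -- generators only its constant term contributes in degree 1.
  suffices H : ∀ a, homogeneousComponent 1 (a * l) ∈ W by
    simpa [homogeneousComponent_eq_self hl] using H 1
  clear hl
  induction h using Submodule.span_induction with
  | mem w hw =>
    intro a
    have h1 := homogeneousComponent_mul_isHomogeneous a (hW hw : w.IsHomogeneous 1) 0
    rw [zero_add] at h1
    rw [h1, homogeneousComponent_zero, ← smul_eq_C_mul]
    exact W.smul_mem _ hw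
  | zero => simp
  | add p q _ _ hp hq =>
    intro a
    rw [mul_add, map_add]
    exact W.add_mem (hp a) (hq a)
  | smul r p _ hp =>
    intro a
    rw [smul_eq_mul, ← mul_assoc]
    exact hp _

theorem ideal_span_span (s : Set (MvPolynomial (Fin n) k)) :
    Ideal.span (Submodule.span k s : Set (MvPolynomial (Fin n) k)) = Ideal.span s :=
  Submodule.span_span_of_tower k _ s

theorem isPrime_ideal_span {W : Submodule k (MvPolynomial (Fin n) k)} (hW : W ≤ linForms k n) :
    (Ideal.span (W : Set (MvPolynomial (Fin n) k))).IsPrime := by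
  obtain ⟨c⟩ := exists_linCoords hW
  have : Ideal.span (W : Set (MvPolynomial (Fin n) k)) = RingHom.ker c.proj := by
    ext p
    exact c.proj_eq_zero_iff.symm
  rw [this]
  exact RingHom.ker_isPrime _

theorem span_le_linForms {s : Set (MvPolynomial (Fin n) k)} (hs : ∀ l ∈ s, l.IsHomogeneous 1) :
    Submodule.span k s ≤ linForms k n :=
  Submodule.span_le.2 hs

theorem isPrime_ideal_span_set {s : Set (MvPolynomial (Fin n) k)}
    (hs : ∀ l ∈ s, l.IsHomogeneous 1) : (Ideal.span s).IsPrime := by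
  rw [← ideal_span_span]
  exact isPrime_ideal_span (span_le_linForms hs)

theorem mem_span_of_mem_ideal_span {s : Set (MvPolynomial (Fin n) k)}
    (hs : ∀ l ∈ s, l.IsHomogeneous 1) {l : MvPolynomial (Fin n) k} (hl : l.IsHomogeneous 1)
    (h : l ∈ Ideal.span s) : l ∈ Submodule.span k s :=
  mem_of_mem_ideal_span (span_le_linForms hs) hl (by rwa [ideal_span_span])

/-- A quadric in an ideal of linear forms can be written using twice as many linear forms. -/
theorem exists_linForms_of_quadric_mem {W : Submodule k (MvPolynomial (Fin n) k)}
    (hW : W ≤ linForms k n) {p : MvPolynomial (Fin n) k} (hp : p.IsHomogeneous 2)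
    (h : p ∈ Ideal.span (W : Set (MvPolynomial (Fin n) k))) :
    ∃ W' : Submodule k (MvPolynomial (Fin n) k), W ≤ W' ∧ W' ≤ linForms k n ∧
      Module.finrank k W' ≤ 2 * Module.finrank k W ∧ p ∈ Algebra.adjoin k (W' : Set _) := by
  have := finiteDimensional_of_le_linForms hW
  let b := Module.finBasis k W
  let z : Fin (Module.finrank k W) → MvPolynomial (Fin n) k := fun i => b i
  have hzspan : Submodule.span k (Set.range z) = W := by
    have : Set.range z = W.subtype '' Set.range b := by
      rw [← Set.range_comp]
      rfl
    rw [this, Submodule.span_image, b.span_eq, Submodule.map_top, Submodule.range_subtype]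
  obtain ⟨a, ha, hpa⟩ := exists_isHomogeneous_coeffs (z := z) (fun i => hW (b i).2) hp
    (by rw [← ideal_span_span, hzspan]; exact h)
  refine ⟨W ⊔ Submodule.span k (Set.range a), le_sup_left, sup_le hW ?_, ?_, ?_⟩
  · exact span_le_linForms (by rintro _ ⟨i, rfl⟩; exact ha i)
  · have h1 : Module.finrank k (Submodule.span k (Set.range a)) ≤ Module.finrank k W := by
      have := finrank_range_le_card (R := k) a
      rwa [Fintype.card_fin] at this
    have := FiniteDimensional.span_of_finite k (Set.finite_range a)
    have h2 := Submodule.finrank_add_le_finrank_add_finrank W (Submodule.span k (Set.range a))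
    omega
  · rw [hpa]
    refine sum_mem fun i _ => mul_mem (Algebra.subset_adjoin ?_) (Algebra.subset_adjoin ?_)
    · exact Submodule.mem_sup_right (Submodule.subset_span ⟨i, rfl⟩)
    · exact Submodule.mem_sup_left (b i).2

theorem PDLT_of_adjoin {W : Submodule k (MvPolynomial (Fin n) k)} (hW : W ≤ linForms k n)
    {G : Set (MvPolynomial (Fin n) k)} (hG : G ⊆ Algebra.adjoin k (W : Set (MvPolynomial (Fin n) k))) {N : ℕ}
    (hN : Module.finrank k W < N) :
    PDLT (MvPolynomial (Fin n) k) (MvPolynomial (Fin n) k ⧸ Ideal.span G) N := by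
  obtain ⟨c⟩ := exists_linCoords hW
  refine (PDLT_of_regular_mod c (s := 0) (e := 1) one_pos Fin.elim0 (fun i => i.elim0) trivial G
    (hG.trans ?_)).mono (by omega)
  exact Algebra.adjoin_mono Set.subset_union_left

theorem RegularModulo.singleton {S : Type*} [CommRing S] [IsDomain S] {q : S} (hq : q ≠ 0) :
    RegularModulo ⊥ [q] :=
  ⟨fun a ha => by simpa [hq] using ha, trivial⟩

/-- If `q` is regular modulo `W`, the bound is `18 + 1`. Otherwise `q` lies in the ideal of `W` and
becomes a polynomial in at most `2 * 18 = 36` linear forms. -/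
theorem PDLT_of_adjoin_one {W : Submodule k (MvPolynomial (Fin n) k)} (hW : W ≤ linForms k n)
    {q : MvPolynomial (Fin n) k} (hq : q.IsHomogeneous 2)
    {G : Set (MvPolynomial (Fin n) k)} (hG : G ⊆ Algebra.adjoin k ((W : Set _) ∪ {q}))
    (hN : Module.finrank k W ≤ 18) :
    PDLT (MvPolynomial (Fin n) k) (MvPolynomial (Fin n) k ⧸ Ideal.span G) 37 := by
  by_cases h : q ∈ Ideal.span (W : Set (MvPolynomial (Fin n) k))
  · obtain ⟨W', h1, h2, h3, h4⟩ := exists_linForms_of_quadric_mem hW hq h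
    refine PDLT_of_adjoin h2 (hG.trans ?_) (by omega)
    rw [SetLike.coe_subset_coe, Algebra.adjoin_le_iff, Set.union_subset_iff]
    exact ⟨fun w hw => Algebra.subset_adjoin (h1 hw), by simpa using h4⟩
  · obtain ⟨c⟩ := exists_linCoords hW
    rw [← c.proj_eq_zero_iff] at h
    refine (PDLT_of_regular_mod c (s := 1) (e := 2) two_pos ![q] (by simpa using hq)
      (by simpa using RegularModulo.singleton h) G (hG.trans ?_)).mono (by omega)
    exact Algebra.adjoin_mono (by simp)

end MvPolynomial

/-! ### Factors of forms and pairs of quadrics -/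

namespace MvPolynomial

/-- The map scaling all variables by a new variable. -/
noncomputable def scaleHom (k σ : Type*) [CommRing k] :
    MvPolynomial σ k →ₐ[k] Polynomial (MvPolynomial σ k) :=
  aeval fun i => Polynomial.C (X i) * Polynomial.X

theorem scaleHom_monomial {k σ : Type*} [CommRing k] (s : σ →₀ ℕ) (c : k) :
    scaleHom k σ (monomial s c) = Polynomial.C (monomial s c) * Polynomial.X ^ s.degree := by
  rw [scaleHom, aeval_monomial, monomial_eq, Finsupp.degree_apply, ← Finset.prod_pow_eq_pow_sum,
    Finsupp.prod, Finsupp.prod, map_mul, map_prod]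
  simp only [mul_pow, Finset.prod_mul_distrib, map_pow]
  rw [mul_assoc]
  rfl

theorem coeff_scaleHom {k σ : Type*} [CommRing k] (p : MvPolynomial σ k) (i : ℕ) :
    (scaleHom k σ p).coeff i = homogeneousComponent i p := by
  induction p using MvPolynomial.induction_on' with
  | monomial s c =>
    rw [scaleHom_monomial, Polynomial.coeff_C_mul_X_pow,
      homogeneousComponent_of_mem (isHomogeneous_monomial c rfl)]
  | add p q hp hq => rw [map_add, map_add, Polynomial.coeff_add, hp, hq]

theorem scaleHom_injective (k σ : Type*) [CommRing k] : Function.Injective (scaleHom k σ) := by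
  rw [injective_iff_map_eq_zero]
  intro p hp
  rw [← sum_homogeneousComponent p]
  exact Finset.sum_eq_zero fun i _ => by rw [← coeff_scaleHom, hp, Polynomial.coeff_zero]

theorem isHomogeneous_iff_scaleHom {k σ : Type*} [CommRing k] {p : MvPolynomial σ k} {d : ℕ} :
    p.IsHomogeneous d ↔ scaleHom k σ p = Polynomial.C p * Polynomial.X ^ d := by
  constructor
  · intro h
    ext1 i
    rw [coeff_scaleHom, Polynomial.coeff_C_mul_X_pow, homogeneousComponent_of_mem h]
  · intro h
    have := coeff_scaleHom p d
    rw [h, Polynomial.coeff_C_mul_X_pow, if_pos rfl] at this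
    rw [this]
    exact homogeneousComponent_isHomogeneous _ _

theorem isHomogeneous_of_scaleHom {k σ : Type*} [CommRing k] {p : MvPolynomial σ k}
    (h : (scaleHom k σ p).natDegree = (scaleHom k σ p).natTrailingDegree) :
    p.IsHomogeneous (scaleHom k σ p).natDegree := by
  have h1 : ∀ i, i ≠ (scaleHom k σ p).natDegree → homogeneousComponent i p = 0 := by
    intro i hi
    rw [← coeff_scaleHom]
    rcases lt_or_gt_of_ne hi with hi | hi
    · exact Polynomial.coeff_eq_zero_of_lt_natTrailingDegree (h ▸ hi)
    · exact Polynomial.coeff_eq_zero_of_natDegree_lt hi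
  set d := (scaleHom k σ p).natDegree
  have h2 : homogeneousComponent d p = p := by
    conv_rhs => rw [← sum_homogeneousComponent p]
    by_cases hd : d ∈ Finset.range (p.totalDegree + 1)
    · rw [Finset.sum_eq_single_of_mem d hd fun i _ hi => h1 i hi]
    · rw [Finset.sum_eq_zero fun i hi => h1 i fun h => hd (h ▸ hi),
        homogeneousComponent_eq_zero _ _ (by simpa using hd)]
  rw [← h2]
  exact homogeneousComponent_isHomogeneous _ _

/-- Factors of a nonzero form are forms. -/
theorem IsHomogeneous.of_mul {k σ : Type*} [CommRing k] [IsDomain k] {a b : MvPolynomial σ k} {d : ℕ}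
    (h : (a * b).IsHomogeneous d) (h0 : a * b ≠ 0) :
    ∃ e f, a.IsHomogeneous e ∧ b.IsHomogeneous f ∧ e + f = d := by
  have ha : scaleHom k σ a ≠ 0 := fun h => left_ne_zero_of_mul h0
    (scaleHom_injective k σ (by rw [h, map_zero]))
  have hb : scaleHom k σ b ≠ 0 := fun h => right_ne_zero_of_mul h0
    (scaleHom_injective k σ (by rw [h, map_zero]))
  -- Degree and trailing degree in the scaling variable are both additive. They agree for the
  -- product, hence for each factor.
  have h1 := isHomogeneous_iff_scaleHom.1 h
  have h2 := congrArg Polynomial.natDegree h1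
  have h3 := congrArg Polynomial.natTrailingDegree h1
  rw [map_mul, Polynomial.natDegree_mul ha hb, Polynomial.natDegree_C_mul_X_pow _ _ h0] at h2
  rw [map_mul, Polynomial.natTrailingDegree_mul ha hb, Polynomial.natTrailingDegree_mul_X_pow
    (by simpa using h0), Polynomial.natTrailingDegree_C, zero_add] at h3
  have h4 := (scaleHom k σ a).natTrailingDegree_le_natDegree
  have h5 := (scaleHom k σ b).natTrailingDegree_le_natDegree
  exact ⟨_, _, isHomogeneous_of_scaleHom (by omega), isHomogeneous_of_scaleHom (by omega), h2⟩

theorem IsHomogeneous.isUnit_of_degree_eq_zero {k σ : Type*} [Field k] {p : MvPolynomial σ k} {d : ℕ}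
    (hp : p.IsHomogeneous d) (hd : d = 0) (h0 : p ≠ 0) : IsUnit p := by
  subst hd
  obtain ⟨c, rfl⟩ := hp.exists_eq_C
  exact (isUnit_iff_ne_zero.2 fun h => h0 (by rw [h, C_0])).map C

theorem IsHomogeneous.eq_zero_of_isUnit {k σ : Type*} [Field k] {p : MvPolynomial σ k} {d : ℕ}
    (hp : p.IsHomogeneous d) (h : IsUnit p) : d = 0 := by
  have h1 := isUnit_iff_totalDegree_of_isReduced.1 h
  rw [← hp.totalDegree h.ne_zero, h1.2]

/-- Two quadrics over a field are dependent, have a common linear factor, or are coprime. -/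
theorem quadrics_trichotomy {k σ : Type*} [Field k] {q₁ q₂ : MvPolynomial σ k}
    (h₁ : q₁.IsHomogeneous 2) (h₂ : q₂.IsHomogeneous 2) :
    (∃ a b : k, (a ≠ 0 ∨ b ≠ 0) ∧ a • q₁ + b • q₂ = 0) ∨
    (∃ l m₁ m₂ : MvPolynomial σ k, l.IsHomogeneous 1 ∧ m₁.IsHomogeneous 1 ∧ m₂.IsHomogeneous 1 ∧
      q₁ = m₁ * l ∧ q₂ = m₂ * l) ∨ IsRelPrime q₁ q₂ := by
  by_cases h0 : q₁ = 0
  · left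
    exact ⟨1, 0, Or.inl one_ne_zero, by simp [h0]⟩
  by_cases hrel : IsRelPrime q₁ q₂
  · exact Or.inr (Or.inr hrel)
  · unfold IsRelPrime at hrel
    push Not at hrel
    obtain ⟨d, hd1, hd2, hd⟩ := hrel
    obtain ⟨c, rfl⟩ := hd1
    obtain ⟨e, f, he, hf, hef⟩ := h₁.of_mul h0
    have he0 : e ≠ 0 := fun h => hd (he.isUnit_of_degree_eq_zero h (left_ne_zero_of_mul h0))
    obtain rfl | rfl : e = 1 ∨ e = 2 := by omega
    · right; left
      obtain ⟨m₂, hm₂, rfl⟩ := exists_isHomogeneous_of_dvd (d := 1) he h₂ hd2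
      obtain rfl : f = 1 := by omega
      exact ⟨d, c, m₂, he, hf, hm₂, mul_comm _ _, rfl⟩
    · left
      obtain ⟨m₂, hm₂, rfl⟩ := exists_isHomogeneous_of_dvd (d := 0) he (by simpa using h₂) hd2
      obtain rfl : f = 0 := by omega
      obtain ⟨a, rfl⟩ := hf.exists_eq_C
      obtain ⟨b, rfl⟩ := hm₂.exists_eq_C
      have ha : a ≠ 0 := by
        rintro rfl
        simp at h0
      refine ⟨b, -a, Or.inr (neg_ne_zero.2 ha), ?_⟩
      rw [smul_eq_C_mul, smul_eq_C_mul, map_neg]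
      ring

variable {k : Type u} [Field k] {n : ℕ}

theorem RegularModulo.pair {S : Type*} [CommRing S] [IsDomain S] [DecompositionMonoid S]
    {q₁ q₂ : S} (h0 : q₁ ≠ 0) (h : IsRelPrime q₁ q₂) : RegularModulo ⊥ [q₁, q₂] := by
  refine ⟨fun a ha => by simpa [h0] using ha, fun a ha => ?_, trivial⟩
  rw [bot_sup_eq, Ideal.mem_span_singleton] at ha ⊢
  exact h.dvd_of_dvd_mul_right ha

namespace LinCoords

variable {W : Submodule k (MvPolynomial (Fin n) k)} (c : LinCoords W)

theorem mem_span_sup_of_proj_mem {p : MvPolynomial (Fin n) k}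
    {s : Set (MvPolynomial (Fin c.t) k)} (h : c.proj p ∈ Ideal.span s) :
    p ∈ Ideal.span ((W ⊔ Submodule.span k (c.lift '' s) : Submodule k _) :
      Set (MvPolynomial (Fin n) k)) := by
  have h1 := c.sub_lift_proj_mem p
  have h2 : c.lift (c.proj p) ∈ Ideal.span (c.lift '' s) := by
    have := Ideal.mem_map_of_mem c.lift h
    rwa [Ideal.map_span] at this
  have := add_mem (Ideal.span_mono (t := ((W ⊔ Submodule.span k (c.lift '' s) : Submodule k _) :
      Set (MvPolynomial (Fin n) k))) (fun w hw => Submodule.mem_sup_left hw) h1)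
    (Ideal.span_mono (fun w hw => Submodule.mem_sup_right (Submodule.subset_span hw)) h2)
  simpa using this

end LinCoords

theorem smul_add_smul_isHomogeneous {σ : Type*} {p q : MvPolynomial σ k} {d : ℕ}
    (hp : p.IsHomogeneous d) (hq : q.IsHomogeneous d) (a b : k) : (a • p + b • q).IsHomogeneous d :=
  Submodule.add_mem (homogeneousSubmodule σ k d) (Submodule.smul_mem _ a hp)
    (Submodule.smul_mem _ b hq)

theorem adjoin_pair_le {S : Subalgebra k (MvPolynomial (Fin n) k)}
    {W : Submodule k (MvPolynomial (Fin n) k)} {q₁ q₂ : MvPolynomial (Fin n) k}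
    (hW : ∀ w ∈ W, w ∈ S) (h₁ : q₁ ∈ S) (h₂ : q₂ ∈ S) :
    Algebra.adjoin k ((W : Set (MvPolynomial (Fin n) k)) ∪ {q₁, q₂}) ≤ S := by
  rw [Algebra.adjoin_le_iff]
  rintro x (hx | rfl | rfl)
  exacts [hW _ hx, h₁, h₂]

theorem finrank_sup_span_singleton_le {W : Submodule k (MvPolynomial (Fin n) k)}
    (hW : W ≤ linForms k n) (l : MvPolynomial (Fin n) k) :
    Module.finrank k (W ⊔ Submodule.span k {l} : Submodule k _) ≤ Module.finrank k W + 1 := by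
  have := finiteDimensional_of_le_linForms hW
  have h1 := Submodule.finrank_add_le_finrank_add_finrank W (Submodule.span k {l})
  have h2 := finrank_span_le_card (R := k) ({l} : Set (MvPolynomial (Fin n) k))
  simp only [Set.toFinset_singleton, Finset.card_singleton] at h2
  omega

theorem sup_span_singleton_le {W : Submodule k (MvPolynomial (Fin n) k)}
    (hW : W ≤ linForms k n) {l : MvPolynomial (Fin n) k} (hl : l.IsHomogeneous 1) :
    W ⊔ Submodule.span k {l} ≤ linForms k n :=
  sup_le hW (span_le_linForms (by simpa using hl))

/-- The trichotomy for quadrics is applied to the images modulo `W`; a common linear factor there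
lifts to one additional linear form `l`. -/
theorem RegularModulo.pair_or {W : Submodule k (MvPolynomial (Fin n) k)} (c : LinCoords W)
    {q₁ q₂ : MvPolynomial (Fin n) k} (h₁ : q₁.IsHomogeneous 2) (h₂ : q₂.IsHomogeneous 2) :
    RegularModulo ⊥ [c.proj q₁, c.proj q₂] ∨
    (∃ a b : k, (a ≠ 0 ∨ b ≠ 0) ∧ a • q₁ + b • q₂ ∈ Ideal.span (W : Set (MvPolynomial (Fin n) k))) ∨
    ∃ l, l.IsHomogeneous 1 ∧
      q₁ ∈ Ideal.span ((W ⊔ Submodule.span k {l} : Submodule k _) : Set (MvPolynomial (Fin n) k)) ∧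
      q₂ ∈ Ideal.span ((W ⊔ Submodule.span k {l} : Submodule k _) : Set (MvPolynomial (Fin n) k)) := by
  rcases quadrics_trichotomy (c.isHomogeneous_proj h₁) (c.isHomogeneous_proj h₂) with
    ⟨a, b, hab, h⟩ | ⟨l, m₁, m₂, hl, -, -, e₁, e₂⟩ | h
  · right; left
    refine ⟨a, b, hab, ?_⟩
    rw [← c.proj_eq_zero_iff, map_add, map_smul, map_smul, h]
  · right; right
    refine ⟨c.lift l, c.isHomogeneous_lift hl, ?_, ?_⟩
    · rw [← Set.image_singleton]
      exact c.mem_span_sup_of_proj_mem (Ideal.mem_span_singleton.2 ⟨m₁, by rw [e₁, mul_comm]⟩)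
    · rw [← Set.image_singleton]
      exact c.mem_span_sup_of_proj_mem (Ideal.mem_span_singleton.2 ⟨m₂, by rw [e₂, mul_comm]⟩)
  · by_cases h0 : c.proj q₁ = 0
    · right; left
      refine ⟨1, 0, Or.inl one_ne_zero, ?_⟩
      rw [← c.proj_eq_zero_iff]
      simp [h0]
    · exact Or.inl (RegularModulo.pair h0 h)

theorem mem_of_smul_add_smul_mem {A : Subalgebra k (MvPolynomial (Fin n) k)} {a b : k}
    {p q : MvPolynomial (Fin n) k} (hb : b ≠ 0) (hp : p ∈ A) (h : a • p + b • q ∈ A) : q ∈ A := by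
  have h1 := A.smul_mem (A.sub_mem h (A.smul_mem hp a)) b⁻¹
  rwa [add_sub_cancel_left, smul_smul, inv_mul_cancel₀ hb, one_smul] at h1

/-- A regular pair costs `8 + 2`. A combination in the ideal of `W` costs 16 linear forms and leaves
one quadric, within the 18 allowed by `PDLT_of_adjoin_one`. A common linear factor gives 9 forms,
doubled separately for each quadric: `18 + 18 = 36`. -/
theorem PDLT_of_adjoin_two {W : Submodule k (MvPolynomial (Fin n) k)} (hW : W ≤ linForms k n)
    {q₁ q₂ : MvPolynomial (Fin n) k} (h₁ : q₁.IsHomogeneous 2) (h₂ : q₂.IsHomogeneous 2)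
    {G : Set (MvPolynomial (Fin n) k)}
    (hG : G ⊆ Algebra.adjoin k ((W : Set (MvPolynomial (Fin n) k)) ∪ {q₁, q₂}))
    (hN : Module.finrank k W ≤ 8) :
    PDLT (MvPolynomial (Fin n) k) (MvPolynomial (Fin n) k ⧸ Ideal.span G) 37 := by
  obtain ⟨c⟩ := exists_linCoords hW
  rcases RegularModulo.pair_or c h₁ h₂ with h | ⟨a, b, hab, h⟩ | ⟨l, hl, e₁, e₂⟩
  · refine (PDLT_of_regular_mod c (s := 2) (e := 2) two_pos ![q₁, q₂]
      (Fin.forall_fin_two.2 ⟨h₁, h₂⟩) (by simpa using h) G (hG.trans ?_)).mono (by omega)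
    refine Algebra.adjoin_mono (Set.union_subset_union_right _ ?_)
    rintro x (rfl | rfl)
    exacts [⟨0, rfl⟩, ⟨1, rfl⟩]
  · obtain ⟨W', hWW, hW', hfin, hmem⟩ := exists_linForms_of_quadric_mem hW
      (smul_add_smul_isHomogeneous h₁ h₂ a b) h
    have hle : ∀ q : MvPolynomial (Fin n) k, ∀ p ∈ Algebra.adjoin k (W' : Set (MvPolynomial (Fin n) k)),
      p ∈ Algebra.adjoin k ((W' : Set (MvPolynomial (Fin n) k)) ∪ {q}) := fun q p hp =>
        Algebra.adjoin_mono Set.subset_union_left hp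
    have hqm : ∀ q, q ∈ Algebra.adjoin k ((W' : Set (MvPolynomial (Fin n) k)) ∪ {q}) := fun q =>
      Algebra.subset_adjoin (Or.inr rfl)
    rcases hab with ha | hb
    · refine PDLT_of_adjoin_one hW' h₂ (hG.trans ?_) (by omega)
      refine adjoin_pair_le (fun w hw => hle _ _ (Algebra.subset_adjoin (hWW hw))) ?_ (hqm _)
      refine mem_of_smul_add_smul_mem (a := b) (p := q₂) ha (hqm _) ?_
      rw [add_comm]
      exact hle _ _ hmem
    · refine PDLT_of_adjoin_one hW' h₁ (hG.trans ?_) (by omega)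
      refine adjoin_pair_le (fun w hw => hle _ _ (Algebra.subset_adjoin (hWW hw))) (hqm _) ?_
      exact mem_of_smul_add_smul_mem hb (hqm _) (hle _ _ hmem)
  · have hW1 := sup_span_singleton_le hW hl
    have hfin1 := finrank_sup_span_singleton_le hW l
    obtain ⟨W₁, h11, h12, h13, h14⟩ := exists_linForms_of_quadric_mem hW1 h₁ e₁
    obtain ⟨W₂, h21, h22, h23, h24⟩ := exists_linForms_of_quadric_mem hW1 h₂ e₂
    have := finiteDimensional_of_le_linForms h12
    have := finiteDimensional_of_le_linForms h22
    have hfin := Submodule.finrank_add_le_finrank_add_finrank W₁ W₂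
    refine PDLT_of_adjoin (sup_le h12 h22) (hG.trans ?_)
      (show Module.finrank k (W₁ ⊔ W₂ : Submodule k _) < 37 by omega)
    refine adjoin_pair_le (fun w hw => Algebra.subset_adjoin ?_) ?_ ?_
    · exact Submodule.mem_sup_left (h11 (Submodule.mem_sup_left hw))
    · exact Algebra.adjoin_mono (fun x hx => Submodule.mem_sup_left hx) h14
    · exact Algebra.adjoin_mono (fun x hx => Submodule.mem_sup_right hx) h24

end MvPolynomial

/-! ### Elimination modulo a monic quadratic -/

namespace Polynomial

variable {A : Type*} [CommRing A]

/-- If `b₁` is a zero divisor modulo `(b₂, b₃)`, some prime of the base makes `b₁`, `b₂` have a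
common annihilator modulo `b₃`. -/
theorem exists_prime_of_not_regular [IsDomain A] [UniqueFactorizationMonoid A] {b₁ b₂ b₃ : A[X]}
    (h₃ : b₃.Monic) (hreg : ∀ a, b₃ ∣ a * b₂ → b₃ ∣ a) {N : A} (hN : N ≠ 0) {a : A[X]}
    (ha : a ∉ Ideal.span {b₂, b₃}) (hab : a * b₁ ∈ Ideal.span {b₂, b₃})
    (hNa : C N * a ∈ Ideal.span {b₂, b₃}) :
    ∃ π : A, Prime π ∧ ∃ s, s ∉ Ideal.span {C π, b₃} ∧ s * b₁ ∈ Ideal.span {C π, b₃} ∧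
      s * b₂ ∈ Ideal.span {C π, b₃} := by
  induction N using UniqueFactorizationMonoid.induction_on_prime generalizing a with
  | h₁ => exact absurd rfl hN
  | h₂ r hr => exact absurd ((Ideal.unit_mul_mem_iff_mem _ (hr.map C)).1 hNa) ha
  | h₃ N π hN0 hπ ih =>
    -- Primes are stripped from `N` until multiplication by a single prime `π` carries an element
    -- outside the ideal into it. The coefficient `s` of `b₂` in the resulting relation is the
    -- common annihilator.
    by_cases h : C N * a ∈ Ideal.span {b₂, b₃}
    · exact ih hN0 ha hab h
    refine ⟨π, hπ, ?_⟩
    have hπC : Prime (C π) := prime_C_iff.2 hπ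
    have hπ3 : ¬ C π ∣ b₃ := fun hd => hπ.not_isUnit
      (isUnit_of_dvd_one (by simpa [h₃] using C_dvd_iff_dvd_coeff _ _ |>.1 hd b₃.natDegree))
    rw [C_mul, mul_assoc] at hNa
    have hab' : (C N * a) * b₁ ∈ Ideal.span {b₂, b₃} := by
      rw [mul_assoc]
      exact Ideal.mul_mem_left _ _ hab
    generalize C N * a = a at h hNa hab'
    obtain ⟨s, w, hs⟩ := Ideal.mem_span_pair.1 hNa
    obtain ⟨c, d, hc⟩ := Ideal.mem_span_pair.1 hab'
    refine ⟨s, fun hmem => h ?_, ?_, ?_⟩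
    · obtain ⟨s', w', rfl⟩ := Ideal.mem_span_pair.1 hmem
      have h1 : C π ∣ (w' * b₂ + w) * b₃ := ⟨a - s' * b₂, by linear_combination hs⟩
      obtain ⟨z, hz⟩ := (hπC.dvd_or_dvd h1).resolve_right hπ3
      refine Ideal.mem_span_pair.2 ⟨s', z, mul_left_cancel₀ hπC.ne_zero ?_⟩
      linear_combination hs - b₃ * hz
    · obtain ⟨z, hz⟩ := hreg (s * b₁ - C π * c) ⟨C π * d - w * b₁, by
        linear_combination b₁ * hs - C π * hc⟩
      exact Ideal.mem_span_pair.2 ⟨c, z, by linear_combination -hz⟩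
    · exact Ideal.mem_span_pair.2 ⟨a, -w, by linear_combination -hs⟩

/-- Remainders modulo the monic `b₃` are unique, so `π` divides `r` times every coefficient of the
remainder of `s`. Not all of these coefficients are divisible by `π`. -/
theorem dvd_of_mul_C_mem {b₃ s : A[X]} (h₃ : b₃.Monic) {π r : A} (hπ : Prime π)
    (hs : s ∉ Ideal.span {C π, b₃}) (h : s * C r ∈ Ideal.span {C π, b₃}) : π ∣ r := by
  by_contra hr
  apply hs
  obtain ⟨u, v, huv⟩ := Ideal.mem_span_pair.1 h
  have h1 : r • (s %ₘ b₃) = π • (u %ₘ b₃) := by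
    rw [← smul_modByMonic, ← smul_modByMonic, smul_eq_C_mul, smul_eq_C_mul, mul_comm, ← huv,
      add_modByMonic, (modByMonic_eq_zero_iff_dvd h₃).2 (dvd_mul_left b₃ v), add_zero, mul_comm]
  have h2 : C π ∣ s %ₘ b₃ := by
    rw [C_dvd_iff_dvd_coeff]
    intro i
    have := congrArg (coeff · i) h1
    simp only [coeff_smul, smul_eq_mul] at this
    exact (hπ.dvd_or_dvd (Dvd.intro _ this.symm)).resolve_left hr
  obtain ⟨z, hz⟩ := h2
  have h3 := modByMonic_add_div s b₃
  exact Ideal.mem_span_pair.2 ⟨z, s /ₘ b₃, by linear_combination h3 - hz⟩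

variable {b₃ s : A[X]} {L Q p q p' q' π : A}

theorem monic_quadratic [Nontrivial A] : (X ^ 2 + C L * X + C Q).Monic := by
  monicity!

/-- Multiplying `p X + q` by its conjugate `q - p L - p X` gives the norm modulo the monic
quadratic. -/
theorem dvd_norm (hπ : Prime π) [Nontrivial A] (hs : s ∉ Ideal.span {C π, X ^ 2 + C L * X + C Q})
    (h : s * (C p * X + C q) ∈ Ideal.span {C π, X ^ 2 + C L * X + C Q}) :
    π ∣ q ^ 2 - q * p * L + p ^ 2 * Q := by
  refine dvd_of_mul_C_mem monic_quadratic hπ hs ?_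
  have h1 : s * C (q ^ 2 - q * p * L + p ^ 2 * Q) =
      s * (C p * X + C q) * (C q - C p * C L - C p * X) +
        s * C p ^ 2 * (X ^ 2 + C L * X + C Q) := by
    simp only [C_add, C_sub, C_mul, C_pow]
    ring
  rw [h1]
  exact add_mem (Ideal.mul_mem_right _ _ h)
    (Ideal.mul_mem_left _ _ (Ideal.subset_span (by simp)))

theorem dvd_resultant (hπ : Prime π) [Nontrivial A]
    (hs : s ∉ Ideal.span {C π, X ^ 2 + C L * X + C Q})
    (h : s * (C p * X + C q) ∈ Ideal.span {C π, X ^ 2 + C L * X + C Q})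
    (h' : s * (C p' * X + C q') ∈ Ideal.span {C π, X ^ 2 + C L * X + C Q}) :
    π ∣ p' * q - p * q' := by
  refine dvd_of_mul_C_mem monic_quadratic hπ hs ?_
  have h1 : s * C (p' * q - p * q') =
      s * (C p * X + C q) * C p' - s * (C p' * X + C q') * C p := by
    simp only [C_sub, C_mul]
    ring
  rw [h1]
  exact sub_mem (Ideal.mul_mem_right _ _ h) (Ideal.mul_mem_right _ _ h')

end Polynomial

/-! ### Quadrics with a common annihilator modulo a prime -/

namespace MvPolynomial

variable {k : Type u} [Field k] {m : ℕ}

theorem prime_of_isHomogeneous_one {p : MvPolynomial (Fin m) k} (hp : p.IsHomogeneous 1)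
    (h0 : p ≠ 0) : Prime p :=
  (Ideal.span_singleton_prime h0).1 (isPrime_ideal_span_set (by simpa using hp))

/-- A quadric remains irreducible modulo a linear form unless it lies in an ideal of two linear
forms. -/
theorem prime_proj_or {W : Submodule k (MvPolynomial (Fin m) k)} (c : LinCoords W)
    {q : MvPolynomial (Fin m) k} (hq : q.IsHomogeneous 2) :
    Prime (c.proj q) ∨ ∃ l, l.IsHomogeneous 1 ∧
      q ∈ Ideal.span ((W ⊔ Submodule.span k {l} : Submodule k _) : Set (MvPolynomial (Fin m) k)) := by
  by_cases h0 : c.proj q = 0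
  · right
    rw [c.proj_eq_zero_iff] at h0
    exact ⟨0, isHomogeneous_zero _ _ _, Ideal.span_mono (fun w hw => Submodule.mem_sup_left hw) h0⟩
  by_cases h : Irreducible (c.proj q)
  · exact Or.inl h.prime
  right
  have hq' := c.isHomogeneous_proj hq
  have hnu : ¬ IsUnit (c.proj q) := fun h => by simpa using hq'.eq_zero_of_isUnit h
  rw [irreducible_iff] at h
  push Not at h
  obtain ⟨a, b, hab, ha, hb⟩ := h hnu
  rw [hab] at hq' h0
  obtain ⟨e, f, he, hf, hef⟩ := hq'.of_mul h0
  have he0 : e ≠ 0 := fun h => ha (he.isUnit_of_degree_eq_zero h (left_ne_zero_of_mul h0))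
  have hf0 : f ≠ 0 := fun h => hb (hf.isUnit_of_degree_eq_zero h (right_ne_zero_of_mul h0))
  obtain rfl : e = 1 := by omega
  refine ⟨c.lift a, c.isHomogeneous_lift he, ?_⟩
  rw [← Set.image_singleton]
  exact c.mem_span_sup_of_proj_mem (Ideal.mem_span_singleton.2 ⟨b, hab⟩)

open Polynomial in
/-- Linear forms in one more variable. -/
def IsLinear (ℓ : Polynomial (MvPolynomial (Fin m) k)) : Prop :=
  ∃ (e : k) (l : MvPolynomial (Fin m) k), l.IsHomogeneous 1 ∧
    ℓ = Polynomial.C (C e) * Polynomial.X + Polynomial.C l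

theorem isLinear_C {l : MvPolynomial (Fin m) k} (hl : l.IsHomogeneous 1) :
    IsLinear (Polynomial.C l) :=
  ⟨0, l, hl, by simp⟩

theorem isLinear_X_add {l : MvPolynomial (Fin m) k} (hl : l.IsHomogeneous 1) :
    IsLinear (Polynomial.X + Polynomial.C l) :=
  ⟨1, l, hl, by simp⟩

section

variable {L Q p q p' q' π : MvPolynomial (Fin m) k} {s : Polynomial (MvPolynomial (Fin m) k)}

/-- This is the case where the second quadric `q'` is free of `X`. Since `π` divides `q'`, which
lies in no ideal of two linear forms, `π` is `q'` up to a constant. Modulo `p` the norm is `q²`. If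
`π` stays prime modulo `p`, then `q = c' π + p μ` and a combination of the two quadrics is a
multiple of `p (X + μ)`. If not, `π`, and with it `q'`, lies in an ideal of two linear forms. -/
theorem false_of_common_annihilator_aux (hp : p.IsHomogeneous 1) (hq : q.IsHomogeneous 2)
    (hq' : q'.IsHomogeneous 2) (hπ : Prime π)
    (hN : π ∣ q ^ 2 - q * p * L + p ^ 2 * Q) (hN' : π ∣ q' ^ 2)
    (H : ∀ a b : k, a ≠ 0 ∨ b ≠ 0 → ∀ ℓ ℓ' : Polynomial (MvPolynomial (Fin m) k), IsLinear ℓ →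
      IsLinear ℓ' → Polynomial.C (C a) * (Polynomial.C p * Polynomial.X + Polynomial.C q) +
        Polynomial.C (C b) * Polynomial.C q' ∉ Ideal.span {ℓ, ℓ'}) : False := by
  have hmem : ∀ l l' : MvPolynomial (Fin m) k, l.IsHomogeneous 1 → l'.IsHomogeneous 1 →
      q' ∉ Ideal.span {l, l'} := by
    intro l l' hl hl' h
    apply H 0 1 (Or.inr one_ne_zero) _ _ (isLinear_C hl) (isLinear_C hl')
    have := Ideal.mem_map_of_mem Polynomial.C h
    rw [Ideal.map_span, Set.image_pair] at this
    simpa using this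
  have hq'0 : q' ≠ 0 := fun h => hmem 0 0 (isHomogeneous_zero _ _ _) (isHomogeneous_zero _ _ _)
    (by rw [h]; exact zero_mem _)
  obtain ⟨γ, rfl⟩ := hπ.dvd_of_dvd_pow hN'
  obtain ⟨e, f, he, hf, hef⟩ := hq'.of_mul hq'0
  have he0 : e ≠ 0 := fun h => hπ.not_isUnit (he.isUnit_of_degree_eq_zero h hπ.ne_zero)
  obtain rfl | rfl : e = 1 ∨ e = 2 := by omega
  · exact hmem π π he he (Ideal.mul_mem_right _ _ (Ideal.subset_span (by simp)))
  obtain rfl : f = 0 := by omega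
  obtain ⟨c, rfl⟩ := hf.exists_eq_C
  have hc : c ≠ 0 := by
    rintro rfl
    simp at hq'0
  have key : ∀ (c' : k) (μ : MvPolynomial (Fin m) k), μ.IsHomogeneous 1 → q ≠ C c' * π + p * μ := by
    rintro c' μ hμ rfl
    apply H c (-c') (Or.inl hc) _ _ (isLinear_C hp) (isLinear_C hp)
    refine Ideal.mem_span_pair.2
      ⟨Polynomial.C (C c) * (Polynomial.X + Polynomial.C μ), 0, ?_⟩
    simp only [map_add, map_mul, map_neg]
    ring
  by_cases hp0 : p = 0
  · subst hp0
    have h1 : π ∣ q ^ 2 := by simpa using hN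
    obtain ⟨a, ha, rfl⟩ := exists_isHomogeneous_of_dvd (d := 0) he (by simpa using hq)
      (hπ.dvd_of_dvd_pow h1)
    obtain ⟨c', rfl⟩ := ha.exists_eq_C
    exact key c' 0 (isHomogeneous_zero _ _ _) (by simp)
  have hW : Submodule.span k {p} ≤ linForms k m := span_le_linForms (by simpa using hp)
  obtain ⟨c'⟩ := exists_linCoords hW
  have hker : ∀ r, c'.proj r = 0 ↔ p ∣ r := by
    intro r
    rw [c'.proj_eq_zero_iff, ideal_span_span, Ideal.mem_span_singleton]
  rcases prime_proj_or c' he with h | ⟨l, hl, h⟩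
  · have h1 : c'.proj π ∣ c'.proj q := by
      obtain ⟨ρ, hρ⟩ := hN
      have h2 := congrArg c'.proj hρ
      have hpp : c'.proj p = 0 := (hker p).2 dvd_rfl
      simp only [map_add, map_sub, map_mul, map_pow, hpp] at h2
      exact h.dvd_of_dvd_pow (n := 2) ⟨c'.proj ρ, by rw [← h2]; ring⟩
    obtain ⟨a, ha, h3⟩ := exists_isHomogeneous_of_dvd (d := 0) (c'.isHomogeneous_proj he)
      (by simpa using c'.isHomogeneous_proj hq) h1
    obtain ⟨a, rfl⟩ := ha.exists_eq_C
    have h4 : p ∣ q - C a * π := by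
      rw [← hker, map_sub, map_mul, h3, algHom_C, algebraMap_eq, sub_self]
    have h5 : (q - C a * π).IsHomogeneous (1 + 1) := by
      rw [← smul_eq_C_mul, sub_eq_add_neg, ← neg_smul]
      simpa using smul_add_smul_isHomogeneous hq he 1 (-a)
    obtain ⟨μ, hμ, h6⟩ := exists_isHomogeneous_of_dvd hp h5 h4
    exact key a μ hμ (by linear_combination h6)
  · refine hmem p l hp hl ?_
    have : Submodule.span k {p} ⊔ Submodule.span k {l} = Submodule.span k {p, l} := by
      rw [Submodule.span_insert]
    rw [this, ideal_span_span] at h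
    exact Ideal.mul_mem_right _ _ h

/-- Put `p' q - p q' = π δ`. Comparison with the norm modulo `p` gives `q δ ∈ (p, p')`, hence `δ = v
p + u p'`. It follows that `q = π u + p μ` and `q' = -π v + p' μ`. If `π` has degree 2, then `u`,
`v` are constants and the combination `v, u` of the quadrics is `(v p + u p') (X + μ)`. If `π` is
linear, the first quadric lies in `(X + μ, π)`. -/
theorem false_of_common_annihilator_of_independent (hp : p.IsHomogeneous 1)
    (hp' : p'.IsHomogeneous 1) (hq : q.IsHomogeneous 2) (hq' : q'.IsHomogeneous 2) (hπ : Prime π)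
    (hp0 : p ≠ 0) (hpp : ¬ p ∣ p')
    (hN : π ∣ q ^ 2 - q * p * L + p ^ 2 * Q) (hD : π ∣ p' * q - p * q')
    (H : ∀ a b : k, a ≠ 0 ∨ b ≠ 0 → ∀ ℓ ℓ' : Polynomial (MvPolynomial (Fin m) k), IsLinear ℓ →
      IsLinear ℓ' → Polynomial.C (C a) * (Polynomial.C p * Polynomial.X + Polynomial.C q) +
        Polynomial.C (C b) * (Polynomial.C p' * Polynomial.X + Polynomial.C q') ∉
        Ideal.span {ℓ, ℓ'}) : False := by
  have hpr := prime_of_isHomogeneous_one hp hp0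
  have H2 : ∀ ℓ ℓ' : Polynomial (MvPolynomial (Fin m) k), IsLinear ℓ →
      IsLinear ℓ' → (Polynomial.C p * Polynomial.X + Polynomial.C q) ∉ Ideal.span {ℓ, ℓ'} := by
    intro ℓ ℓ' h h'
    simpa using H 1 0 (Or.inl one_ne_zero) ℓ ℓ' h h'
  have hpq' : q ∉ Ideal.span {p, p'} := by
    intro h
    obtain ⟨a, b, hab⟩ := Ideal.mem_span_pair.1 h
    refine H2 _ _ (isLinear_C hp) (isLinear_C hp') (Ideal.mem_span_pair.2
      ⟨Polynomial.X + Polynomial.C a, Polynomial.C b, ?_⟩)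
    rw [← hab]
    simp only [map_add, map_mul]
    ring
  have hpq : ¬ p ∣ q := by
    rintro ⟨a, rfl⟩
    exact hpq' (Ideal.mul_mem_right _ _ (Ideal.subset_span (by simp)))
  obtain ⟨δ, hδ⟩ := hD
  obtain ⟨ρ, hρ⟩ := hN
  have hD0 : p' * q - p * q' ≠ 0 := by
    intro h
    exact (hpr.dvd_or_dvd (show p ∣ p' * q from ⟨q', by linear_combination h⟩)).elim hpp hpq
  have hDh : (π * δ).IsHomogeneous 3 := by
    rw [← hδ]
    exact (homogeneousSubmodule _ k 3).sub_mem (hp'.mul hq) (hp.mul hq')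
  obtain ⟨e, f, he, hf, hef⟩ := hDh.of_mul (hδ ▸ hD0)
  have he0 : e ≠ 0 := fun h => hπ.not_isUnit (he.isUnit_of_degree_eq_zero h hπ.ne_zero)
  have hpπ : ¬ p ∣ π := by
    rintro ⟨r, rfl⟩
    exact hpq (hpr.dvd_of_dvd_pow (n := 2)
      ⟨r * ρ + q * L - p * Q, by linear_combination hρ⟩)
  -- Modulo `p`, both `π q δ` and `π p' ρ` are `p' q²`, and `p` does not divide `π`.
  have hmem : q * δ ∈ Ideal.span {p, p'} := by
    obtain ⟨z, hz⟩ := (hpr.dvd_or_dvd (show p ∣ π * (q * δ - p' * ρ) from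
      ⟨p' * q * L - p * p' * Q - q * q', by linear_combination p' * hρ - q * hδ⟩)).resolve_left hpπ
    exact Ideal.mem_span_pair.2 ⟨z, ρ, by linear_combination -hz⟩
  have hprime : (Ideal.span {p, p'}).IsPrime := isPrime_ideal_span_set (by
    rintro l (rfl | rfl)
    exacts [hp, hp'])
  have hδmem := (hprime.mem_or_mem hmem).resolve_left hpq'
  have hδ0 : δ ≠ 0 := by
    rintro rfl
    exact hD0 (by rw [hδ, mul_zero])
  obtain _ | f := f
  · exact hprime.ne_top (Ideal.eq_top_of_isUnit_mem _ hδmem (hf.isUnit_of_degree_eq_zero rfl hδ0))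
  obtain ⟨v, u, hv, hu, rfl⟩ := exists_isHomogeneous_pair hp hp' hf hδmem
  have hqh : (q - π * u).IsHomogeneous (1 + 1) := by
    refine (homogeneousSubmodule _ k 2).sub_mem hq ?_
    change (π * u).IsHomogeneous (1 + 1)
    rw [show 1 + 1 = e + f by omega]
    exact he.mul hu
  obtain ⟨μ, hμ, hqμ⟩ := exists_isHomogeneous_of_dvd hp hqh ((hpr.dvd_or_dvd
    (show p ∣ p' * (q - π * u) from ⟨q' + π * v, by linear_combination hδ⟩)).resolve_left hpp)
  have hq'μ : q' = -π * v + p' * μ :=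
    mul_left_cancel₀ hp0 (by linear_combination p' * hqμ - hδ)
  obtain ⟨rfl, rfl⟩ | ⟨rfl, rfl⟩ : f = 0 ∧ e = 2 ∨ f = 1 ∧ e = 1 := by omega
  · obtain ⟨v, rfl⟩ := hv.exists_eq_C
    obtain ⟨u, rfl⟩ := hu.exists_eq_C
    have huv : v ≠ 0 ∨ u ≠ 0 := by
      by_contra! h
      simp [h.1, h.2] at hδ0
    have hl : (v • p + u • p').IsHomogeneous 1 := smul_add_smul_isHomogeneous hp hp' v u
    apply H v u huv _ _ (isLinear_C hl) (isLinear_C hl)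
    refine Ideal.mem_span_pair.2 ⟨Polynomial.X + Polynomial.C μ, 0, ?_⟩
    rw [hq'μ, show q = π * C u + μ * p by linear_combination hqμ]
    simp only [smul_eq_C_mul, map_add, map_mul, map_neg]
    ring
  · apply H2 _ _ (isLinear_X_add hμ) (isLinear_C he)
    refine Ideal.mem_span_pair.2 ⟨Polynomial.C p, Polynomial.C u, ?_⟩
    rw [show q = π * u + μ * p by linear_combination hqμ]
    simp only [map_add, map_mul]
    ring

end

end MvPolynomial

namespace MvPolynomial

variable {k : Type u} [Field k] {m n : ℕ}

/-- When one of `p`, `p'` is a multiple of the other, a combination of the quadrics is free of `X`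
and the auxiliary case applies. Otherwise the independent case does. -/
theorem false_of_common_annihilator {L Q p q p' q' π : MvPolynomial (Fin m) k}
    {s : Polynomial (MvPolynomial (Fin m) k)} (hp : p.IsHomogeneous 1)
    (hp' : p'.IsHomogeneous 1) (hq : q.IsHomogeneous 2) (hq' : q'.IsHomogeneous 2) (hπ : Prime π)
    (hs : s ∉ Ideal.span {Polynomial.C π,
      Polynomial.X ^ 2 + Polynomial.C L * Polynomial.X + Polynomial.C Q})
    (h : s * (Polynomial.C p * Polynomial.X + Polynomial.C q) ∈ Ideal.span {Polynomial.C π,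
      Polynomial.X ^ 2 + Polynomial.C L * Polynomial.X + Polynomial.C Q})
    (h' : s * (Polynomial.C p' * Polynomial.X + Polynomial.C q') ∈ Ideal.span {Polynomial.C π,
      Polynomial.X ^ 2 + Polynomial.C L * Polynomial.X + Polynomial.C Q})
    (H : ∀ a b : k, a ≠ 0 ∨ b ≠ 0 → ∀ ℓ ℓ' : Polynomial (MvPolynomial (Fin m) k), IsLinear ℓ →
      IsLinear ℓ' → Polynomial.C (C a) * (Polynomial.C p * Polynomial.X + Polynomial.C q) +
        Polynomial.C (C b) * (Polynomial.C p' * Polynomial.X + Polynomial.C q') ∉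
        Ideal.span {ℓ, ℓ'}) : False := by
  by_cases hp0 : p = 0
  · subst hp0
    refine false_of_common_annihilator_aux (L := L) (Q := Q) hp' hq' hq hπ
      (Polynomial.dvd_norm hπ hs h') (by simpa using Polynomial.dvd_norm hπ hs h) ?_
    intro a b hab ℓ ℓ' hℓ hℓ' hmem
    refine H b a hab.symm ℓ ℓ' hℓ hℓ' ?_
    rw [add_comm]
    simpa using hmem
  by_cases hpp : p ∣ p'
  · obtain ⟨c, hc, rfl⟩ := exists_isHomogeneous_of_dvd (d := 0) hp (by simpa using hp') hpp
    obtain ⟨c, rfl⟩ := hc.exists_eq_C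
    have h3 : (q' - C c * q).IsHomogeneous 2 := by
      have := smul_add_smul_isHomogeneous hq' hq 1 (-c)
      rwa [one_smul, neg_smul, ← sub_eq_add_neg, smul_eq_C_mul] at this
    have h2 : s * (Polynomial.C 0 * Polynomial.X + Polynomial.C (q' - C c * q)) ∈
        Ideal.span {Polynomial.C π,
      Polynomial.X ^ 2 + Polynomial.C L * Polynomial.X + Polynomial.C Q} := by
      convert sub_mem h' (Ideal.mul_mem_left _ (Polynomial.C (C c)) h) using 1
      simp only [map_sub, map_mul, map_zero]
      ring
    refine false_of_common_annihilator_aux (L := L) (Q := Q) hp hq h3 hπ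
      (Polynomial.dvd_norm hπ hs h) (by simpa using Polynomial.dvd_norm hπ hs h2) ?_
    intro a b hab ℓ ℓ' hℓ hℓ' hmem
    refine H (a - b * c) b ?_ ℓ ℓ' hℓ hℓ' ?_
    · by_contra! hh
      obtain ⟨hh, rfl⟩ := hh
      simp_all
    · convert hmem using 1
      simp only [map_sub, map_mul]
      ring
  · exact false_of_common_annihilator_of_independent hp hp' hq hq' hπ hp0 hpp
      (Polynomial.dvd_norm hπ hs h) (Polynomial.dvd_resultant hπ hs h h') H

theorem IsHomogeneous.mem_span_X {σ : Type*} {p : MvPolynomial σ k} {d : ℕ}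
    (hp : p.IsHomogeneous (d + 1)) : p ∈ Ideal.span (Set.range (X : σ → MvPolynomial σ k)) := by
  rw [p.as_sum]
  refine sum_mem fun s hs => ?_
  have h1 := hp (mem_support_iff.1 hs)
  have h2 : s ≠ 0 := by
    rintro rfl
    simp at h1
  obtain ⟨i, hi⟩ := Finsupp.ne_iff.1 h2
  have h3 : s = (s - Finsupp.single i 1) + Finsupp.single i 1 :=
    (tsub_add_cancel_of_le (Finsupp.single_le_iff.2 (Nat.one_le_iff_ne_zero.2 hi))).symm
  rw [h3, monomial_add_single, pow_one]
  exact Ideal.mul_mem_left _ _ (Ideal.subset_span ⟨i, rfl⟩)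

theorem IsHomogeneous.exists_matrix {b : MvPolynomial (Fin n) k} (hb : b.IsHomogeneous 2) :
    ∃ M : Fin n → Fin n → k, b = ∑ i, ∑ j, C (M i j) * X j * X i := by
  obtain ⟨a, ha, rfl⟩ := exists_isHomogeneous_coeffs (fun i => isHomogeneous_X k i) hb hb.mem_span_X
  have h1 : ∀ i, ∃ c : Fin n → k, a i = ∑ j, C (c j) * X j := by
    intro i
    obtain ⟨c, hc, h⟩ := exists_isHomogeneous_coeffs (fun i => isHomogeneous_X k i) (d := 0) (ha i)
      (IsHomogeneous.mem_span_X (d := 0) (ha i))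
    choose c' hc' using fun j => (hc j).exists_eq_C
    exact ⟨c', by rw [h]; simp only [hc']⟩
  choose M hM using h1
  refine ⟨M, Finset.sum_congr rfl fun i _ => ?_⟩
  rw [hM, Finset.sum_mul]

/-- A nonzero quadric does not vanish identically, over any field. -/
theorem IsHomogeneous.exists_eval_ne_zero {b : MvPolynomial (Fin n) k} (hb : b.IsHomogeneous 2)
    (h0 : b ≠ 0) : ∃ v : Fin n → k, eval v b ≠ 0 := by
  by_contra! H
  obtain ⟨M, rfl⟩ := hb.exists_matrix
  -- Values at `eᵢ` and `eᵢ + eⱼ` recover the coefficients of `Xᵢ²` and `Xᵢ Xⱼ`. In degree 2 this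
  -- works over every field, including the field with two elements.
  have hev : ∀ v : Fin n → k, ∑ i, ∑ j, M i j * v j * v i = 0 := by
    intro v
    simpa [map_sum] using H v
  have hdiag : ∀ i, M i i = 0 := by
    intro i
    simpa [Pi.single_apply] using hev (Pi.single i 1)
  have hoff : ∀ i j, M i j + M j i = 0 := by
    intro i j
    have := hev (Pi.single i 1 + Pi.single j 1)
    simp only [Pi.add_apply, mul_add, add_mul, Finset.sum_add_distrib, Pi.single_apply] at this
    simp [hdiag] at this
    linear_combination this
  apply h0
  rw [← Finset.sum_product']
  refine Finset.sum_involution (fun a _ => (a.2, a.1)) ?_ ?_ (by simp) (by simp)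
  · rintro ⟨i, j⟩ -
    have := congrArg (C : k → MvPolynomial (Fin n) k) (hoff i j)
    rw [C_add, C_0] at this
    linear_combination (X i * X j) * this
  · rintro ⟨i, j⟩ - h1 h2
    simp only [Prod.mk.injEq] at h2
    rw [h2.1] at h1
    simp [hdiag] at h1

/-- Linear coordinates in which a given quadric is monic in the distinguished variable. -/
theorem exists_monic_coordinates {b : MvPolynomial (Fin n) k} (hb : b.IsHomogeneous 2) (h0 : b ≠ 0) :
    ∃ (m : ℕ) (E : Polynomial (MvPolynomial (Fin m) k) ≃ₐ[k] MvPolynomial (Fin n) k),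
      (∀ ℓ, IsLinear ℓ → (E ℓ).IsHomogeneous 1) ∧
      (∀ b' : MvPolynomial (Fin n) k, b'.IsHomogeneous 2 →
        ∃ (α : k) (L Q : MvPolynomial (Fin m) k), L.IsHomogeneous 1 ∧ Q.IsHomogeneous 2 ∧
          b' = E (Polynomial.C (C α) * Polynomial.X ^ 2 + Polynomial.C L * Polynomial.X +
            Polynomial.C Q)) ∧
      ∀ (α : k) (L Q : MvPolynomial (Fin m) k), L.IsHomogeneous 1 → Q.IsHomogeneous 2 →
          b = E (Polynomial.C (C α) * Polynomial.X ^ 2 + Polynomial.C L * Polynomial.X +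
            Polynomial.C Q) → α ≠ 0 := by
  obtain ⟨v, hv⟩ := hb.exists_eval_ne_zero h0
  -- Take the inner variables to be a basis of the linear forms vanishing at `v`. Then the value of
  -- `b` at `v` comes from the `X²` term alone, so its coefficient is nonzero.
  let φ : linForms k n →ₗ[k] k := (aeval v).toLinearMap.comp (linForms k n).subtype
  have hφ : ∀ l, φ l = eval v l := fun l => by simp [φ]
  have hφ0 : φ ≠ 0 := by
    intro h
    apply hv
    obtain ⟨a, ha, rfl⟩ := exists_isHomogeneous_coeffs (fun i => isHomogeneous_X k i) hb
      hb.mem_span_X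
    rw [map_sum]
    refine Finset.sum_eq_zero fun i _ => ?_
    have h1 := hφ ⟨a i, ha i⟩
    rw [h, LinearMap.zero_apply] at h1
    rw [map_mul, ← h1, zero_mul]
  obtain ⟨t, β, hβ⟩ := Submodule.exists_basis_sum (LinearMap.ker φ)
  have ht : t = 1 := by
    have h1 := Module.finrank_eq_card_basis β
    have h2 := Module.Dual.finrank_ker_add_one_of_ne_zero (f := φ) hφ0
    rw [Fintype.card_sum, Fintype.card_fin, Fintype.card_fin] at h1
    omega
  subst ht
  generalize Module.finrank k (LinearMap.ker φ) = m at β hβ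
  let ε : Option (Fin m) ≃ Fin 1 ⊕ Fin m := (Equiv.optionEquivSumPUnit.{0} (Fin m)).trans
    ((Equiv.sumComm _ _).trans (Equiv.sumCongr (Equiv.ofUnique _ _) (Equiv.refl _)))
  obtain ⟨f, hf⟩ := exists_algEquiv_of_basis (β.reindex ε.symm)
  let E : Polynomial (MvPolynomial (Fin m) k) ≃ₐ[k] MvPolynomial (Fin n) k :=
    (optionEquivLeft k (Fin m)).symm.trans f
  have hEX : E Polynomial.X = β (Sum.inl 0) := by
    simp only [E, AlgEquiv.trans_apply, optionEquivLeft_symm_X, hf, Module.Basis.reindex_apply]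
    rfl
  have hEC : ∀ i, E (Polynomial.C (X i)) = β (Sum.inr i) := by
    intro i
    simp only [E, AlgEquiv.trans_apply, optionEquivLeft_symm_C_X, hf, Module.Basis.reindex_apply]
    rfl
  have hECC : ∀ a : k, E (Polynomial.C (C a)) = C a := fun a => E.commutes a
  have hker : ∀ i, φ (β (Sum.inr i)) = 0 := by
    intro i
    have : β (Sum.inr i) ∈ LinearMap.ker φ := by
      rw [← hβ]
      exact Submodule.subset_span ⟨i, rfl⟩
    exact this
  have hEp : ∀ p d, p.IsHomogeneous d → (E (Polynomial.C p)).IsHomogeneous d := by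
    intro p d hp
    have h1 : ∀ p, E (Polynomial.C p) = aeval (fun i => E (Polynomial.C (X i))) p := by
      intro p
      induction p using MvPolynomial.induction_on with
      | C a => rw [hECC, aeval_C, algebraMap_eq]
      | add p q hp hq => simp only [map_add, hp, hq]
      | mul_X p i hp => simp only [map_mul, hp, aeval_X]
    rw [h1]
    simpa using hp.aeval (fun i => E (Polynomial.C (X i))) (n := 1) fun i => by
      rw [hEC]
      exact (β _).2
  have hlin : ∀ l : MvPolynomial (Fin n) k, l.IsHomogeneous 1 → ∃ (e : k) (L : _),
      L.IsHomogeneous 1 ∧ l = E (Polynomial.C (C e) * Polynomial.X + Polynomial.C L) := by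
    intro l hl
    have h1 := congrArg (linForms k n).subtype (β.sum_repr ⟨l, hl⟩)
    rw [Fintype.sum_sum_type, map_add, map_sum, map_sum, Fin.sum_univ_one] at h1
    refine ⟨β.repr ⟨l, hl⟩ (Sum.inl 0), ∑ i, C (β.repr ⟨l, hl⟩ (Sum.inr i)) * X i, ?_, ?_⟩
    · exact IsHomogeneous.sum _ _ _ fun i _ => by
        simpa using (isHomogeneous_C _ _).mul (isHomogeneous_X k i)
    · simp only [map_add, map_mul, map_sum, hEX, hEC, hECC]
      simp only [map_smul, Submodule.subtype_apply, smul_eq_C_mul] at h1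
      exact h1.symm
  refine ⟨m, E, ?_, ?_, ?_⟩
  · rintro _ ⟨e, l, hl, rfl⟩
    rw [map_add, map_mul, hEX, hECC]
    refine IsHomogeneous.add ?_ (hEp l 1 hl)
    rw [← smul_eq_C_mul]
    exact (linForms k n).smul_mem _ (β _).2
  · intro b' hb'
    obtain ⟨a, ha, rfl⟩ := exists_isHomogeneous_coeffs (fun i => isHomogeneous_X k i) hb'
      hb'.mem_span_X
    choose e L hL h using fun i => hlin _ (isHomogeneous_X k i)
    choose e' L' hL' h' using fun i => hlin _ (ha i)
    refine ⟨∑ i, e' i * e i, ∑ i, (C (e' i) * L i + C (e i) * L' i), ∑ i, L' i * L i, ?_, ?_, ?_⟩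
    · refine IsHomogeneous.sum _ _ _ fun i _ => ?_
      rw [← smul_eq_C_mul, ← smul_eq_C_mul]
      exact smul_add_smul_isHomogeneous (hL i) (hL' i) _ _
    · exact IsHomogeneous.sum _ _ _ fun i _ => (hL' i).mul (hL i)
    · have h1 : ∀ i, a i * X i = E ((Polynomial.C (C (e' i)) * Polynomial.X + Polynomial.C (L' i)) *
          (Polynomial.C (C (e i)) * Polynomial.X + Polynomial.C (L i))) := by
        intro i
        rw [map_mul, ← h, ← h']
      rw [Finset.sum_congr rfl fun i _ => h1 i, ← map_sum]
      congr 1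
      simp only [map_sum, Finset.sum_mul, ← Finset.sum_add_distrib, map_add, map_mul]
      exact Finset.sum_congr rfl fun i _ => by ring
  · rintro α L Q hL hQ rfl rfl
    apply hv
    have hz : ∀ p d, p.IsHomogeneous (d + 1) → eval v (E (Polynomial.C p)) = 0 := by
      intro p d hp
      obtain ⟨a, rfl⟩ := Ideal.mem_span_range_iff_exists_fun.1 hp.mem_span_X
      simp only [map_sum, map_mul, hEC]
      exact Finset.sum_eq_zero fun i _ => by rw [← hφ, hker, mul_zero]
    simp [hz L 0 hL, hz Q 1 hQ, map_add, map_mul]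

end MvPolynomial

/-! ### Regular sequences of three quadrics -/

namespace MvPolynomial

variable {k : Type u} [Field k] {m n : ℕ}

/-- If the norm vanished, regularity would make the monic quadratic divide the conjugate, which has
degree at most 1. The conjugate would be zero, and with it `p` and `q`. -/
theorem norm_ne_zero {A : Type*} [CommRing A] [IsDomain A] {L Q p q : A}
    (h : Polynomial.C p * Polynomial.X + Polynomial.C q ≠ 0)
    (hreg : ∀ a, Polynomial.X ^ 2 + Polynomial.C L * Polynomial.X + Polynomial.C Q ∣
      a * (Polynomial.C p * Polynomial.X + Polynomial.C q) →
      Polynomial.X ^ 2 + Polynomial.C L * Polynomial.X + Polynomial.C Q ∣ a) :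
    q ^ 2 - q * p * L + p ^ 2 * Q ≠ 0 := by
  intro hN
  have h1 := hreg (Polynomial.C (-p) * Polynomial.X + Polynomial.C (q - p * L))
    ⟨-Polynomial.C p ^ 2, by
      have := congrArg Polynomial.C hN
      simp only [map_add, map_sub, map_mul, map_pow, map_zero, map_neg] at this ⊢
      linear_combination this⟩
  have h2 : Polynomial.C (-p) * Polynomial.X + Polynomial.C (q - p * L) = 0 := by
    refine Polynomial.eq_zero_of_dvd_of_natDegree_lt h1 ?_
    refine lt_of_le_of_lt Polynomial.natDegree_linear_le ?_
    have : (Polynomial.X ^ 2 + Polynomial.C L * Polynomial.X + Polynomial.C Q).natDegree = 2 := by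
      compute_degree!
    omega
  have h3 := congrArg (Polynomial.coeff · 1) h2
  have h4 := congrArg (Polynomial.coeff · 0) h2
  simp at h3 h4
  apply h
  rw [h3] at h4 ⊢
  simp at h4
  simp [h4]

theorem exists_monic_form {b : MvPolynomial (Fin n) k} (hb : b.IsHomogeneous 2) (h0 : b ≠ 0) :
    ∃ (m : ℕ) (E : Polynomial (MvPolynomial (Fin m) k) ≃ₐ[k] MvPolynomial (Fin n) k)
      (L Q : MvPolynomial (Fin m) k) (c : k), c ≠ 0 ∧
      (∀ ℓ, IsLinear ℓ → (E ℓ).IsHomogeneous 1) ∧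
      b = E (Polynomial.C (C c) *
        (Polynomial.X ^ 2 + Polynomial.C L * Polynomial.X + Polynomial.C Q)) ∧
      ∀ b' : MvPolynomial (Fin n) k, b'.IsHomogeneous 2 →
        ∃ (α : k) (p q : MvPolynomial (Fin m) k), p.IsHomogeneous 1 ∧ q.IsHomogeneous 2 ∧
          b' = E (Polynomial.C p * Polynomial.X + Polynomial.C q + Polynomial.C (C α) *
            (Polynomial.X ^ 2 + Polynomial.C L * Polynomial.X + Polynomial.C Q)) := by
  obtain ⟨m, E, hE₁, hE₂, hE₃⟩ := exists_monic_coordinates hb h0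
  obtain ⟨α₃, L, Q, hL, hQ, e₃⟩ := hE₂ b hb
  have hα := hE₃ α₃ L Q hL hQ e₃
  have hαα : Polynomial.C (C α₃) * Polynomial.C (C α₃⁻¹) =
      (1 : Polynomial (MvPolynomial (Fin m) k)) := by
    rw [← Polynomial.C_mul, ← C_mul, mul_inv_cancel₀ hα, C_1, Polynomial.C_1]
  have hhom : ∀ {d : ℕ} {P P' : MvPolynomial (Fin m) k} (c : k), P.IsHomogeneous d →
      P'.IsHomogeneous d → (P - C c * (C α₃⁻¹ * P')).IsHomogeneous d := by
    intro d P P' c hP hP'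
    have := smul_add_smul_isHomogeneous hP hP' 1 (-(c * α₃⁻¹))
    rwa [one_smul, neg_smul, ← sub_eq_add_neg, smul_eq_C_mul, C_mul, mul_assoc] at this
  refine ⟨m, E, C α₃⁻¹ * L, C α₃⁻¹ * Q, α₃, hα, hE₁, ?_, ?_⟩
  · rw [e₃]
    refine congrArg E ?_
    rw [Polynomial.C_mul, Polynomial.C_mul]
    linear_combination -(Polynomial.C L * Polynomial.X + Polynomial.C Q) * hαα
  · intro b' hb'
    obtain ⟨α, L₀, Q₀, hL₀, hQ₀, e⟩ := hE₂ b' hb'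
    refine ⟨α, L₀ - C α * (C α₃⁻¹ * L), Q₀ - C α * (C α₃⁻¹ * Q), hhom α hL₀ hL,
      hhom α hQ₀ hQ, ?_⟩
    rw [e]
    refine congrArg E ?_
    simp only [Polynomial.C_sub, Polynomial.C_mul]
    ring

/-- Three quadrics form a regular sequence unless some combination lies in an ideal of two linear
forms. -/
theorem RegularModulo.triple {b₁ b₂ b₃ : MvPolynomial (Fin n) k} (h₁ : b₁.IsHomogeneous 2)
    (h₂ : b₂.IsHomogeneous 2) (h₃ : b₃.IsHomogeneous 2)
    (H : ∀ c₁ c₂ c₃ : k, c₁ ≠ 0 ∨ c₂ ≠ 0 ∨ c₃ ≠ 0 → ∀ l l' : MvPolynomial (Fin n) k,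
      l.IsHomogeneous 1 → l'.IsHomogeneous 1 → c₁ • b₁ + c₂ • b₂ + c₃ • b₃ ∉ Ideal.span {l, l'}) :
    RegularModulo ⊥ [b₃, b₂, b₁] := by
  have hz := isHomogeneous_zero (Fin n) k 1
  have hb₃ : b₃ ≠ 0 := by
    rintro rfl
    exact H 0 0 1 (by simp) 0 0 hz hz (by simp)
  have hrel : IsRelPrime b₃ b₂ := by
    rcases quadrics_trichotomy h₃ h₂ with ⟨a, b, hab, h⟩ | ⟨l, m₁, -, hl, -, -, h, -⟩ | h
    · exact absurd (show (0 : k) • b₁ + b • b₂ + a • b₃ ∈ Ideal.span {0, 0} by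
        rw [zero_smul, zero_add, add_comm, h]
        exact zero_mem _) (H 0 b a (Or.inr hab.symm) 0 0 hz hz)
    · exact absurd (show (0 : k) • b₁ + (0 : k) • b₂ + (1 : k) • b₃ ∈ Ideal.span {l, l} by
        rw [zero_smul, zero_smul, zero_add, zero_add, one_smul, h]
        exact Ideal.mul_mem_left _ _ (Ideal.subset_span (by simp))) (H 0 0 1 (by simp) l l hl hl)
    · exact h
  obtain ⟨hr₁, hr₂, -⟩ := RegularModulo.pair hb₃ hrel
  refine ⟨hr₁, hr₂, fun a ha => ?_, trivial⟩
  rw [bot_sup_eq, ← Ideal.span_union, Set.singleton_union] at ha ⊢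
  simp only [bot_sup_eq, Ideal.mem_span_singleton] at hr₂
  by_contra hna
  -- In coordinates where `b₃` is a constant times a quadric monic in `X`, subtracting multiples of
  -- it makes `b₁` and `b₂` linear in `X`. A zero divisor then yields a common annihilator modulo a
  -- prime of the base, which `false_of_common_annihilator` excludes.
  obtain ⟨m, E, L', Q', α₃, hα, hE₁, E₃, Egen⟩ := exists_monic_form h₃ hb₃
  obtain ⟨α₂, p₂, q₂, hp₂, hq₂, e₂⟩ := Egen b₂ h₂
  obtain ⟨α₁, p₁, q₁, hp₁, hq₁, e₁⟩ := Egen b₁ h₁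
  clear Egen
  have hECC : ∀ a : k, E (Polynomial.C (C a)) = C a := fun a => E.commutes a
  have hαα : Polynomial.C (C α₃) * Polynomial.C (C α₃⁻¹) =
      (1 : Polynomial (MvPolynomial (Fin m) k)) := by
    rw [← Polynomial.C_mul, ← C_mul, mul_inv_cancel₀ hα, C_1, Polynomial.C_1]
  set B : Polynomial (MvPolynomial (Fin m) k) :=
    Polynomial.X ^ 2 + Polynomial.C L' * Polynomial.X + Polynomial.C Q' with hB
  set B₂ := Polynomial.C p₂ * Polynomial.X + Polynomial.C q₂ with hB₂
  set B₁ := Polynomial.C p₁ * Polynomial.X + Polynomial.C q₁ with hB₁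
  have hBb : E B = C α₃⁻¹ * b₃ := by
    rw [E₃, ← hECC, ← map_mul]
    refine congrArg E ?_
    linear_combination -B * hαα
  have hmem : ∀ x, E x ∈ Ideal.span {b₃, b₂} ↔ x ∈ Ideal.span {B₂, B} := by
    intro x
    rw [Ideal.mem_span_pair, Ideal.mem_span_pair]
    constructor
    · rintro ⟨u, v, h⟩
      obtain ⟨u, rfl⟩ := E.surjective u
      obtain ⟨v, rfl⟩ := E.surjective v
      refine ⟨v, u * Polynomial.C (C α₃) + v * Polynomial.C (C α₂), E.injective ?_⟩
      rw [← h, E₃, e₂, ← map_mul, ← map_mul, ← map_add]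
      refine congrArg E ?_
      ring
    · rintro ⟨u, v, rfl⟩
      refine ⟨E (v * Polynomial.C (C α₃⁻¹) - u * Polynomial.C (C α₂) * Polynomial.C (C α₃⁻¹)),
        E u, ?_⟩
      rw [E₃, e₂, ← map_mul, ← map_mul, ← map_add]
      refine congrArg E ?_
      linear_combination (v * B - u * Polynomial.C (C α₂) * B) * hαα
  have hH : ∀ a b : k, a ≠ 0 ∨ b ≠ 0 → ∀ ℓ ℓ' : Polynomial (MvPolynomial (Fin m) k), IsLinear ℓ →
      IsLinear ℓ' → Polynomial.C (C a) * B₂ + Polynomial.C (C b) * B₁ ∉ Ideal.span {ℓ, ℓ'} := by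
    intro a b hab ℓ ℓ' hℓ hℓ' h
    refine H b a (-(a * α₂ + b * α₁) * α₃⁻¹) (by tauto) _ _ (hE₁ _ hℓ) (hE₁ _ hℓ') ?_
    obtain ⟨u, v, huv⟩ := Ideal.mem_span_pair.1 h
    refine Ideal.mem_span_pair.2 ⟨E u, E v, ?_⟩
    rw [← map_mul, ← map_mul, ← map_add, huv, smul_eq_C_mul, smul_eq_C_mul, smul_eq_C_mul,
      ← hECC b, ← hECC a, ← hECC, E₃, e₂, e₁, ← map_mul, ← map_mul, ← map_mul, ← map_add, ← map_add]
    refine congrArg E ?_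
    simp only [map_mul, map_neg, map_add]
    linear_combination (-(Polynomial.C (C a) * Polynomial.C (C α₂) +
      Polynomial.C (C b) * Polynomial.C (C α₁)) * B) * (-hαα)
  have hB3 : ∀ x, b₃ ∣ E x ↔ B ∣ x := by
    intro x
    constructor
    · rintro ⟨u, hu⟩
      obtain ⟨u, rfl⟩ := E.surjective u
      rw [E₃, ← map_mul] at hu
      exact ⟨Polynomial.C (C α₃) * u, by rw [E.injective hu]; ring⟩
    · rintro ⟨u, rfl⟩
      refine ⟨C α₃⁻¹ * E u, ?_⟩
      rw [map_mul, hBb]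
      ring
  have hreg : ∀ z, B ∣ z * B₂ → B ∣ z := by
    intro z hz'
    rw [← hB3]
    apply hr₂
    rw [e₂, ← map_mul, hB3, mul_add]
    exact dvd_add hz' (Dvd.intro_left (z * Polynomial.C (C α₂)) (by ring))
  have hB₂0 : B₂ ≠ 0 := by
    intro h
    refine hH 1 0 (by simp) 0 0 ⟨0, 0, isHomogeneous_zero _ _ _, by simp⟩
      ⟨0, 0, isHomogeneous_zero _ _ _, by simp⟩ ?_
    simp [h]
  obtain ⟨a, rfl⟩ := E.surjective a
  rw [Set.pair_comm, ← Set.pair_comm b₃ b₂] at ha hna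
  -- The constant `N` is the norm of `B₂` modulo `B`. It is a combination of `B₂` and `B`, and
  -- nonzero because `B₂` is regular modulo `B`.
  obtain ⟨π, hπ, s, hs, hs₁, hs₂⟩ := Polynomial.exists_prime_of_not_regular (b₁ := B₁) (a := a)
    Polynomial.monic_quadratic hreg (norm_ne_zero hB₂0 hreg) (by rwa [← hmem]) (by
      rw [e₁, ← map_mul, hmem, mul_add] at ha
      convert sub_mem ha (Ideal.mul_mem_left _ (a * Polynomial.C (C α₁))
        (Ideal.subset_span (show B ∈ {B₂, B} by simp))) using 1
      ring) (by
      refine Ideal.mul_mem_right _ _ (Ideal.mem_span_pair.2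
        ⟨Polynomial.C q₂ - Polynomial.C p₂ * Polynomial.C L' - Polynomial.C p₂ * Polynomial.X,
          Polynomial.C p₂ ^ 2, ?_⟩)
      simp only [hB₂, map_add, map_sub, map_mul, map_pow]
      ring)
  exact false_of_common_annihilator hp₂ hp₁ hq₂ hq₁ hπ hs hs₂ hs₁ hH

end MvPolynomial

/-! ### Two-generated ideals and regular sequences of length three -/

/-- If `a` times each of three elements forming a regular sequence lies in a two-generated ideal of a
factorial domain, then so does `a`. -/
theorem Ideal.mem_span_pair_of_mul_mem_of_isRelPrime {R : Type*} [CommRing R] [IsDomain R]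
    [UniqueFactorizationMonoid R] {c₁ c₂ c₃ g h a : R} (hc₁ : c₁ ≠ 0) (hc₂ : IsRelPrime c₁ c₂)
    (hc₃ : ∀ w, w * c₃ ∈ Ideal.span {c₁, c₂} → w ∈ Ideal.span {c₁, c₂}) (hh : h ≠ 0)
    (hgh : IsRelPrime g h) (h₁ : a * c₁ ∈ Ideal.span {g, h}) (h₂ : a * c₂ ∈ Ideal.span {g, h})
    (h₃ : a * c₃ ∈ Ideal.span {g, h}) : a ∈ Ideal.span {g, h} := by
  obtain ⟨u₁, v₁, e₁⟩ := Ideal.mem_span_pair.1 h₁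
  obtain ⟨u₂, v₂, e₂⟩ := Ideal.mem_span_pair.1 h₂
  obtain ⟨u₃, v₃, e₃⟩ := Ideal.mem_span_pair.1 h₃
  -- Two of the relations differ by a multiple `w` of the trivial syzygy of `g`, `h`. The three
  -- multipliers satisfy a Koszul relation on `c₁`, `c₂`, `c₃`. Exactness of that complex corrects
  -- `u₁`, `v₁` so that both become divisible by `c₁`, and the quotients express `a`.
  have syz : ∀ x y u v u' v' : R, u * g + v * h = a * x → u' * g + v' * h = a * y →
      ∃ w, x * u' - y * u = w * h ∧ x * v' - y * v = -(w * g) := by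
    intro x y u v u' v' e e'
    obtain ⟨w, hw⟩ := hgh.symm.dvd_of_dvd_mul_right (show h ∣ (x * u' - y * u) * g from
      ⟨y * v - x * v', by linear_combination x * e' - y * e⟩)
    refine ⟨w, by rw [hw, mul_comm], mul_right_cancel₀ hh ?_⟩
    linear_combination x * e' - y * e - g * hw
  obtain ⟨w₁₂, p₁₂, q₁₂⟩ := syz _ _ _ _ _ _ e₁ e₂
  obtain ⟨w₁₃, p₁₃, q₁₃⟩ := syz _ _ _ _ _ _ e₁ e₃
  obtain ⟨w₂₃, p₂₃, q₂₃⟩ := syz _ _ _ _ _ _ e₂ e₃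
  have hk : c₁ * w₂₃ - c₂ * w₁₃ + c₃ * w₁₂ = 0 := by
    refine (mul_eq_zero.1 (?_ : _ * h = 0)).resolve_right hh
    linear_combination -c₁ * p₂₃ + c₂ * p₁₃ - c₃ * p₁₂
  obtain ⟨z₁, z₂, hz⟩ := Ideal.mem_span_pair.1 (hc₃ w₁₂ (Ideal.mem_span_pair.2
    ⟨-w₂₃, w₁₃, by linear_combination -hk⟩))
  obtain ⟨z₃, hz₃⟩ := hc₂.dvd_of_dvd_mul_left (show c₁ ∣ c₂ * (w₁₃ - c₃ * z₂) from
    ⟨w₂₃ + c₃ * z₁, by linear_combination -hk - c₃ * hz⟩)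
  have hz₂₃ : w₂₃ + c₃ * z₁ = c₂ * z₃ :=
    mul_left_cancel₀ hc₁ (by linear_combination hk + c₃ * hz + c₂ * hz₃)
  obtain ⟨t, ht⟩ := hc₂.dvd_of_dvd_mul_left (show c₁ ∣ c₂ * (u₁ + z₂ * h) from
    ⟨u₂ - z₁ * h, by linear_combination -p₁₂ + h * hz⟩)
  obtain ⟨t', ht'⟩ := hc₂.dvd_of_dvd_mul_left (show c₁ ∣ c₂ * (v₁ - z₂ * g) from
    ⟨v₂ + z₁ * g, by linear_combination -q₁₂ - g * hz⟩)
  exact Ideal.mem_span_pair.2 ⟨t, t', mul_left_cancel₀ hc₁ (by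
    linear_combination e₁ - g * ht - h * ht')⟩

/-- Dividing by a greatest common divisor `d` of `g` and `h` reduces to coprime generators. Since
`d` divides `a c₁` and `a c₂` with `c₁`, `c₂` coprime, it also divides `a`. -/
theorem Ideal.mem_span_pair_of_mul_mem {R : Type*} [CommRing R] [IsDomain R]
    [UniqueFactorizationMonoid R] {c₁ c₂ c₃ g h a : R} (hc₁ : c₁ ≠ 0) (hc₂ : IsRelPrime c₁ c₂)
    (hc₃ : ∀ w, w * c₃ ∈ Ideal.span {c₁, c₂} → w ∈ Ideal.span {c₁, c₂})
    (h₁ : a * c₁ ∈ Ideal.span {g, h}) (h₂ : a * c₂ ∈ Ideal.span {g, h})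
    (h₃ : a * c₃ ∈ Ideal.span {g, h}) : a ∈ Ideal.span {g, h} := by
  suffices H : ∀ g h : R, h ≠ 0 → a * c₁ ∈ Ideal.span {g, h} → a * c₂ ∈ Ideal.span {g, h} →
      a * c₃ ∈ Ideal.span {g, h} → a ∈ Ideal.span {g, h} by
    by_cases hh : h = 0
    · by_cases hg : g = 0
      · subst hh hg
        have h0 : a * c₁ = 0 := by simpa using h₁
        rw [(mul_eq_zero.1 h0).resolve_right hc₁]
        exact zero_mem _
      · rw [Set.pair_comm] at h₁ h₂ h₃ ⊢
        exact H h g hg h₁ h₂ h₃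
    · exact H g h hh h₁ h₂ h₃
  clear h₁ h₂ h₃
  intro g h hh h₁ h₂ h₃
  obtain ⟨g, h, d, hrel, rfl, rfl⟩ := UniqueFactorizationMonoid.exists_reduced_factors' g h hh
  have hd : ∀ x ∈ Ideal.span {d * g, d * h}, d ∣ x := by
    intro x hx
    obtain ⟨u, v, rfl⟩ := Ideal.mem_span_pair.1 hx
    exact ⟨u * g + v * h, by ring⟩
  have hd0 := left_ne_zero_of_mul hh
  obtain ⟨r₁, hr₁⟩ := hd _ h₁
  obtain ⟨r₂, hr₂⟩ := hd _ h₂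
  obtain ⟨a, rfl⟩ : d ∣ a := by
    obtain ⟨z, rfl⟩ := hc₂.dvd_of_dvd_mul_left (show c₁ ∣ c₂ * r₁ from
      ⟨r₂, mul_left_cancel₀ hd0 (by linear_combination c₁ * hr₂ - c₂ * hr₁)⟩)
    exact ⟨z, mul_left_cancel₀ hc₁ (by linear_combination hr₁)⟩
  have hmem : ∀ x, d * x ∈ Ideal.span {d * g, d * h} ↔ x ∈ Ideal.span {g, h} := by
    intro x
    rw [Ideal.mem_span_pair, Ideal.mem_span_pair]
    refine exists_congr fun u => exists_congr fun v => ?_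
    exact ⟨fun h => mul_left_cancel₀ hd0 (by linear_combination h),
      fun h => by linear_combination d * h⟩
  rw [mul_assoc, hmem] at h₁ h₂ h₃
  rw [hmem]
  exact mem_span_pair_of_mul_mem_of_isRelPrime hc₁ hc₂ hc₃ (right_ne_zero_of_mul hh) hrel h₁ h₂ h₃

/-! ### McCoy's theorem and wide quadrics -/

namespace MvPolynomial

/-- McCoy's theorem. -/
theorem exists_mul_coeff_eq_zero {A σ : Type*} [CommRing A] (m : MonomialOrder σ)
    {a f : MvPolynomial σ A} (ha : a ≠ 0) (h : a * f = 0) :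
    ∃ b : A, b ≠ 0 ∧ ∀ μ, b * coeff μ f = 0 := by
  induction hd : m.toSyn (m.degree a) using WellFoundedLT.induction generalizing a with
  | ind d ih =>
  by_cases hall : ∀ μ, C (coeff μ f) * a = 0
  · refine ⟨m.leadingCoeff a, m.leadingCoeff_ne_zero_iff.2 ha, fun μ => ?_⟩
    have := congrArg (coeff (m.degree a)) (hall μ)
    rwa [coeff_C_mul, coeff_zero, mul_comm] at this
  classical
  push Not at hall
  obtain ⟨μ₁, hμ₁⟩ := hall
  -- Only the terms of `f` whose coefficient does not kill `a` are kept, so `a * f' = 0` and the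
  -- leading coefficients of `a` and `f'` multiply to zero. Hence the leading coefficient of `f'`
  -- times `a` is a nonzero annihilator of `f` of smaller degree.
  let f' : MvPolynomial σ A :=
    ∑ μ ∈ f.support with C (coeff μ f) * a ≠ 0, monomial μ (coeff μ f)
  have hcoeff : ∀ μ, coeff μ f' = if C (coeff μ f) * a ≠ 0 then coeff μ f else 0 := by
    intro μ
    simp only [f', coeff_sum, coeff_monomial, Finset.sum_ite_eq', Finset.mem_filter,
      mem_support_iff]
    by_cases h0 : coeff μ f = 0 <;> simp [h0]
  have hf'0 : f' ≠ 0 := by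
    intro h0
    have := hcoeff μ₁
    rw [if_pos hμ₁, h0, coeff_zero] at this
    rw [← this] at hμ₁
    simp at hμ₁
  have haf' : a * f' = 0 := by
    have h1 : a * ∑ μ ∈ f.support with ¬ C (coeff μ f) * a ≠ 0, monomial μ (coeff μ f) = 0 := by
      rw [Finset.mul_sum]
      refine Finset.sum_eq_zero fun μ hμ => ?_
      have := (Finset.mem_filter.1 hμ).2
      rw [not_not] at this
      rw [← mul_one (coeff μ f), ← C_mul_monomial, ← mul_assoc, mul_comm a, this, zero_mul]
    rw [f.as_sum, ← Finset.sum_filter_add_sum_filter_not f.support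
      (fun μ => C (coeff μ f) * a ≠ 0), mul_add, h1, add_zero] at h
    exact h
  have hμ₀ : C (coeff (m.degree f') f) * a ≠ 0 := by
    intro h0
    have := hcoeff (m.degree f')
    rw [if_neg (not_not.2 h0)] at this
    exact m.coeff_degree_ne_zero_iff.2 hf'0 this
  have hlead : m.leadingCoeff a * coeff (m.degree f') f = 0 := by
    have h1 : m.leadingCoeff f' = coeff (m.degree f') f := by
      have := hcoeff (m.degree f')
      rwa [if_pos hμ₀] at this
    rw [← h1, ← m.coeff_mul_of_degree_add, haf', coeff_zero]
  refine ih _ ?_ hμ₀ (by rw [mul_assoc, h, mul_zero]) rfl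
  rw [← hd]
  refine lt_of_le_of_ne ?_ ?_
  · simpa using m.degree_mul_le (f := C (coeff (m.degree f') f)) (g := a)
  · intro heq
    have h1 := m.coeff_degree_ne_zero_iff.2 hμ₀
    rw [m.toSyn.injective heq, coeff_C_mul, mul_comm] at h1
    exact h1 hlead

variable {k : Type u} [Field k] {n : ℕ}

namespace LinCoords

variable {W : Submodule k (MvPolynomial (Fin n) k)} (c : LinCoords W)

theorem exists_eq_e_C {p : MvPolynomial (Fin n) k} (hp : p ∈ Algebra.adjoin k (W : Set _)) :
    ∃ b, c.e (C b) = p := by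
  let Φ : MvPolynomial (Fin c.m) k →ₐ[k] MvPolynomial (Fin n) k :=
    c.e.toAlgHom.comp (Algebra.ofId _ _ |>.restrictScalars k)
  suffices h : Algebra.adjoin k (W : Set _) ≤ Φ.range from h hp
  rw [Algebra.adjoin_le_iff]
  intro x hx
  rw [← c.span_eq] at hx
  have : Submodule.span k (Set.range fun i => c.e (C (X i))) ≤ Subalgebra.toSubmodule Φ.range := by
    rw [Submodule.span_le]
    rintro _ ⟨i, rfl⟩
    exact ⟨X i, rfl⟩
  exact this hx

/-- A zero divisor modulo an ideal defined over the inner variables, linear in the outer variables,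
has coefficients with a common annihilator. -/
theorem exists_mul_mem {G : Set (MvPolynomial (Fin n) k)}
    (hG : G ⊆ Algebra.adjoin k (W : Set (MvPolynomial (Fin n) k))) {q : MvPolynomial (Fin n) k}
    (hq : q ∈ Algebra.adjoin k (W : Set (MvPolynomial (Fin n) k)))
    {d : Fin c.t → MvPolynomial (Fin n) k}
    (hd : ∀ i, d i ∈ Algebra.adjoin k (W : Set (MvPolynomial (Fin n) k)))
    {a : MvPolynomial (Fin n) k} (ha : a ∉ Ideal.span G)
    (h : a * (q + ∑ i, d i * c.e (X i)) ∈ Ideal.span G) :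
    ∃ β, β ∉ Ideal.span G ∧ ∀ i, β * d i ∈ Ideal.span G := by
  let ι : MvPolynomial (Fin c.m) k →+* MvPolynomial (Fin n) k := (RingHomClass.toRingHom c.e).comp C
  let I : Ideal (MvPolynomial (Fin c.m) k) := Ideal.span (ι ⁻¹' G)
  have hI : Ideal.span G = (I.map C).map (RingHomClass.toRingHom c.e) := by
    rw [Ideal.map_map, Ideal.map_span]
    congr 1
    exact (Set.image_preimage_eq_of_subset fun p hp => c.exists_eq_e_C (hG hp)).symm
  -- The ideal is extended from the inner variables, so the quotient is a polynomial ring over the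
  -- inner quotient. McCoy's theorem then applies to the coefficients of the outer variables.
  have hmem : ∀ P, c.e P ∈ Ideal.span G ↔ map (Ideal.Quotient.mk I) P = 0 := by
    intro P
    have h1 : c.e P ∈ (I.map C).map (RingHomClass.toRingHom c.e) ↔ P ∈ I.map C := by
      constructor
      · intro h
        obtain ⟨x, hx, hxP⟩ := (Ideal.mem_map_iff_of_surjective _ c.e.surjective).1 h
        rwa [← c.e.injective hxP]
      · exact fun h => Ideal.mem_map_of_mem (RingHomClass.toRingHom c.e) h
    rw [hI, h1, ← RingHom.mem_ker, ker_map, Ideal.mk_ker]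
  obtain ⟨q, rfl⟩ := c.exists_eq_e_C hq
  choose d' hd' using fun i => c.exists_eq_e_C (hd i)
  obtain ⟨a, rfl⟩ := c.e.surjective a
  have hf : c.e (C q) + ∑ i, d i * c.e (X i) = c.e (C q + ∑ i, C (d' i) * X i) := by
    simp only [map_add, map_sum, map_mul, hd']
  rw [hf, ← map_mul, hmem, map_mul] at h
  rw [hmem] at ha
  obtain ⟨b, hb, hbf⟩ := exists_mul_coeff_eq_zero MonomialOrder.lex ha h
  obtain ⟨b, rfl⟩ := Ideal.Quotient.mk_surjective b
  refine ⟨c.e (C b), ?_, fun i => ?_⟩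
  · rw [hmem, map_C]
    simpa using hb
  · have h1 := hbf (Finsupp.single i 1)
    rw [coeff_map] at h1
    have h2 : coeff (Finsupp.single i 1) (C q + ∑ i, C (d' i) * X i) = d' i := by
      classical
      rw [coeff_add, coeff_C, if_neg (by simp [eq_comm]), coeff_sum, zero_add]
      simp [coeff_X, Finsupp.single_left_inj, eq_comm]
    rw [h2] at h1
    rw [← hd', ← map_mul, hmem, ← C_mul, map_C, map_mul, h1, C_0]

end LinCoords

end MvPolynomial

namespace MvPolynomial

variable {k : Type u} [Field k] {n : ℕ}

/-- No element outside `I` is multiplied into `I` by three independent linear forms. -/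
def IsLinearlySaturated (I : Ideal (MvPolynomial (Fin n) k)) : Prop :=
  ∀ D : Submodule k (MvPolynomial (Fin n) k), D ≤ linForms k n → 3 ≤ Module.finrank k D →
    ∀ a, (∀ w ∈ D, a * w ∈ I) → a ∈ I

/-- Three independent linear forms are a regular sequence, because linear forms generate prime
ideals. A quotient by two elements has projective dimension at most 2, too small for a nonzero class
to be killed by such a sequence. -/
theorem isLinearlySaturated_span_pair (g h : MvPolynomial (Fin n) k) :
    IsLinearlySaturated (Ideal.span {g, h}) := by
  intro D hD h3 a ha
  obtain ⟨f, hf⟩ := exists_linearIndependent_of_le_finrank h3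
  have hf' : LinearIndependent k fun i => (f i : MvPolynomial (Fin n) k) :=
    hf.map' D.subtype (Submodule.ker_subtype D)
  have hom : ∀ i, (f i : MvPolynomial (Fin n) k).IsHomogeneous 1 := fun i => hD (f i).2
  have h01 : ∀ s : Set (Fin 3), ∀ i ∉ s, (f i : MvPolynomial (Fin n) k) ∉
      Ideal.span ((fun i => (f i : MvPolynomial (Fin n) k)) '' s) := by
    intro s i hi hmem
    refine hf'.notMem_span_image hi ?_
    refine mem_span_of_mem_ideal_span ?_ (hom i) hmem
    rintro _ ⟨j, -, rfl⟩
    exact hom j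
  have hp := prime_of_isHomogeneous_one (hom 0) (hf'.ne_zero 0)
  have hrel : IsRelPrime (f 0 : MvPolynomial (Fin n) k) (f 1) := by
    rw [hp.irreducible.isRelPrime_iff_not_dvd]
    intro hd
    refine h01 {0} 1 (by simp) ?_
    rwa [Set.image_singleton, Ideal.mem_span_singleton]
  refine Ideal.mem_span_pair_of_mul_mem (hf'.ne_zero 0) hrel (fun w hw => ?_) (ha _ (f 0).2)
    (ha _ (f 1).2) (ha _ (f 2).2)
  have hprime : (Ideal.span {(f 0 : MvPolynomial (Fin n) k), (f 1 : MvPolynomial (Fin n) k)}).IsPrime :=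
    isPrime_ideal_span_set (by
      rintro l (rfl | rfl)
      exacts [hom 0, hom 1])
  refine (hprime.mem_or_mem hw).resolve_right fun h => h01 {0, 1} 2 (by decide) ?_
  rwa [Set.image_pair]

/-- `b` is a linear combination of variables outside `W` whose coefficients span at least three
dimensions of `W`, up to a polynomial in `W`. -/
def IsWide (W : Submodule k (MvPolynomial (Fin n) k)) (b : MvPolynomial (Fin n) k) : Prop :=
  ∃ (c : LinCoords W) (q : MvPolynomial (Fin n) k) (d : Fin c.t → MvPolynomial (Fin n) k),
    q ∈ Algebra.adjoin k (W : Set (MvPolynomial (Fin n) k)) ∧ (∀ i, d i ∈ W) ∧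
    b = q + ∑ i, d i * c.e (X i) ∧ 3 ≤ Module.finrank k (Submodule.span k (Set.range d))

theorem IsWide.add {W : Submodule k (MvPolynomial (Fin n) k)} {b p : MvPolynomial (Fin n) k}
    (hb : IsWide W b) (hp : p ∈ Algebra.adjoin k (W : Set (MvPolynomial (Fin n) k))) :
    IsWide W (b + p) := by
  obtain ⟨c, q, d, hq, hd, rfl, h3⟩ := hb
  exact ⟨c, q + p, d, add_mem hq hp, hd, by ring, h3⟩

/-- A zero divisor would give `β ∉ (G)` with `β y dᵢ ∈ (G)` for all `i`. Regularity of `y` removes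
`y`, and the `dᵢ` span at least three dimensions, which contradicts saturation. -/
theorem IsWide.regular {W : Submodule k (MvPolynomial (Fin n) k)} (hW : W ≤ linForms k n)
    {b : MvPolynomial (Fin n) k} (hb : IsWide W b) {G : Set (MvPolynomial (Fin n) k)}
    (hG : G ⊆ Algebra.adjoin k (W : Set (MvPolynomial (Fin n) k)))
    (hsat : IsLinearlySaturated (Ideal.span G)) {e y : MvPolynomial (Fin n) k}
    (he : e ∈ Algebra.adjoin k (W : Set (MvPolynomial (Fin n) k)))
    (hy : y ∈ Algebra.adjoin k (W : Set (MvPolynomial (Fin n) k)))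
    (hreg : ∀ a, a * y ∈ Ideal.span G → a ∈ Ideal.span G) (a : MvPolynomial (Fin n) k)
    (ha : a * (e + y * b) ∈ Ideal.span G) : a ∈ Ideal.span G := by
  obtain ⟨c, q, d, hq, hd, rfl, h3⟩ := hb
  by_contra hna
  have hd' : ∀ i, y * d i ∈ Algebra.adjoin k (W : Set (MvPolynomial (Fin n) k)) := fun i =>
    mul_mem hy (Algebra.subset_adjoin (hd i))
  obtain ⟨β, hβ, h⟩ := c.exists_mul_mem hG (add_mem he (mul_mem hy hq)) hd' hna (by
    convert ha using 2
    rw [mul_add, add_assoc, Finset.mul_sum]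
    simp only [mul_assoc])
  have hspan : Submodule.span k (Set.range d) ≤ W := Submodule.span_le.2 (by
    rintro _ ⟨i, rfl⟩
    exact hd i)
  refine hβ (hsat _ (hspan.trans hW) h3 β fun w hw => ?_)
  induction hw using Submodule.span_induction with
  | mem x hx =>
    obtain ⟨i, rfl⟩ := hx
    exact hreg _ (by rw [mul_assoc, mul_comm (d i)]; exact h i)
  | zero => simp
  | add x z _ _ hx hz =>
    rw [mul_add]
    exact add_mem hx hz
  | smul r x _ hx =>
    rw [smul_eq_C_mul, mul_left_comm]
    exact Ideal.mul_mem_left _ _ hx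

theorem exists_linear_decomposition {W : Submodule k (MvPolynomial (Fin n) k)}
    (hW : W ≤ linForms k n) (c : LinCoords W) {b : MvPolynomial (Fin n) k} (hb : b.IsHomogeneous 2)
    (h : b ∈ Ideal.span (W : Set (MvPolynomial (Fin n) k))) :
    ∃ (q : MvPolynomial (Fin n) k) (d : Fin c.t → MvPolynomial (Fin n) k),
      q ∈ Algebra.adjoin k (W : Set (MvPolynomial (Fin n) k)) ∧ (∀ i, d i ∈ W) ∧
      b = q + ∑ i, d i * c.e (X i) := by
  have := finiteDimensional_of_le_linForms hW
  let β := Module.finBasis k W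
  let z : Fin (Module.finrank k W) → MvPolynomial (Fin n) k := fun i => β i
  have hzspan : Submodule.span k (Set.range z) = W := by
    have : Set.range z = W.subtype '' Set.range β := by
      rw [← Set.range_comp]
      rfl
    rw [this, Submodule.span_image, β.span_eq, Submodule.map_top, Submodule.range_subtype]
  obtain ⟨a, ha, rfl⟩ := exists_isHomogeneous_coeffs (z := z) (fun i => hW (β i).2) hb
    (by rw [← ideal_span_span, hzspan]; exact h)
  have hdec : ∀ i, ∃ (α : Fin c.t → k) (w : MvPolynomial (Fin n) k), w ∈ W ∧
      a i = ∑ j, α j • c.e (X j) + w := by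
    intro i
    obtain ⟨u, hu, w, hw, e⟩ := Submodule.mem_sup.1 (c.lin_le (ha i))
    obtain ⟨α, rfl⟩ := (Submodule.mem_span_range_iff_exists_fun k).1 hu
    exact ⟨α, w, hw, e.symm⟩
  choose α w hw e using hdec
  refine ⟨∑ i, w i * z i, fun j => ∑ i, α i j • z i, ?_, fun j => ?_, ?_⟩
  · exact sum_mem fun i _ => mul_mem (Algebra.subset_adjoin (hw i)) (Algebra.subset_adjoin (β i).2)
  · exact sum_mem fun i _ => W.smul_mem _ (β i).2
  · simp only [Finset.sum_mul]
    rw [Finset.sum_comm, ← Finset.sum_add_distrib]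
    refine Finset.sum_congr rfl fun i _ => ?_
    rw [e, add_mul, add_comm, Finset.sum_mul]
    congr 1
    exact Finset.sum_congr rfl fun j _ => by rw [smul_mul_assoc, smul_mul_assoc, mul_comm]

/-- If the coefficients `dᵢ` span at most two dimensions, expanding them in a basis collects the
outer variables into at most two linear forms, which are added to `W`. -/
theorem isWide_or {W : Submodule k (MvPolynomial (Fin n) k)}
    (hW : W ≤ linForms k n) {b : MvPolynomial (Fin n) k} (hb : b.IsHomogeneous 2)
    (h : b ∈ Ideal.span (W : Set (MvPolynomial (Fin n) k))) :
    IsWide W b ∨ ∃ W' : Submodule k (MvPolynomial (Fin n) k), W ≤ W' ∧ W' ≤ linForms k n ∧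
      Module.finrank k W' ≤ Module.finrank k W + 2 ∧ b ∈ Algebra.adjoin k (W' : Set _) := by
  obtain ⟨c⟩ := exists_linCoords hW
  obtain ⟨q, d, hq, hd, rfl⟩ := exists_linear_decomposition hW c hb h
  by_cases h3 : 3 ≤ Module.finrank k (Submodule.span k (Set.range d))
  · exact Or.inl ⟨c, q, d, hq, hd, rfl, h3⟩
  right
  set D := Submodule.span k (Set.range d) with hD
  have hDW : D ≤ W := Submodule.span_le.2 (by
    rintro _ ⟨i, rfl⟩
    exact hd i)
  have hdD : ∀ i, d i ∈ D := fun i => Submodule.subset_span ⟨i, rfl⟩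
  have := finiteDimensional_of_le_linForms hW
  have := finiteDimensional_of_le_linForms (hDW.trans hW)
  let β := Module.finBasis k D
  let Y : Fin (Module.finrank k D) → MvPolynomial (Fin n) k := fun j =>
    ∑ i, β.repr ⟨d i, hdD i⟩ j • c.e (X i)
  have hY : ∀ j, (Y j).IsHomogeneous 1 := fun j =>
    (linForms k n).sum_mem fun i _ => (linForms k n).smul_mem _ (c.lin i)
  refine ⟨W ⊔ Submodule.span k (Set.range Y), le_sup_left,
    sup_le hW (span_le_linForms (by rintro _ ⟨i, rfl⟩; exact hY i)), ?_, ?_⟩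
  · have h1 := finrank_range_le_card (R := k) Y
    rw [Fintype.card_fin] at h1
    have h1' : Module.finrank k (Submodule.span k (Set.range Y)) ≤ Module.finrank k D := h1
    have := FiniteDimensional.span_of_finite k (Set.finite_range Y)
    have h2 := Submodule.finrank_add_le_finrank_add_finrank W (Submodule.span k (Set.range Y))
    omega
  · refine add_mem (Algebra.adjoin_mono (fun x hx => Submodule.mem_sup_left hx) hq) ?_
    have h1 : ∑ i, d i * c.e (X i) = ∑ j, (β j : MvPolynomial (Fin n) k) * Y j := by
      have h2 : ∀ i, d i = ∑ j, β.repr ⟨d i, hdD i⟩ j • (β j : MvPolynomial (Fin n) k) := by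
        intro i
        have := congrArg D.subtype (β.sum_repr ⟨d i, hdD i⟩)
        rw [map_sum] at this
        exact this.symm
      conv_lhs => enter [2, i, 1]; rw [h2]
      simp only [Y, Finset.mul_sum, Finset.sum_mul]
      rw [Finset.sum_comm]
      exact Finset.sum_congr rfl fun j _ => Finset.sum_congr rfl fun i _ => by
        rw [smul_mul_assoc, mul_smul_comm]
    rw [h1]
    exact sum_mem fun j _ => mul_mem
      (Algebra.subset_adjoin (Submodule.mem_sup_left (hDW (β j).2)))
      (Algebra.subset_adjoin (Submodule.mem_sup_right (Submodule.subset_span ⟨j, rfl⟩)))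

end MvPolynomial

theorem Ideal.mem_span_triple {R : Type*} [CommRing R] {a b c x : R} :
    x ∈ Ideal.span {a, b, c} ↔ ∃ u v w, u * a + v * b + w * c = x :=
  Submodule.mem_span_triple

theorem Ideal.span_triple_eq_sup {R : Type*} [CommRing R] (a b c : R) :
    Ideal.span {a, b, c} = Ideal.span {b, c} ⊔ Ideal.span {a} := by
  rw [Ideal.span_insert, sup_comm]

/-! ### Colon ideals of a square pencil -/

section pencil

variable {R : Type u} [CommRing R] [IsDomain R]

/-- Syzygies of a regular sequence `u, b` modulo a prime element `y`. -/
theorem exists_syzygy {y u b : R} (hy : Prime y) (hu : ¬ y ∣ u) (hp : (Ideal.span {u, y}).IsPrime)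
    (hb : b ∉ Ideal.span {u, y}) {s t : R} (h : y ∣ s * u + t * b) :
    ∃ w s' t', s = -b * w + y * s' ∧ t = u * w + y * t' := by
  obtain ⟨z, hz⟩ := h
  have h1 : t * b ∈ Ideal.span {u, y} :=
    Ideal.mem_span_pair.2 ⟨-s, z, by linear_combination -hz⟩
  obtain ⟨w, t', ht⟩ := Ideal.mem_span_pair.1 ((hp.mem_or_mem h1).resolve_right hb)
  obtain ⟨s', hs'⟩ := (hy.dvd_or_dvd (show y ∣ (s + b * w) * u from
    ⟨z - t' * b, by linear_combination hz + b * ht⟩)).resolve_right hu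
  exact ⟨w, s', t', by linear_combination hs', by linear_combination -ht⟩

variable {x y l₁ l₂ l₃ b₁ b₂ b₃ : R}

/-- Let `g`, `h` be the last two cubics and `Δ = l₂ b₃ - l₃ b₂`, so that `l₂ h - l₃ g = y Δ`. A
relation `s g + t h = r y` reduces modulo `y` to `s l₂ + t l₃ = 0`. So `(s, t)` is a Koszul syzygy
modulo `y`, and it contributes a multiple of `Δ`. -/
theorem mul_mem_pencil_iff (hy : Prime y) (hx : ¬ y ∣ x) (h₂ : ¬ y ∣ l₂)
    (hp : (Ideal.span {l₂, y}).IsPrime) (h₃ : l₃ ∉ Ideal.span {l₂, y}) (r : R) :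
    r ∈ Ideal.span {l₂ * b₃ - l₃ * b₂, l₂ * x ^ 2 + y * b₂, l₃ * x ^ 2 + y * b₃} ↔
      r * y ∈ Ideal.span {l₂ * x ^ 2 + y * b₂, l₃ * x ^ 2 + y * b₃} := by
  rw [Ideal.mem_span_triple, Ideal.mem_span_pair]
  constructor
  · rintro ⟨w, s, t, rfl⟩
    exact ⟨y * s - w * l₃, y * t + w * l₂, by ring⟩
  · rintro ⟨s, t, h⟩
    have h1 : y ∣ s * l₂ + t * l₃ := by
      refine (hy.dvd_or_dvd (show y ∣ (s * l₂ + t * l₃) * x ^ 2 from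
        ⟨r - s * b₂ - t * b₃, by linear_combination h⟩)).resolve_right
        fun hd => hx (hy.dvd_of_dvd_pow hd)
    obtain ⟨w, s', t', rfl, rfl⟩ := exists_syzygy hy h₂ hp h₃ h1
    exact ⟨w, s', t', mul_left_cancel₀ hy.ne_zero (by linear_combination h)⟩

/-- Modulo `y` the relation reads `w Δ + (s l₂ + t l₃) x² = 0`. Since `x`, `Δ` is a regular sequence
there, each factor `x` can be peeled off in turn, and a syzygy of `l₂`, `l₃` remains. -/
theorem mem_of_mul_mem_pencil (hy : Prime y) (hx : ¬ y ∣ x) (hxy : (Ideal.span {x, y}).IsPrime)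
    (h₂ : ¬ y ∣ l₂) (hp : (Ideal.span {l₂, y}).IsPrime) (h₃ : l₃ ∉ Ideal.span {l₂, y})
    (hΔ : l₂ * b₃ - l₃ * b₂ ∉ Ideal.span {x, y}) (r : R)
    (h : r * y ∈ Ideal.span {l₂ * b₃ - l₃ * b₂, l₂ * x ^ 2 + y * b₂, l₃ * x ^ 2 + y * b₃}) :
    r ∈ Ideal.span {l₂ * b₃ - l₃ * b₂, l₂ * x ^ 2 + y * b₂, l₃ * x ^ 2 + y * b₃} := by
  rw [Ideal.mem_span_triple] at h ⊢
  obtain ⟨w, s, t, h⟩ := h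
  obtain ⟨w₁, a₁, c₁, e₁, rfl⟩ := exists_syzygy (s := (s * l₂ + t * l₃) * x) hy hx hxy hΔ (t := w)
    ⟨r - s * b₂ - t * b₃, by linear_combination h⟩
  obtain ⟨w₂, a₂, c₂, e₂, rfl⟩ := exists_syzygy (s := s * l₂ + t * l₃) hy hx hxy hΔ (t := w₁)
    ⟨a₁, by linear_combination e₁⟩
  obtain ⟨v, s', t', hs, ht⟩ := exists_syzygy (s := s + w₂ * b₃) (t := t - w₂ * b₂) hy h₂ hp h₃
    ⟨a₂, by linear_combination e₂⟩
  refine ⟨v + x * c₂ + c₁, s', t', mul_left_cancel₀ hy.ne_zero ?_⟩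
  linear_combination h - (l₂ * x ^ 2 + y * b₂) * hs - (l₃ * x ^ 2 + y * b₃) * ht

/-- Both `y` and `x²` carry the larger ideal into the pair, since `x² (l₂ b₃ - l₃ b₂) = b₃ g - b₂
h`. Hence so does the first cubic; its regularity gives the converse. -/
theorem mul_mem_pencil_iff_of_regular (hy : Prime y) (hx : ¬ y ∣ x) (h₂ : ¬ y ∣ l₂)
    (hp : (Ideal.span {l₂, y}).IsPrime) (h₃ : l₃ ∉ Ideal.span {l₂, y})
    (hf : ∀ r, r * (l₁ * x ^ 2 + y * b₁) ∈
      Ideal.span {l₂ * b₃ - l₃ * b₂, l₂ * x ^ 2 + y * b₂, l₃ * x ^ 2 + y * b₃} →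
      r ∈ Ideal.span {l₂ * b₃ - l₃ * b₂, l₂ * x ^ 2 + y * b₂, l₃ * x ^ 2 + y * b₃}) (r : R) :
    r ∈ Ideal.span {l₂ * b₃ - l₃ * b₂, l₂ * x ^ 2 + y * b₂, l₃ * x ^ 2 + y * b₃} ↔
      r * (l₁ * x ^ 2 + y * b₁) ∈ Ideal.span {l₂ * x ^ 2 + y * b₂, l₃ * x ^ 2 + y * b₃} := by
  constructor
  · intro h
    have h1 := (mul_mem_pencil_iff hy hx h₂ hp h₃ r).1 h
    have h2 : r * x ^ 2 ∈ Ideal.span {l₂ * x ^ 2 + y * b₂, l₃ * x ^ 2 + y * b₃} := by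
      obtain ⟨w, s, t, rfl⟩ := Ideal.mem_span_triple.1 h
      exact Ideal.mem_span_pair.2 ⟨s * x ^ 2 + w * b₃, t * x ^ 2 - w * b₂, by ring⟩
    rw [show r * (l₁ * x ^ 2 + y * b₁) = l₁ * (r * x ^ 2) + b₁ * (r * y) by ring]
    exact add_mem (Ideal.mul_mem_left _ _ h2) (Ideal.mul_mem_left _ _ h1)
  · intro h
    exact hf r (Ideal.span_mono (Set.subset_insert _ _) h)

/-- Modulo `y` the cubic is `l₂ x²`; its factors `l₂`, `x`, `x` are peeled off one at a time. -/
theorem mem_of_mul_mem_span_pair_of_regular (hy : Prime y) (hx : ¬ y ∣ x)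
    (hxy : (Ideal.span {x, y}).IsPrime) (h₂ : ¬ y ∣ l₂) (hp : (Ideal.span {l₂, y}).IsPrime)
    (hbx : b₃ ∉ Ideal.span {x, y}) (hbl : b₃ ∉ Ideal.span {l₂, y}) (r : R)
    (h : r * y ∈ Ideal.span {l₂ * x ^ 2 + y * b₂, b₃}) :
    r ∈ Ideal.span {l₂ * x ^ 2 + y * b₂, b₃} := by
  obtain ⟨s, t, h⟩ := Ideal.mem_span_pair.1 h
  obtain ⟨w₁, a₁, c₁, e₁, rfl⟩ := exists_syzygy (s := s * x ^ 2) hy h₂ hp hbl (t := t)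
    ⟨r - s * b₂, by linear_combination h⟩
  obtain ⟨w₂, a₂, c₂, e₂, rfl⟩ := exists_syzygy (s := s * x) hy hx hxy hbx (t := w₁)
    ⟨a₁, by linear_combination e₁⟩
  obtain ⟨w₃, a₃, c₃, e₃, rfl⟩ := exists_syzygy (s := s) hy hx hxy hbx (t := w₂)
    ⟨a₂, by linear_combination e₂⟩
  refine Ideal.mem_span_pair.2 ⟨a₃, c₁ + l₂ * c₂ + l₂ * x * c₃ - b₂ * w₃,
    mul_left_cancel₀ hy.ne_zero ?_⟩
  linear_combination h - (l₂ * x ^ 2 + y * b₂) * e₃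

/-- Eliminating `x²` from the first two cubics leaves a multiple of `y`, which explains the
generator `l₂ * b₃`. Conversely, regularity gives `r = s g + t b₃` with `g` the second cubic.
Reduction modulo `y` forces `t b₃`, hence `t`, into `(l₂, y)`. -/
theorem mul_mem_iff_of_coprime (hy : Prime y) (hp : (Ideal.span {l₂, y}).IsPrime) (h₂ : ¬ y ∣ l₂)
    (hx : ¬ y ∣ x) (h₁ : l₁ ∉ Ideal.span {l₂, y}) (hbl : b₃ ∉ Ideal.span {l₂, y})
    (hf : ∀ r, r * (l₁ * x ^ 2 + y * b₁) ∈ Ideal.span {l₂ * x ^ 2 + y * b₂, b₃} →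
      r ∈ Ideal.span {l₂ * x ^ 2 + y * b₂, b₃}) (r : R) :
    r ∈ Ideal.span {l₂ * x ^ 2 + y * b₂, l₂ * b₃, y * b₃} ↔
      r * (l₁ * x ^ 2 + y * b₁) ∈ Ideal.span {l₂ * x ^ 2 + y * b₂, y * b₃} := by
  constructor
  · intro h
    obtain ⟨u, v, w, rfl⟩ := Ideal.mem_span_triple.1 h
    exact Ideal.mem_span_pair.2 ⟨u * (l₁ * x ^ 2 + y * b₁) + v * l₁ * b₃,
      w * (l₁ * x ^ 2 + y * b₁) + v * l₂ * b₁ - v * l₁ * b₂, by ring⟩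
  · intro h
    obtain ⟨p, q, hpq⟩ := Ideal.mem_span_pair.1 h
    obtain ⟨s, t, rfl⟩ := Ideal.mem_span_pair.1 (hf r (Ideal.mem_span_pair.2
      ⟨p, q * y, by linear_combination hpq⟩))
    have h1 : y ∣ (s * (l₁ * x ^ 2 + y * b₁) - p) * l₂ + t * b₃ * l₁ := by
      refine (hy.dvd_or_dvd (?_ : y ∣ _ * x ^ 2)).resolve_right
        fun hd => hx (hy.dvd_of_dvd_pow hd)
      exact ⟨q * b₃ - s * (l₁ * x ^ 2 + y * b₁) * b₂ + p * b₂ - t * b₃ * b₁, by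
        linear_combination -hpq⟩
    obtain ⟨w, -, t', -, e⟩ := exists_syzygy hy h₂ hp h₁ h1
    have h2 : t * b₃ ∈ Ideal.span {l₂, y} :=
      Ideal.mem_span_pair.2 ⟨w, t', by linear_combination -e⟩
    obtain ⟨c, d, rfl⟩ := Ideal.mem_span_pair.1 ((hp.mem_or_mem h2).resolve_right hbl)
    exact Ideal.mem_span_triple.2 ⟨s, c, d, by ring⟩

end pencil

namespace MvPolynomial

variable {k : Type u} [Field k] {n : ℕ}

theorem isPrime_span_pair {x y : MvPolynomial (Fin n) k} (hx : x.IsHomogeneous 1)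
    (hy : y.IsHomogeneous 1) : (Ideal.span {x, y}).IsPrime :=
  isPrime_ideal_span_set (by
    rintro l (rfl | rfl)
    exacts [hx, hy])

theorem isPrime_span_triple {x y z : MvPolynomial (Fin n) k} (hx : x.IsHomogeneous 1)
    (hy : y.IsHomogeneous 1) (hz : z.IsHomogeneous 1) : (Ideal.span {x, y, z}).IsPrime :=
  isPrime_ideal_span_set (by
    rintro l (rfl | rfl | rfl)
    exacts [hx, hy, hz])

theorem exists_C_mul_add_C_mul {x y p : MvPolynomial (Fin n) k} (hx : x.IsHomogeneous 1)
    (hy : y.IsHomogeneous 1) (hp : p.IsHomogeneous 1) (h : p ∈ Ideal.span {x, y}) :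
    ∃ a b : k, p = C a * x + C b * y := by
  obtain ⟨a, b, ha, hb, rfl⟩ := exists_isHomogeneous_pair (d := 0) hx hy hp h
  obtain ⟨a, rfl⟩ := ha.exists_eq_C
  obtain ⟨b, rfl⟩ := hb.exists_eq_C
  exact ⟨a, b, rfl⟩

theorem mem_span_pair_exchange {p q y : MvPolynomial (Fin n) k} (hp : p.IsHomogeneous 1)
    (hq : q.IsHomogeneous 1) (hy : y.IsHomogeneous 1) (hpy : ¬ y ∣ p)
    (h : p ∈ Ideal.span {q, y}) : q ∈ Ideal.span {p, y} := by
  obtain ⟨a, b, rfl⟩ := exists_C_mul_add_C_mul hq hy hp h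
  have ha : a ≠ 0 := by
    rintro rfl
    exact hpy ⟨C b, by simp [mul_comm]⟩
  have h1 : C a⁻¹ * C a = (1 : MvPolynomial (Fin n) k) := by
    rw [← C_mul, inv_mul_cancel₀ ha, C_1]
  exact Ideal.mem_span_pair.2 ⟨C a⁻¹, -(C a⁻¹ * C b), by linear_combination q * h1⟩

/-- A common factor is itself a form, and its image is a unit, so it has degree 0. -/
theorem IsHomogeneous.isRelPrime_of_proj {W : Submodule k (MvPolynomial (Fin n) k)}
    (c : LinCoords W) {a b : MvPolynomial (Fin n) k} {d : ℕ} (ha : a.IsHomogeneous d)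
    (h0 : c.proj a ≠ 0) (h : IsRelPrime (c.proj a) (c.proj b)) : IsRelPrime a b := by
  rintro r ⟨s, rfl⟩ hrb
  have hne : r * s ≠ 0 := fun h => h0 (by rw [h, map_zero])
  obtain ⟨e, f, he, -, -⟩ := ha.of_mul hne
  have h1 : IsUnit (c.proj r) := h (map_mul c.proj r s ▸ dvd_mul_right _ _) (map_dvd c.proj hrb)
  exact he.isUnit_of_degree_eq_zero ((c.isHomogeneous_proj he).eq_zero_of_isUnit h1)
    (left_ne_zero_of_mul hne)

theorem finrank_span_list_le (L : List (MvPolynomial (Fin n) k)) :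
    Module.finrank k (Submodule.span k {l | l ∈ L}) ≤ L.length := by
  classical
  have h : {l | l ∈ L} = (L.toFinset : Set (MvPolynomial (Fin n) k)) := by
    ext
    simp
  rw [h]
  exact (finrank_span_finset_le_card _).trans L.toFinset_card_le

theorem adjoin_span_union (s t : Set (MvPolynomial (Fin n) k)) :
    Algebra.adjoin k (s ∪ t) ≤
      Algebra.adjoin k ((Submodule.span k s : Set (MvPolynomial (Fin n) k)) ∪ t) :=
  Algebra.adjoin_mono (Set.union_subset_union_left _ Submodule.subset_span)

theorem PDLT_of_list {L : List (MvPolynomial (Fin n) k)} (hL : ∀ l ∈ L, l.IsHomogeneous 1) {N : ℕ}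
    (hlen : L.length < N) {G : Set (MvPolynomial (Fin n) k)}
    (hG : ∀ g ∈ G, g ∈ Algebra.adjoin k {l | l ∈ L}) :
    PDLT (MvPolynomial (Fin n) k) (MvPolynomial (Fin n) k ⧸ Ideal.span G) N :=
  PDLT_of_adjoin (span_le_linForms hL)
    (fun g hg => Algebra.adjoin_mono Submodule.subset_span (hG g hg))
    ((finrank_span_list_le L).trans_lt hlen)

theorem PDLT_of_list_one {L : List (MvPolynomial (Fin n) k)} (hL : ∀ l ∈ L, l.IsHomogeneous 1)
    (hlen : L.length ≤ 18) {q : MvPolynomial (Fin n) k} (hq : q.IsHomogeneous 2)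
    {G : Set (MvPolynomial (Fin n) k)}
    (hG : ∀ g ∈ G, g ∈ Algebra.adjoin k ({l | l ∈ L} ∪ {q})) :
    PDLT (MvPolynomial (Fin n) k) (MvPolynomial (Fin n) k ⧸ Ideal.span G) 37 :=
  PDLT_of_adjoin_one (span_le_linForms hL) hq (fun g hg => adjoin_span_union _ _ (hG g hg))
    ((finrank_span_list_le L).trans hlen)

theorem PDLT_of_list_two {L : List (MvPolynomial (Fin n) k)} (hL : ∀ l ∈ L, l.IsHomogeneous 1)
    (hlen : L.length ≤ 8) {q₁ q₂ : MvPolynomial (Fin n) k} (h₁ : q₁.IsHomogeneous 2)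
    (h₂ : q₂.IsHomogeneous 2) {G : Set (MvPolynomial (Fin n) k)}
    (hG : ∀ g ∈ G, g ∈ Algebra.adjoin k ({l | l ∈ L} ∪ {q₁, q₂})) :
    PDLT (MvPolynomial (Fin n) k) (MvPolynomial (Fin n) k ⧸ Ideal.span G) 37 :=
  PDLT_of_adjoin_two (span_le_linForms hL) h₁ h₂ (fun g hg => adjoin_span_union _ _ (hG g hg))
    ((finrank_span_list_le L).trans hlen)

/-! ### Pencils with a wide member -/

section cases

variable {x y l₁ l₂ l₃ b₁ b₂ b₃ : MvPolynomial (Fin n) k}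

/-- The colon of the last two cubics by the first equals their colon by `y`. Its dimension follows
from the pair together with `y`; there the colon by `x²` is `(y, l₂, l₃)`, and adding `x²` leaves
`(y, x²)`. -/
theorem PDLT_of_pencil {W : Submodule k (MvPolynomial (Fin n) k)} (hW : W ≤ linForms k n)
    (hxW : x ∈ W) (hyW : y ∈ W) (hl₁ : l₁ ∈ W) (hl₂ : l₂ ∈ W) (hl₃ : l₃ ∈ W)
    (hb₁ : IsWide W b₁) (hb₂ : b₂ ∈ Algebra.adjoin k (W : Set (MvPolynomial (Fin n) k)))
    (hb₃ : b₃ ∈ Algebra.adjoin k (W : Set (MvPolynomial (Fin n) k)))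
    (hy0 : y ≠ 0) (hx : ¬ y ∣ x) (h₂ : ¬ y ∣ l₂) (h₃ : l₃ ∉ Ideal.span {l₂, y})
    (hΔ : l₂ * b₃ - l₃ * b₂ ∉ Ideal.span {x, y}) :
    PDLT (MvPolynomial (Fin n) k) (MvPolynomial (Fin n) k ⧸
      Ideal.span {l₁ * x ^ 2 + y * b₁, l₂ * x ^ 2 + y * b₂, l₃ * x ^ 2 + y * b₃}) 4 := by
  have hy := prime_of_isHomogeneous_one (hW hyW) hy0
  have hp := isPrime_span_pair (hW hl₂) (hW hyW)
  have hxy := isPrime_span_pair (hW hxW) (hW hyW)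
  have hmem : ∀ w ∈ W, w ∈ Algebra.adjoin k (W : Set (MvPolynomial (Fin n) k)) := fun w hw =>
    Algebra.subset_adjoin hw
  have hcolon := mul_mem_pencil_iff (b₂ := b₂) (b₃ := b₃) hy hx h₂ hp h₃
  have hreg := mem_of_mul_mem_pencil hy hx hxy h₂ hp h₃ hΔ
  have hf := hb₁.regular hW
    (G := {l₂ * b₃ - l₃ * b₂, l₂ * x ^ 2 + y * b₂, l₃ * x ^ 2 + y * b₃})
    (by
      rintro p (rfl | rfl | rfl)
      · exact sub_mem (mul_mem (hmem _ hl₂) hb₃) (mul_mem (hmem _ hl₃) hb₂)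
      · exact add_mem (mul_mem (hmem _ hl₂) (pow_mem (hmem _ hxW) 2)) (mul_mem (hmem _ hyW) hb₂)
      · exact add_mem (mul_mem (hmem _ hl₃) (pow_mem (hmem _ hxW) 2)) (mul_mem (hmem _ hyW) hb₃))
    (by
      intro D hD h3 a ha
      rw [hcolon]
      refine isLinearlySaturated_span_pair _ _ D hD h3 _ fun w hw => ?_
      rw [mul_right_comm, ← hcolon]
      exact ha w hw)
    (mul_mem (hmem _ hl₁) (pow_mem (hmem _ hxW) 2)) (hmem _ hyW) hreg
  rw [Ideal.span_triple_eq_sup]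
  refine PDLT.sup_of_colon (mul_mem_pencil_iff_of_regular hy hx h₂ hp h₃ hf) ?_
    ((PDLT.quotient_span_pair _ _).mono (by norm_num))
  refine PDLT.colon hcolon (PDLT.quotient_span_pair _ _) ?_
  have hyM : y ∈ Ideal.span {l₂ * x ^ 2 + y * b₂, l₃ * x ^ 2 + y * b₃} ⊔ Ideal.span {y} :=
    Ideal.mem_sup_right (Ideal.mem_span_singleton_self y)
  refine PDLT.of_colon (K := Ideal.span {y, l₂, l₃}) (a := x ^ 2) (fun r => ?_) ?_ ?_
  · constructor
    · intro h
      obtain ⟨u, v, w, rfl⟩ := Ideal.mem_span_triple.1 h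
      rw [show (u * y + v * l₂ + w * l₃) * x ^ 2 = v * (l₂ * x ^ 2 + y * b₂) +
        w * (l₃ * x ^ 2 + y * b₃) + (u * x ^ 2 - v * b₂ - w * b₃) * y by ring]
      exact add_mem (Ideal.mem_sup_left (Ideal.mem_span_pair.2 ⟨v, w, rfl⟩))
        (Ideal.mul_mem_left _ _ hyM)
    · intro h
      obtain ⟨p, hp', q, hq, hpq⟩ := Submodule.mem_sup.1 h
      obtain ⟨v, w, rfl⟩ := Ideal.mem_span_pair.1 hp'
      obtain ⟨u, rfl⟩ := Ideal.mem_span_singleton'.1 hq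
      obtain ⟨z, hz⟩ := (hy.dvd_or_dvd (show y ∣ (r - v * l₂ - w * l₃) * x ^ 2 from
        ⟨u + v * b₂ + w * b₃, by linear_combination -hpq⟩)).resolve_right
        fun hd => hx (hy.dvd_of_dvd_pow hd)
      exact Ideal.mem_span_triple.2 ⟨z, v, w, by linear_combination -hz⟩
  · refine PDLT_of_list (L := [y, l₂, l₃]) ?_ (by simp) ?_
    · simpa using ⟨hW hyW, hW hl₂, hW hl₃⟩
    · intro g hg
      exact Algebra.subset_adjoin (by simpa using hg)
  · have h1 : Ideal.span {l₂ * x ^ 2 + y * b₂, l₃ * x ^ 2 + y * b₃} ⊔ Ideal.span {y} ⊔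
        Ideal.span {x ^ 2} = Ideal.span {y, x ^ 2} := by
      refine le_antisymm ?_ ?_
      · refine sup_le (sup_le (Ideal.span_le.2 ?_) (Ideal.span_mono (by simp)))
          (Ideal.span_mono (by simp))
        rintro p (rfl | rfl)
        · exact Ideal.mem_span_pair.2 ⟨b₂, l₂, by ring⟩
        · exact Ideal.mem_span_pair.2 ⟨b₃, l₃, by ring⟩
      · rw [Ideal.span_le]
        rintro p (rfl | rfl)
        · exact Ideal.mem_sup_left hyM
        · exact Ideal.mem_sup_right (Ideal.mem_span_singleton_self _)
    rw [h1]
    exact (PDLT.quotient_span_pair _ _).mono (by norm_num)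

/-- The pencil whose second member is divisible by `y`, with independent leading forms. -/
theorem PDLT_of_divisible_pencil {W : Submodule k (MvPolynomial (Fin n) k)} (hW : W ≤ linForms k n)
    (hxW : x ∈ W) (hyW : y ∈ W) (hl₁ : l₁ ∈ W) (hl₂ : l₂ ∈ W)
    (hb₁ : IsWide W b₁) (hb₂ : b₂ ∈ Algebra.adjoin k (W : Set (MvPolynomial (Fin n) k)))
    (hb₃ : b₃ ∈ Algebra.adjoin k (W : Set (MvPolynomial (Fin n) k)))
    (hb₂' : b₂.IsHomogeneous 2)
    (hy0 : y ≠ 0) (hx : ¬ y ∣ x) (h₂ : ¬ y ∣ l₂) (h₁ : l₁ ∉ Ideal.span {l₂, y})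
    (hbx : b₃ ∉ Ideal.span {x, y}) (hbl : b₃ ∉ Ideal.span {l₂, y}) :
    PDLT (MvPolynomial (Fin n) k) (MvPolynomial (Fin n) k ⧸
      Ideal.span {l₁ * x ^ 2 + y * b₁, l₂ * x ^ 2 + y * b₂, y * b₃}) 4 := by
  have hy := prime_of_isHomogeneous_one (hW hyW) hy0
  have hp := isPrime_span_pair (hW hl₂) (hW hyW)
  have hxy := isPrime_span_pair (hW hxW) (hW hyW)
  have hmem : ∀ w ∈ W, w ∈ Algebra.adjoin k (W : Set (MvPolynomial (Fin n) k)) := fun w hw =>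
    Algebra.subset_adjoin hw
  have hf := hb₁.regular hW (G := {l₂ * x ^ 2 + y * b₂, b₃})
    (by
      rintro p (rfl | rfl)
      · exact add_mem (mul_mem (hmem _ hl₂) (pow_mem (hmem _ hxW) 2)) (mul_mem (hmem _ hyW) hb₂)
      · exact hb₃)
    (isLinearlySaturated_span_pair _ _)
    (mul_mem (hmem _ hl₁) (pow_mem (hmem _ hxW) 2)) (hmem _ hyW)
    (mem_of_mul_mem_span_pair_of_regular hy hx hxy h₂ hp hbx hbl)
  rw [Ideal.span_triple_eq_sup]
  refine PDLT.sup_of_colon (mul_mem_iff_of_coprime hy hp h₂ hx h₁ hbl hf) ?_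
    ((PDLT.quotient_span_pair _ _).mono (by norm_num))
  -- Modulo `y` the cubic becomes `l₂ x²`, and `b₃` is coprime there to both `l₂` and `x`.
  have hrel : IsRelPrime (l₂ * x ^ 2 + y * b₂) b₃ := by
    have hY : Submodule.span k {y} ≤ linForms k n := span_le_linForms (by simpa using hW hyW)
    obtain ⟨c⟩ := exists_linCoords hY
    have hker : ∀ r, c.proj r = 0 ↔ y ∣ r := by
      intro r
      rw [c.proj_eq_zero_iff, ideal_span_span, Ideal.mem_span_singleton]
    have hrel' : ∀ l : MvPolynomial (Fin n) k, l.IsHomogeneous 1 → ¬ y ∣ l →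
        b₃ ∉ Ideal.span {l, y} → IsRelPrime (c.proj l) (c.proj b₃) := by
      intro l hl hyl hbl
      have h0 : c.proj l ≠ 0 := fun h => hyl ((hker l).1 h)
      rw [(prime_of_isHomogeneous_one (c.isHomogeneous_proj hl) h0).irreducible.isRelPrime_iff_not_dvd]
      rintro ⟨r, hr⟩
      obtain ⟨s, hs⟩ := (hker (b₃ - l * c.lift r)).1 (by rw [map_sub, map_mul, c.proj_lift, hr, sub_self])
      exact hbl (Ideal.mem_span_pair.2 ⟨c.lift r, s, by linear_combination -hs⟩)
    have e : c.proj (l₂ * x ^ 2 + y * b₂) = c.proj l₂ * c.proj x ^ 2 := by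
      rw [map_add, map_mul, map_mul, map_pow, (hker y).2 dvd_rfl, zero_mul, add_zero]
    refine IsHomogeneous.isRelPrime_of_proj c (d := 3)
      (((hW hl₂ : l₂.IsHomogeneous 1).mul ((hW hxW : x.IsHomogeneous 1).pow 2)).add
        ((hW hyW : y.IsHomogeneous 1).mul hb₂')) ?_ ?_
    · rw [e]
      exact mul_ne_zero (fun h => h₂ ((hker _).1 h)) (pow_ne_zero _ fun h => hx ((hker _).1 h))
    · rw [e]
      exact IsRelPrime.mul_left (hrel' _ (hW hl₂) h₂ hbl) (hrel' _ (hW hxW) hx hbx).pow_left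
  have hbM : b₃ ∈ Ideal.span {l₂ * x ^ 2 + y * b₂, l₂ * b₃, y * b₃} ⊔ Ideal.span {b₃} :=
    Ideal.mem_sup_right (Ideal.mem_span_singleton_self _)
  have hb0 : b₃ ≠ 0 := by
    rintro rfl
    exact hbx (zero_mem _)
  -- By coprimality the colon by `b₃` is `(l₂, y)`; adding `b₃` leaves only the cubic and `b₃`. Both
  -- ideals are two-generated.
  refine PDLT.of_colon (K := Ideal.span {l₂, y}) (a := b₃) (fun r => ?_)
    (PDLT.quotient_span_pair _ _) ?_
  · constructor
    · intro h
      obtain ⟨u, v, rfl⟩ := Ideal.mem_span_pair.1 h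
      exact Ideal.mem_span_triple.2 ⟨0, u, v, by ring⟩
    · intro h
      obtain ⟨s, u, v, e⟩ := Ideal.mem_span_triple.1 h
      obtain ⟨s', rfl⟩ := hrel.symm.dvd_of_dvd_mul_right (show b₃ ∣ s * (l₂ * x ^ 2 + y * b₂) from
        ⟨r - u * l₂ - v * y, by linear_combination e⟩)
      exact Ideal.mem_span_pair.2 ⟨u + s' * x ^ 2, v + s' * b₂,
        mul_left_cancel₀ hb0 (by linear_combination e)⟩
  · have h1 : Ideal.span {l₂ * x ^ 2 + y * b₂, l₂ * b₃, y * b₃} ⊔ Ideal.span {b₃} =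
        Ideal.span {l₂ * x ^ 2 + y * b₂, b₃} := by
      refine le_antisymm ?_ ?_
      · refine sup_le (Ideal.span_le.2 ?_) (Ideal.span_mono (by simp))
        rintro p (rfl | rfl | rfl)
        · exact Ideal.subset_span (by simp)
        · exact Ideal.mul_mem_left _ _ (Ideal.subset_span (by simp))
        · exact Ideal.mul_mem_left _ _ (Ideal.subset_span (by simp))
      · rw [Ideal.span_le]
        rintro p (rfl | rfl)
        · exact Ideal.mem_sup_left (Ideal.subset_span (by simp))
        · exact hbM
    rw [h1]
    exact PDLT.quotient_span_pair _ _

/-- Since `y` does not divide `l x²`, the coefficient of `g` in a multiple of `y` is divisible by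
`y`. So the colon by `y` is `(f', g, h')`, while adding `y` leaves `(y, l x²)`. -/
theorem PDLT_of_colon_linear {f g h f' h' : MvPolynomial (Fin n) k} (hy : Prime y)
    (hx : ¬ y ∣ x) {l b : MvPolynomial (Fin n) k} (hl : ¬ y ∣ l) (hg : g = l * x ^ 2 + y * b)
    (hf : f = y * f') (hh : h = y * h')
    (hK : PDLT (MvPolynomial (Fin n) k) (MvPolynomial (Fin n) k ⧸ Ideal.span {f', g, h'}) 4) :
    PDLT (MvPolynomial (Fin n) k) (MvPolynomial (Fin n) k ⧸ Ideal.span {f, g, h}) 4 := by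
  subst hf hg hh
  refine PDLT.of_colon (K := Ideal.span {f', l * x ^ 2 + y * b, h'}) (a := y) (fun r => ?_) hK ?_
  · rw [Ideal.mem_span_triple, Ideal.mem_span_triple]
    constructor
    · rintro ⟨u, v, w, rfl⟩
      exact ⟨u, v * y, w, by ring⟩
    · rintro ⟨u, v, w, e⟩
      obtain ⟨v', rfl⟩ := (hy.dvd_or_dvd (show y ∣ v * (l * x ^ 2) from
        ⟨r - u * f' - v * b - w * h', by linear_combination e⟩)).resolve_right fun hd =>
        ((hy.dvd_or_dvd hd).resolve_left hl |> fun hd => hx (hy.dvd_of_dvd_pow hd))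
      exact ⟨u, v', w, mul_left_cancel₀ hy.ne_zero (by linear_combination e)⟩
  · have h1 : Ideal.span {y * f', l * x ^ 2 + y * b, y * h'} ⊔ Ideal.span {y} =
        Ideal.span {y, l * x ^ 2} := by
      refine le_antisymm ?_ ?_
      · refine sup_le (Ideal.span_le.2 ?_) (Ideal.span_mono (by simp))
        rintro p (rfl | rfl | rfl)
        · exact Ideal.mul_mem_right _ _ (Ideal.subset_span (by simp))
        · exact Ideal.mem_span_pair.2 ⟨b, 1, by ring⟩
        · exact Ideal.mul_mem_right _ _ (Ideal.subset_span (by simp))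
      · rw [Ideal.span_le]
        have hyM : y ∈ Ideal.span {y * f', l * x ^ 2 + y * b, y * h'} ⊔ Ideal.span {y} :=
          Ideal.mem_sup_right (Ideal.mem_span_singleton_self _)
        rintro p (rfl | rfl)
        · exact hyM
        · have h3 := sub_mem (Ideal.mem_sup_left (T := Ideal.span {y})
            (Ideal.subset_span (show l * x ^ 2 + y * b ∈ {y * f', l * x ^ 2 + y * b, y * h'} by
              simp))) (Ideal.mul_mem_left _ b hyM)
          rwa [show l * x ^ 2 + y * b - b * y = l * x ^ 2 by ring] at h3
    rw [h1]
    exact (PDLT.quotient_span_pair _ _).mono (by norm_num)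

end cases

end MvPolynomial

/-! ### Degenerate pencils -/

namespace MvPolynomial

variable {k : Type u} [Field k] {n : ℕ}
  {x y l₁ l₂ l₃ b₁ b₂ b₃ : MvPolynomial (Fin n) k}

theorem _root_.Ideal.span_triple_sub_mul {R : Type*} [CommRing R] (f g h c : R) :
    Ideal.span {f, g - c * h, h} = Ideal.span {f, g, h} := by
  refine le_antisymm (Ideal.span_le.2 ?_) (Ideal.span_le.2 ?_)
  · rintro p (rfl | rfl | rfl)
    · exact Ideal.subset_span (by simp)
    · exact Ideal.mem_span_triple.2 ⟨0, 1, -c, by ring⟩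
    · exact Ideal.subset_span (by simp)
  · rintro p (rfl | rfl | rfl)
    · exact Ideal.subset_span (by simp)
    · exact Ideal.mem_span_triple.2 ⟨0, 1, c, by ring⟩
    · exact Ideal.subset_span (by simp)

theorem _root_.Ideal.span_triple_swap {R : Type*} [CommRing R] (f g h : R) :
    Ideal.span {f, g, h} = Ideal.span {f, h, g} := by
  rw [Set.pair_comm]

theorem sub_C_mul_isHomogeneous {p q : MvPolynomial (Fin n) k} {d : ℕ} (hp : p.IsHomogeneous d)
    (hq : q.IsHomogeneous d) (c : k) : (p - C c * q).IsHomogeneous d := by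
  have := smul_add_smul_isHomogeneous hp hq 1 (-c)
  rwa [one_smul, neg_smul, ← sub_eq_add_neg, smul_eq_C_mul] at this

/-- Here `l₃ b₂` lies in the prime `(x, y)` but `l₃` does not, so `b₂ = m x + m' y`. Seven linear
forms and the quadrics `b₁`, `b₃` remain. -/
theorem PDLT_of_degenerate_aux (hx : x.IsHomogeneous 1) (hy : y.IsHomogeneous 1)
    (hl₁ : l₁.IsHomogeneous 1) (hl₂ : l₂.IsHomogeneous 1) (hl₃ : l₃.IsHomogeneous 1)
    (hb₁ : b₁.IsHomogeneous 2) (hb₂ : b₂.IsHomogeneous 2) (hb₃ : b₃.IsHomogeneous 2)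
    (h₂ : ¬ y ∣ l₂) (h₃ : l₃ ∉ Ideal.span {l₂, y}) (h₂x : l₂ ∈ Ideal.span {x, y})
    (hΔ : l₂ * b₃ - l₃ * b₂ ∈ Ideal.span {x, y}) :
    PDLT (MvPolynomial (Fin n) k) (MvPolynomial (Fin n) k ⧸
      Ideal.span {l₁ * x ^ 2 + y * b₁, l₂ * x ^ 2 + y * b₂, l₃ * x ^ 2 + y * b₃}) 37 := by
  have hxy := isPrime_span_pair hx hy
  have hx₂ := mem_span_pair_exchange hl₂ hx hy h₂ h₂x
  have hl₃x : l₃ ∉ Ideal.span {x, y} := fun h => h₃ ((Ideal.span_le.2 (by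
    rintro p (rfl | rfl)
    exacts [hx₂, Ideal.subset_span (by simp)]) : Ideal.span {x, y} ≤ Ideal.span {l₂, y}) h)
  have h4 : l₃ * b₂ ∈ Ideal.span {x, y} := by
    have := sub_mem (Ideal.mul_mem_right b₃ _ h₂x) hΔ
    rwa [sub_sub_cancel] at this
  obtain ⟨m, m', hm, hm', rfl⟩ := exists_isHomogeneous_pair hx hy hb₂
    ((hxy.mem_or_mem h4).resolve_left hl₃x)
  refine PDLT_of_list_two (L := [x, y, l₁, l₂, l₃, m, m']) ?_ (by simp) hb₁ hb₃ ?_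
  · simpa using ⟨hx, hy, hl₁, hl₂, hl₃, hm, hm'⟩
  set A := Algebra.adjoin k ({l | l ∈ [x, y, l₁, l₂, l₃, m, m']} ∪ {b₁, b₃})
  have key : ∀ z ∈ ({l | l ∈ [x, y, l₁, l₂, l₃, m, m']} ∪ {b₁, b₃} : Set _), z ∈ A := fun z hz =>
    Algebra.subset_adjoin hz
  simp only [List.mem_cons, List.not_mem_nil, or_false, Set.mem_union, Set.mem_ofPred_eq,
    Set.mem_insert_iff, Set.mem_singleton_iff, or_assoc, forall_eq_or_imp, forall_eq] at key
  obtain ⟨kx, ky, k1, k2, k3, km, km', kb1, kb3⟩ := key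
  rintro p (rfl | rfl | rfl)
  · exact add_mem (mul_mem k1 (pow_mem kx 2)) (mul_mem ky kb1)
  · exact add_mem (mul_mem k2 (pow_mem kx 2)) (mul_mem ky (add_mem (mul_mem km kx) (mul_mem km' ky)))
  · exact add_mem (mul_mem k3 (pow_mem kx 2)) (mul_mem ky kb3)

/-- If `l₂` and `l₃` are dependent modulo `(x, y)`, a change of generators or a swap leads to the
auxiliary case. Otherwise the vanishing minor gives `b₂ = l₂ μ` and `b₃ = l₃ μ` modulo `(x, y)` with
the same linear `μ`, leaving ten linear forms and `b₁`. -/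
theorem PDLT_of_degenerate (hx : x.IsHomogeneous 1) (hy : y.IsHomogeneous 1)
    (hl₁ : l₁.IsHomogeneous 1) (hl₂ : l₂.IsHomogeneous 1) (hl₃ : l₃.IsHomogeneous 1)
    (hb₁ : b₁.IsHomogeneous 2) (hb₂ : b₂.IsHomogeneous 2) (hb₃ : b₃.IsHomogeneous 2)
    (h₂ : ¬ y ∣ l₂) (h₃ : l₃ ∉ Ideal.span {l₂, y})
    (hΔ : l₂ * b₃ - l₃ * b₂ ∈ Ideal.span {x, y}) :
    PDLT (MvPolynomial (Fin n) k) (MvPolynomial (Fin n) k ⧸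
      Ideal.span {l₁ * x ^ 2 + y * b₁, l₂ * x ^ 2 + y * b₂, l₃ * x ^ 2 + y * b₃}) 37 := by
  have hxy := isPrime_span_pair hx hy
  have h₃y : ¬ y ∣ l₃ := by
    rintro ⟨z, rfl⟩
    exact h₃ (Ideal.mul_mem_right _ _ (Ideal.subset_span (by simp)))
  have h₂l : l₂ ∉ Ideal.span {l₃, y} := fun h => h₃ (mem_span_pair_exchange hl₂ hl₃ hy h₂ h)
  by_cases h₂x : l₂ ∈ Ideal.span {x, y}
  · exact PDLT_of_degenerate_aux hx hy hl₁ hl₂ hl₃ hb₁ hb₂ hb₃ h₂ h₃ h₂x hΔ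
  by_cases h₃x : l₃ ∈ Ideal.span {x, y}
  · rw [Ideal.span_triple_swap]
    exact PDLT_of_degenerate_aux hx hy hl₁ hl₃ hl₂ hb₁ hb₃ hb₂ h₃y h₂l h₃x
      (by rw [← neg_sub]; exact neg_mem hΔ)
  by_cases h₂' : l₂ ∈ Ideal.span {x, y, l₃}
  · obtain ⟨α, β, γ, -, -, hγ, e⟩ := exists_isHomogeneous_triple (d := 0) hx hy hl₃ hl₂ h₂'
    obtain ⟨γ, rfl⟩ := hγ.exists_eq_C
    have h := PDLT_of_degenerate_aux (l₂ := l₂ - C γ * l₃) (b₂ := b₂ - C γ * b₃) hx hy hl₁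
      (sub_C_mul_isHomogeneous hl₂ hl₃ γ) hl₃ hb₁ (sub_C_mul_isHomogeneous hb₂ hb₃ γ) hb₃
      (fun ⟨z, hz⟩ => h₂l (Ideal.mem_span_pair.2 ⟨C γ, z, by linear_combination -hz⟩))
      (fun h => by
        have h5 := mem_span_pair_exchange hl₃ (sub_C_mul_isHomogeneous hl₂ hl₃ γ) hy h₃y h
        refine h₂l ?_
        have := add_mem h5 (Ideal.mul_mem_left _ (C γ)
          (Ideal.subset_span (show l₃ ∈ {l₃, y} by simp)))
        rwa [sub_add_cancel] at this)
      (Ideal.mem_span_pair.2 ⟨α, β, by linear_combination -e⟩)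
      (by
        rw [show (l₂ - C γ * l₃) * b₃ - l₃ * (b₂ - C γ * b₃) = l₂ * b₃ - l₃ * b₂ by ring]
        exact hΔ)
    rw [show (l₂ - C γ * l₃) * x ^ 2 + y * (b₂ - C γ * b₃) = (l₂ * x ^ 2 + y * b₂) -
      C γ * (l₃ * x ^ 2 + y * b₃) by ring, Ideal.span_triple_sub_mul] at h
    exact h
  have hxyl := isPrime_span_triple hx hy hl₃
  have hb₃' : b₃ ∈ Ideal.span {x, y, l₃} := by
    obtain ⟨u, v, e⟩ := Ideal.mem_span_pair.1 hΔ
    refine (hxyl.mem_or_mem (?_ : l₂ * b₃ ∈ _)).resolve_left h₂'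
    exact Ideal.mem_span_triple.2 ⟨u, v, b₂, by linear_combination e⟩
  obtain ⟨p, q, μ, hp, hq, hμ, rfl⟩ := exists_isHomogeneous_triple hx hy hl₃ hb₃ hb₃'
  have hb₂' : b₂ - l₂ * μ ∈ Ideal.span {x, y} := by
    refine (hxy.mem_or_mem (?_ : l₃ * (b₂ - l₂ * μ) ∈ _)).resolve_left h₃x
    obtain ⟨u, v, e⟩ := Ideal.mem_span_pair.1 hΔ
    exact Ideal.mem_span_pair.2 ⟨l₂ * p - u, l₂ * q - v, by linear_combination -e⟩
  obtain ⟨p', q', hp', hq', e⟩ := exists_isHomogeneous_pair (d := 1) hx hy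
    ((homogeneousSubmodule _ k 2).sub_mem hb₂ (hl₂.mul hμ)) hb₂'
  obtain rfl : b₂ = l₂ * μ + p' * x + q' * y := by linear_combination e
  refine PDLT_of_list_one (L := [x, y, l₁, l₂, l₃, μ, p, q, p', q']) ?_ (by simp) hb₁ ?_
  · simpa using ⟨hx, hy, hl₁, hl₂, hl₃, hμ, hp, hq, hp', hq'⟩
  set A := Algebra.adjoin k ({l | l ∈ [x, y, l₁, l₂, l₃, μ, p, q, p', q']} ∪ {b₁})
  have key : ∀ z ∈ ({l | l ∈ [x, y, l₁, l₂, l₃, μ, p, q, p', q']} ∪ {b₁} : Set _), z ∈ A :=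
    fun z hz => Algebra.subset_adjoin hz
  simp only [List.mem_cons, List.not_mem_nil, or_false, Set.mem_union, Set.mem_ofPred_eq,
    Set.mem_singleton_iff, or_assoc, forall_eq_or_imp, forall_eq] at key
  obtain ⟨kx, ky, k1, k2, k3, kμ, kp, kq, kp', kq', kb⟩ := key
  rintro p (rfl | rfl | rfl)
  · exact add_mem (mul_mem k1 (pow_mem kx 2)) (mul_mem ky kb)
  · exact add_mem (mul_mem k2 (pow_mem kx 2)) (mul_mem ky
      (add_mem (add_mem (mul_mem k2 kμ) (mul_mem kp' kx)) (mul_mem kq' ky)))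
  · exact add_mem (mul_mem k3 (pow_mem kx 2)) (mul_mem ky
      (add_mem (add_mem (mul_mem kp kx) (mul_mem kq ky)) (mul_mem kμ k3)))

/-- If one of the residual quadrics lies in an ideal of two of the linear forms, two quadrics and
few linear forms suffice. -/
theorem PDLT_of_quadric_mem (hx : x.IsHomogeneous 1) (hy : y.IsHomogeneous 1)
    (hl₁ : l₁.IsHomogeneous 1) (hl₂ : l₂.IsHomogeneous 1)
    (hb₁ : b₁.IsHomogeneous 2) (hb₂ : b₂.IsHomogeneous 2) (hb₃ : b₃.IsHomogeneous 2)
    {l : MvPolynomial (Fin n) k} (hl : l.IsHomogeneous 1) (h : b₃ ∈ Ideal.span {l, y}) :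
    PDLT (MvPolynomial (Fin n) k) (MvPolynomial (Fin n) k ⧸
      Ideal.span {l₁ * x ^ 2 + y * b₁, l₂ * x ^ 2 + y * b₂, y * b₃}) 37 := by
  obtain ⟨m, m', hm, hm', rfl⟩ := exists_isHomogeneous_pair hl hy hb₃ h
  refine PDLT_of_list_two (L := [x, y, l₁, l₂, l, m, m']) ?_ (by simp) hb₁ hb₂ ?_
  · simpa using ⟨hx, hy, hl₁, hl₂, hl, hm, hm'⟩
  set A := Algebra.adjoin k ({z | z ∈ [x, y, l₁, l₂, l, m, m']} ∪ {b₁, b₂})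
  have key : ∀ z ∈ ({z | z ∈ [x, y, l₁, l₂, l, m, m']} ∪ {b₁, b₂} : Set _), z ∈ A := fun z hz =>
    Algebra.subset_adjoin hz
  simp only [List.mem_cons, List.not_mem_nil, or_false, Set.mem_union, Set.mem_ofPred_eq,
    Set.mem_insert_iff, Set.mem_singleton_iff, or_assoc, forall_eq_or_imp, forall_eq] at key
  obtain ⟨kx, ky, k1, k2, kl, km, km', kb1, kb2⟩ := key
  rintro p (rfl | rfl | rfl)
  · exact add_mem (mul_mem k1 (pow_mem kx 2)) (mul_mem ky kb1)
  · exact add_mem (mul_mem k2 (pow_mem kx 2)) (mul_mem ky kb2)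
  · exact mul_mem ky (add_mem (mul_mem km kl) (mul_mem km' ky))

/-- The case where two of the cubics are divisible by `y`. -/
theorem PDLT_of_two_divisible {W : Submodule k (MvPolynomial (Fin n) k)} (hW : W ≤ linForms k n)
    (hxW : x ∈ W) (hyW : y ∈ W) (hl₁ : l₁ ∈ W)
    (hw₁ : IsWide W b₁) (hb₂ : b₂ ∈ Algebra.adjoin k (W : Set (MvPolynomial (Fin n) k)))
    (hb₃ : b₃ ∈ Algebra.adjoin k (W : Set (MvPolynomial (Fin n) k)))
    (hb₁' : b₁.IsHomogeneous 2) (hb₂' : b₂.IsHomogeneous 2) (hb₃' : b₃.IsHomogeneous 2)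
    (hy0 : y ≠ 0) (hx : ¬ y ∣ x) (h₁ : ¬ y ∣ l₁) :
    PDLT (MvPolynomial (Fin n) k) (MvPolynomial (Fin n) k ⧸
      Ideal.span {l₁ * x ^ 2 + y * b₁, y * b₂, y * b₃}) 37 := by
  have hy := prime_of_isHomogeneous_one (hW hyW) hy0
  have hmem : ∀ w ∈ W, w ∈ Algebra.adjoin k (W : Set (MvPolynomial (Fin n) k)) := fun w hw =>
    Algebra.subset_adjoin hw
  have hY : Submodule.span k {y} ≤ linForms k n := span_le_linForms (by simpa using hW hyW)
  obtain ⟨c⟩ := exists_linCoords hY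
  have hker : ∀ r, c.proj r = 0 ↔ y ∣ r := by
    intro r
    rw [c.proj_eq_zero_iff, ideal_span_span, Ideal.mem_span_singleton]
  have h0 := isHomogeneous_zero (Fin n) k 1
  have hmemY : ∀ {a b : k} {q q' : MvPolynomial (Fin n) k}, b ≠ 0 →
      a • q + b • q' ∈ Ideal.span (Submodule.span k {y} : Set (MvPolynomial (Fin n) k)) →
      ∃ z, q' - C (-(b⁻¹ * a)) * q = z * y := by
    intro a b q q' hb h
    rw [ideal_span_span, Ideal.mem_span_singleton] at h
    obtain ⟨z, hz⟩ := h
    refine ⟨C b⁻¹ * z, ?_⟩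
    have h1 : C b⁻¹ * C b = (1 : MvPolynomial (Fin n) k) := by
      rw [← C_mul, inv_mul_cancel₀ hb, C_1]
    rw [smul_eq_C_mul, smul_eq_C_mul] at hz
    rw [map_neg, map_mul]
    linear_combination C b⁻¹ * hz - q' * h1
  rcases RegularModulo.pair_or c hb₂' hb₃' with ⟨hr₁, hr₂, -⟩ | ⟨a, b, hab, h⟩ | ⟨l, hl, e₂, e₃⟩
  -- When `b₂`, `b₃` are regular modulo `y`, `y` is regular modulo `(b₂, b₃)`. Hence so is the wide
  -- cubic, and these three generate the colon by `y`.
  · rw [Set.insert_comm]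
    refine (PDLT_of_colon_linear hy hx h₁ rfl rfl rfl ?_).mono (by norm_num)
    rw [Set.insert_comm, Ideal.span_triple_eq_sup]
    refine PDLT.sup_of_regular ?_ (PDLT.quotient_span_pair _ _)
    refine hw₁.regular hW (G := {b₂, b₃}) (by rintro p (rfl | rfl); exacts [hb₂, hb₃])
      (isLinearlySaturated_span_pair _ _) (mul_mem (hmem _ hl₁) (pow_mem (hmem _ hxW) 2))
      (hmem _ hyW) fun r hr => ?_
    obtain ⟨s, t, e⟩ := Ideal.mem_span_pair.1 hr
    have e' := congrArg c.proj e
    rw [map_add, map_mul, map_mul, map_mul, (hker y).2 dvd_rfl, mul_zero] at e'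
    have ht := hr₂ (c.proj t) (by
      rw [bot_sup_eq, Ideal.mem_span_singleton]
      exact ⟨-c.proj s, by linear_combination e'⟩)
    rw [bot_sup_eq, Ideal.mem_span_singleton] at ht
    obtain ⟨w, hw⟩ := ht
    obtain ⟨t', ht'⟩ := (hker (t - b₂ * c.lift w)).1 (by
      rw [map_sub, map_mul, c.proj_lift, hw, sub_self])
    have hs := hr₁ (c.proj (s + b₃ * c.lift w)) (by
      rw [Ideal.mem_bot, map_add, map_mul, c.proj_lift]
      linear_combination e' - c.proj b₃ * hw)
    rw [Ideal.mem_bot, hker] at hs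
    obtain ⟨s', hs'⟩ := hs
    refine Ideal.mem_span_pair.2 ⟨s', t', mul_left_cancel₀ hy0 ?_⟩
    linear_combination e - b₂ * hs' - b₃ * ht'
  -- With a nonzero coefficient on `b₃`, it can be replaced by a multiple of `y`, that is, an
  -- element of `(0, y)`.
  · suffices H : ∀ {a b : k} {b₂ b₃ : MvPolynomial (Fin n) k}, b₂.IsHomogeneous 2 →
        b₃.IsHomogeneous 2 → b ≠ 0 →
        a • b₂ + b • b₃ ∈ Ideal.span (Submodule.span k {y} : Set (MvPolynomial (Fin n) k)) →
        PDLT (MvPolynomial (Fin n) k) (MvPolynomial (Fin n) k ⧸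
          Ideal.span {l₁ * x ^ 2 + y * b₁, y * b₂, y * b₃}) 37 by
      rcases hab with ha | hb
      · rw [Ideal.span_triple_swap]
        rw [add_comm] at h
        exact H hb₃' hb₂' ha h
      · exact H hb₂' hb₃' hb h
    intro a b b₂ b₃ hb₂' hb₃' hb h
    obtain ⟨z, hz⟩ := hmemY hb h
    set γ := -(b⁻¹ * a)
    have h2 := PDLT_of_quadric_mem (l₂ := 0) (b₃ := b₃ - C γ * b₂) (hW hxW) (hW hyW) (hW hl₁) h0
      hb₁' hb₂' (sub_C_mul_isHomogeneous hb₃' hb₂' γ) h0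
      (Ideal.mem_span_pair.2 ⟨0, z, by rw [hz]; ring⟩)
    rw [zero_mul, zero_add, Ideal.span_triple_swap, mul_sub, mul_left_comm,
      Ideal.span_triple_sub_mul, Ideal.span_triple_swap] at h2
    exact h2
  · have e : Submodule.span k {y} ⊔ Submodule.span k {l} = Submodule.span k {y, l} := by
      rw [Submodule.span_insert]
    rw [e, ideal_span_span] at e₂ e₃
    obtain ⟨m, m', hm, hm', rfl⟩ := exists_isHomogeneous_pair (hW hyW) hl hb₂' e₂
    obtain ⟨p, p', hp, hp', rfl⟩ := exists_isHomogeneous_pair (hW hyW) hl hb₃' e₃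
    refine PDLT_of_list_one (L := [x, y, l₁, l, m, m', p, p']) ?_ (by simp) hb₁' ?_
    · simpa using ⟨hW hxW, hW hyW, hW hl₁, hl, hm, hm', hp, hp'⟩
    set A := Algebra.adjoin k ({z | z ∈ [x, y, l₁, l, m, m', p, p']} ∪ {b₁})
    have key : ∀ z ∈ ({z | z ∈ [x, y, l₁, l, m, m', p, p']} ∪ {b₁} : Set _), z ∈ A := fun z hz =>
      Algebra.subset_adjoin hz
    simp only [List.mem_cons, List.not_mem_nil, or_false, Set.mem_union, Set.mem_ofPred_eq,
      Set.mem_singleton_iff, or_assoc, forall_eq_or_imp, forall_eq] at key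
    obtain ⟨kx, ky, k1, kl, km, km', kp, kp', kb⟩ := key
    rintro p (rfl | rfl | rfl)
    · exact add_mem (mul_mem k1 (pow_mem kx 2)) (mul_mem ky kb)
    · exact mul_mem ky (add_mem (mul_mem km ky) (mul_mem km' kl))
    · exact mul_mem ky (add_mem (mul_mem kp ky) (mul_mem kp' kl))

end MvPolynomial

theorem Ideal.span_triple_rotate {R : Type*} [CommRing R] (f g h : R) :
    Ideal.span {f, g, h} = Ideal.span {g, h, f} := by
  congr 1
  ext
  simp only [Set.mem_insert_iff, Set.mem_singleton_iff]
  tauto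

theorem Ideal.span_triple_combination {R : Type*} [CommRing R] (f g h a b : R) {u : R}
    (hu : IsUnit u) : Ideal.span {f, g, a * f + b * g + u * h} = Ideal.span {f, g, h} := by
  obtain ⟨v, hv⟩ := hu.exists_left_inv
  refine le_antisymm (Ideal.span_le.2 ?_) (Ideal.span_le.2 ?_)
  · rintro p (rfl | rfl | rfl)
    · exact Ideal.subset_span (by simp)
    · exact Ideal.subset_span (by simp)
    · exact Ideal.mem_span_triple.2 ⟨a, b, u, rfl⟩
  · rintro p (rfl | rfl | rfl)
    · exact Ideal.subset_span (by simp)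
    · exact Ideal.subset_span (by simp)
    · exact Ideal.mem_span_triple.2 ⟨-v * a, -v * b, v, by linear_combination p * hv⟩

/-! ### Square pencils in general -/

namespace MvPolynomial

variable {k : Type u} [Field k] {n : ℕ}
  {x y l₁ l₂ l₃ b₁ b₂ b₃ : MvPolynomial (Fin n) k}

theorem C_mul_isHomogeneous {p : MvPolynomial (Fin n) k} {d : ℕ} (hp : p.IsHomogeneous d) (c : k) :
    (C c * p).IsHomogeneous d := by
  simpa using (isHomogeneous_C _ c).mul hp

/-- The division follows the dependence of `l₁`, `l₂`, `l₃` modulo `y`. Subtracting multiples of the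
second cubic turns a dependent one into `y` times a quadric; adding a polynomial in `W` preserves
wideness of `b₁`. -/
theorem PDLT_of_isWide_aux {W : Submodule k (MvPolynomial (Fin n) k)} (hW : W ≤ linForms k n)
    (hxW : x ∈ W) (hyW : y ∈ W) (hl₁ : l₁ ∈ W) (hl₂ : l₂ ∈ W) (hl₃ : l₃ ∈ W)
    (hw : IsWide W b₁) (hb₂ : b₂ ∈ Algebra.adjoin k (W : Set (MvPolynomial (Fin n) k)))
    (hb₃ : b₃ ∈ Algebra.adjoin k (W : Set (MvPolynomial (Fin n) k)))
    (hb₁' : b₁.IsHomogeneous 2) (hb₂' : b₂.IsHomogeneous 2) (hb₃' : b₃.IsHomogeneous 2)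
    (hy0 : y ≠ 0) (hx : ¬ y ∣ x) (h₂ : ¬ y ∣ l₂) :
    PDLT (MvPolynomial (Fin n) k) (MvPolynomial (Fin n) k ⧸
      Ideal.span {l₁ * x ^ 2 + y * b₁, l₂ * x ^ 2 + y * b₂, l₃ * x ^ 2 + y * b₃}) 37 := by
  have hmem : ∀ w ∈ W, w ∈ Algebra.adjoin k (W : Set (MvPolynomial (Fin n) k)) := fun w hw =>
    Algebra.subset_adjoin hw
  have hC : ∀ c : k, C c ∈ Algebra.adjoin k (W : Set (MvPolynomial (Fin n) k)) := fun c =>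
    Subalgebra.algebraMap_mem _ c
  have hxx : x ^ 2 ∈ Algebra.adjoin k (W : Set (MvPolynomial (Fin n) k)) := pow_mem (hmem _ hxW) 2
  have hxh : (x ^ 2).IsHomogeneous 2 := (hW hxW : x.IsHomogeneous 1).pow 2
  by_cases h₃ : l₃ ∈ Ideal.span {l₂, y}
  · obtain ⟨a, b, rfl⟩ := exists_C_mul_add_C_mul (hW hl₂) (hW hyW) (hW hl₃) h₃
    have hB' : (b₃ - C a * b₂ + C b * x ^ 2).IsHomogeneous 2 :=
      (sub_C_mul_isHomogeneous hb₃' hb₂' a).add (C_mul_isHomogeneous hxh b)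
    have hB : b₃ - C a * b₂ + C b * x ^ 2 ∈
        Algebra.adjoin k (W : Set (MvPolynomial (Fin n) k)) :=
      add_mem (sub_mem hb₃ (mul_mem (hC a) hb₂)) (mul_mem (hC b) hxx)
    rw [Ideal.span_triple_swap, ← Ideal.span_triple_sub_mul _ _ _ (C a), Ideal.span_triple_swap,
      show (C a * l₂ + C b * y) * x ^ 2 + y * b₃ - C a * (l₂ * x ^ 2 + y * b₂) =
        y * (b₃ - C a * b₂ + C b * x ^ 2) by ring]
    generalize b₃ - C a * b₂ + C b * x ^ 2 = B at hB hB'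
    by_cases h₁ : l₁ ∈ Ideal.span {l₂, y}
    · obtain ⟨c, d, rfl⟩ := exists_C_mul_add_C_mul (hW hl₂) (hW hyW) (hW hl₁) h₁
      rw [Ideal.span_triple_rotate, Ideal.span_triple_rotate,
        ← Ideal.span_triple_sub_mul _ _ _ (C c), Ideal.span_triple_rotate,
        show (C c * l₂ + C d * y) * x ^ 2 + y * b₁ - C c * (l₂ * x ^ 2 + y * b₂) =
        y * (b₁ + (C d * x ^ 2 - C c * b₂)) by ring]
      have hw' := hw.add (sub_mem (mul_mem (hC d) hxx) (mul_mem (hC c) hb₂))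
      refine (PDLT_of_colon_linear (prime_of_isHomogeneous_one (hW hyW) hy0) hx h₂ rfl rfl rfl
        ?_).mono (by norm_num)
      rw [Ideal.span_triple_eq_sup]
      refine PDLT.sup_of_regular (fun r hr => ?_) (PDLT.quotient_span_pair _ _)
      -- After the colon by `y` the wide quadric itself is a generator, so regularity is used with
      -- `e = 0` and `y` replaced by 1.
      refine hw'.regular hW (G := {l₂ * x ^ 2 + y * b₂, B}) ?_ (isLinearlySaturated_span_pair _ _)
        (zero_mem _) (one_mem _) (fun a ha => by simpa using ha) r (by simpa using hr)
      rintro p (rfl | rfl)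
      exacts [add_mem (mul_mem (hmem _ hl₂) hxx) (mul_mem (hmem _ hyW) hb₂), hB]
    by_cases hBx : B ∈ Ideal.span {x, y}
    · exact PDLT_of_quadric_mem (hW hxW) (hW hyW) (hW hl₁) (hW hl₂) hb₁' hb₂' hB' (hW hxW) hBx
    by_cases hBl : B ∈ Ideal.span {l₂, y}
    · exact PDLT_of_quadric_mem (hW hxW) (hW hyW) (hW hl₁) (hW hl₂) hb₁' hb₂' hB' (hW hl₂) hBl
    exact (PDLT_of_divisible_pencil hW hxW hyW hl₁ hl₂ hw hb₂ hB hb₂' hy0 hx h₂ h₁ hBx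
      hBl).mono (by norm_num)
  by_cases hΔ : l₂ * b₃ - l₃ * b₂ ∈ Ideal.span {x, y}
  · exact PDLT_of_degenerate (hW hxW) (hW hyW) (hW hl₁) (hW hl₂) (hW hl₃) hb₁' hb₂' hb₃' h₂ h₃ hΔ
  · exact (PDLT_of_pencil hW hxW hyW hl₁ hl₂ hl₃ hw hb₂ hb₃ hy0 hx h₂ h₃ hΔ).mono (by norm_num)

theorem PDLT_of_isWide {W : Submodule k (MvPolynomial (Fin n) k)} (hW : W ≤ linForms k n)
    (hxW : x ∈ W) (hyW : y ∈ W) (hl₁ : l₁ ∈ W) (hl₂ : l₂ ∈ W) (hl₃ : l₃ ∈ W)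
    (hw : IsWide W b₁) (hb₂ : b₂ ∈ Algebra.adjoin k (W : Set (MvPolynomial (Fin n) k)))
    (hb₃ : b₃ ∈ Algebra.adjoin k (W : Set (MvPolynomial (Fin n) k)))
    (hb₁' : b₁.IsHomogeneous 2) (hb₂' : b₂.IsHomogeneous 2) (hb₃' : b₃.IsHomogeneous 2)
    (hy0 : y ≠ 0) (hx : ¬ y ∣ x)
    (hJ : ¬ Ideal.span {l₁ * x ^ 2 + y * b₁, l₂ * x ^ 2 + y * b₂, l₃ * x ^ 2 + y * b₃} ≤
      Ideal.span {y}) :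
    PDLT (MvPolynomial (Fin n) k) (MvPolynomial (Fin n) k ⧸
      Ideal.span {l₁ * x ^ 2 + y * b₁, l₂ * x ^ 2 + y * b₂, l₃ * x ^ 2 + y * b₃}) 37 := by
  by_cases h₂ : y ∣ l₂
  · by_cases h₃ : y ∣ l₃
    · have hmem : ∀ w ∈ W, w ∈ Algebra.adjoin k (W : Set (MvPolynomial (Fin n) k)) := fun w hw =>
        Algebra.subset_adjoin hw
      have hC : ∀ c : k, C c ∈ Algebra.adjoin k (W : Set (MvPolynomial (Fin n) k)) := fun c =>
        Subalgebra.algebraMap_mem _ c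
      have hxh : (x ^ 2).IsHomogeneous 2 := (hW hxW : x.IsHomogeneous 1).pow 2
      have h₁ : ¬ y ∣ l₁ := by
        intro h₁
        refine hJ (Ideal.span_le.2 ?_)
        rintro p (rfl | rfl | rfl) <;> rw [SetLike.mem_coe, Ideal.mem_span_singleton]
        · exact dvd_add (h₁.mul_right _) (dvd_mul_right _ _)
        · exact dvd_add (h₂.mul_right _) (dvd_mul_right _ _)
        · exact dvd_add (h₃.mul_right _) (dvd_mul_right _ _)
      obtain ⟨a, ha, rfl⟩ := exists_isHomogeneous_of_dvd (d := 0) (hW hyW) (hW hl₂) h₂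
      obtain ⟨b, hb, rfl⟩ := exists_isHomogeneous_of_dvd (d := 0) (hW hyW) (hW hl₃) h₃
      obtain ⟨a, rfl⟩ := ha.exists_eq_C
      obtain ⟨b, rfl⟩ := hb.exists_eq_C
      rw [show C a * y * x ^ 2 + y * b₂ = y * (b₂ + C a * x ^ 2) by ring,
        show C b * y * x ^ 2 + y * b₃ = y * (b₃ + C b * x ^ 2) by ring]
      exact PDLT_of_two_divisible hW hxW hyW hl₁ hw
        (add_mem hb₂ (mul_mem (hC a) (pow_mem (hmem _ hxW) 2)))
        (add_mem hb₃ (mul_mem (hC b) (pow_mem (hmem _ hxW) 2))) hb₁'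
        (hb₂'.add (C_mul_isHomogeneous hxh a)) (hb₃'.add (C_mul_isHomogeneous hxh b)) hy0 hx h₁
    · rw [Ideal.span_triple_swap]
      exact PDLT_of_isWide_aux hW hxW hyW hl₁ hl₃ hl₂ hw hb₃ hb₂ hb₁' hb₃' hb₂' hy0 hx h₃
  · exact PDLT_of_isWide_aux hW hxW hyW hl₁ hl₂ hl₃ hw hb₂ hb₃ hb₁' hb₂' hb₃' hy0 hx h₂

/-- Outside the ideal of `W`, `b₁` is regular and the bound is `30 + 1`. Inside, it is either wide
or a polynomial in at most 32 linear forms. -/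
theorem PDLT_of_two_in_adjoin {W : Submodule k (MvPolynomial (Fin n) k)} (hW : W ≤ linForms k n)
    (hfin : Module.finrank k W ≤ 30)
    (hxW : x ∈ W) (hyW : y ∈ W) (hl₁ : l₁ ∈ W) (hl₂ : l₂ ∈ W) (hl₃ : l₃ ∈ W)
    (hb₂ : b₂ ∈ Algebra.adjoin k (W : Set (MvPolynomial (Fin n) k)))
    (hb₃ : b₃ ∈ Algebra.adjoin k (W : Set (MvPolynomial (Fin n) k)))
    (hb₁' : b₁.IsHomogeneous 2) (hb₂' : b₂.IsHomogeneous 2) (hb₃' : b₃.IsHomogeneous 2)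
    (hy0 : y ≠ 0) (hx : ¬ y ∣ x)
    (hJ : ¬ Ideal.span {l₁ * x ^ 2 + y * b₁, l₂ * x ^ 2 + y * b₂, l₃ * x ^ 2 + y * b₃} ≤
      Ideal.span {y}) :
    PDLT (MvPolynomial (Fin n) k) (MvPolynomial (Fin n) k ⧸
      Ideal.span {l₁ * x ^ 2 + y * b₁, l₂ * x ^ 2 + y * b₂, l₃ * x ^ 2 + y * b₃}) 37 := by
  have hgen : ∀ A : Subalgebra k (MvPolynomial (Fin n) k), (∀ w ∈ W, w ∈ A) → b₁ ∈ A →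
      {l₁ * x ^ 2 + y * b₁, l₂ * x ^ 2 + y * b₂, l₃ * x ^ 2 + y * b₃} ⊆
        (A : Set (MvPolynomial (Fin n) k)) := by
    intro A hA hb
    have hle : Algebra.adjoin k (W : Set (MvPolynomial (Fin n) k)) ≤ A := Algebra.adjoin_le hA
    rintro p (rfl | rfl | rfl)
    · exact add_mem (mul_mem (hA _ hl₁) (pow_mem (hA _ hxW) 2)) (mul_mem (hA _ hyW) hb)
    · exact add_mem (mul_mem (hA _ hl₂) (pow_mem (hA _ hxW) 2)) (mul_mem (hA _ hyW) (hle hb₂))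
    · exact add_mem (mul_mem (hA _ hl₃) (pow_mem (hA _ hxW) 2)) (mul_mem (hA _ hyW) (hle hb₃))
  by_cases h : b₁ ∈ Ideal.span (W : Set (MvPolynomial (Fin n) k))
  · rcases isWide_or hW hb₁' h with hw | ⟨W', hWW, hW', hfin', hb₁⟩
    · exact PDLT_of_isWide hW hxW hyW hl₁ hl₂ hl₃ hw hb₂ hb₃ hb₁' hb₂' hb₃' hy0 hx hJ
    · exact PDLT_of_adjoin hW' (hgen _ (fun w hw => Algebra.subset_adjoin (hWW hw)) hb₁) (by omega)
  · obtain ⟨c⟩ := exists_linCoords hW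
    rw [← c.proj_eq_zero_iff] at h
    refine (PDLT_of_regular_mod c (s := 1) (e := 2) two_pos ![b₁] (by simpa using hb₁')
      (by simpa using RegularModulo.singleton h) _ (hgen _ (fun w hw => ?_) ?_)).mono (by omega)
    · exact Algebra.subset_adjoin (Or.inl hw)
    · exact Algebra.subset_adjoin (Or.inr (by simp))

/-- A regular pair gives `14 + 2`. A combination of `b₁`, `b₂` in the ideal of `W` becomes a
polynomial in 28 forms and replaces one of them. With a common linear factor, `b₂` is a polynomial
in `2 * 15 = 30` forms. -/
theorem PDLT_of_one_in_adjoin {W : Submodule k (MvPolynomial (Fin n) k)} (hW : W ≤ linForms k n)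
    (hfin : Module.finrank k W ≤ 14)
    (hxW : x ∈ W) (hyW : y ∈ W) (hl₁ : l₁ ∈ W) (hl₂ : l₂ ∈ W) (hl₃ : l₃ ∈ W)
    (hb₃ : b₃ ∈ Algebra.adjoin k (W : Set (MvPolynomial (Fin n) k)))
    (hb₁' : b₁.IsHomogeneous 2) (hb₂' : b₂.IsHomogeneous 2) (hb₃' : b₃.IsHomogeneous 2)
    (hy0 : y ≠ 0) (hx : ¬ y ∣ x)
    (hJ : ¬ Ideal.span {l₁ * x ^ 2 + y * b₁, l₂ * x ^ 2 + y * b₂, l₃ * x ^ 2 + y * b₃} ≤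
      Ideal.span {y}) :
    PDLT (MvPolynomial (Fin n) k) (MvPolynomial (Fin n) k ⧸
      Ideal.span {l₁ * x ^ 2 + y * b₁, l₂ * x ^ 2 + y * b₂, l₃ * x ^ 2 + y * b₃}) 37 := by
  obtain ⟨c⟩ := exists_linCoords hW
  rcases RegularModulo.pair_or c hb₁' hb₂' with h | ⟨a, b, hab, h⟩ | ⟨l, hl, -, e₂⟩
  · refine (PDLT_of_regular_mod c (s := 2) (e := 2) two_pos ![b₁, b₂]
      (Fin.forall_fin_two.2 ⟨hb₁', hb₂'⟩) (by simpa using h) _ ?_).mono (by omega)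
    have key : ∀ w ∈ W, w ∈ Algebra.adjoin k
      ((W : Set (MvPolynomial (Fin n) k)) ∪ Set.range ![b₁, b₂]) := fun w hw =>
        Algebra.subset_adjoin (Or.inl hw)
    have key' : ∀ i, ![b₁, b₂] i ∈ Algebra.adjoin k
      ((W : Set (MvPolynomial (Fin n) k)) ∪ Set.range ![b₁, b₂]) := fun i =>
        Algebra.subset_adjoin (Or.inr ⟨i, rfl⟩)
    rintro p (rfl | rfl | rfl)
    · exact add_mem (mul_mem (key _ hl₁) (pow_mem (key _ hxW) 2)) (mul_mem (key _ hyW) (key' 0))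
    · exact add_mem (mul_mem (key _ hl₂) (pow_mem (key _ hxW) 2)) (mul_mem (key _ hyW) (key' 1))
    · exact add_mem (mul_mem (key _ hl₃) (pow_mem (key _ hxW) 2)) (mul_mem (key _ hyW)
        (Algebra.adjoin_mono Set.subset_union_left hb₃))
  · have hb := smul_add_smul_isHomogeneous hb₁' hb₂' a b
    obtain ⟨W', hWW, hW', hfin', hmem⟩ := exists_linForms_of_quadric_mem hW hb h
    have hb₃'' := Algebra.adjoin_mono (R := k) hWW hb₃
    have hl : a • l₁ + b • l₂ ∈ W' :=
      W'.add_mem (W'.smul_mem _ (hWW hl₁)) (W'.smul_mem _ (hWW hl₂))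
    have hg : (a • l₁ + b • l₂) * x ^ 2 + y * (a • b₁ + b • b₂) =
        C a * (l₁ * x ^ 2 + y * b₁) + C b * (l₂ * x ^ 2 + y * b₂) := by
      simp only [smul_eq_C_mul]
      ring
    rcases hab with ha | hb0
    · have e : Ideal.span {l₂ * x ^ 2 + y * b₂,
          (a • l₁ + b • l₂) * x ^ 2 + y * (a • b₁ + b • b₂), l₃ * x ^ 2 + y * b₃} =
          Ideal.span {l₁ * x ^ 2 + y * b₁, l₂ * x ^ 2 + y * b₂, l₃ * x ^ 2 + y * b₃} := by
        rw [hg, Ideal.span_triple_swap, show C a * (l₁ * x ^ 2 + y * b₁) +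
          C b * (l₂ * x ^ 2 + y * b₂) = C b * (l₂ * x ^ 2 + y * b₂) + 0 * (l₃ * x ^ 2 + y * b₃) +
          C a * (l₁ * x ^ 2 + y * b₁) by ring, Ideal.span_triple_combination _ _ _ _ _
          ((isUnit_iff_ne_zero.2 ha).map C), Ideal.span_triple_rotate, Ideal.span_triple_rotate]
      rw [← e] at hJ ⊢
      exact PDLT_of_two_in_adjoin hW' (by omega) (hWW hxW) (hWW hyW) (hWW hl₂) hl (hWW hl₃) hmem
        hb₃'' hb₂' hb hb₃' hy0 hx hJ
    · have e : Ideal.span {l₁ * x ^ 2 + y * b₁,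
          (a • l₁ + b • l₂) * x ^ 2 + y * (a • b₁ + b • b₂), l₃ * x ^ 2 + y * b₃} =
          Ideal.span {l₁ * x ^ 2 + y * b₁, l₂ * x ^ 2 + y * b₂, l₃ * x ^ 2 + y * b₃} := by
        rw [hg, Ideal.span_triple_swap, show C a * (l₁ * x ^ 2 + y * b₁) +
          C b * (l₂ * x ^ 2 + y * b₂) = C a * (l₁ * x ^ 2 + y * b₁) + 0 * (l₃ * x ^ 2 + y * b₃) +
          C b * (l₂ * x ^ 2 + y * b₂) by ring, Ideal.span_triple_combination _ _ _ _ _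
          ((isUnit_iff_ne_zero.2 hb0).map C), Ideal.span_triple_swap]
      rw [← e] at hJ ⊢
      exact PDLT_of_two_in_adjoin hW' (by omega) (hWW hxW) (hWW hyW) (hWW hl₁) hl (hWW hl₃) hmem
        hb₃'' hb₁' hb hb₃' hy0 hx hJ
  · have hW1 := sup_span_singleton_le hW hl
    have hfin1 := finrank_sup_span_singleton_le hW l
    obtain ⟨W', hWW, hW', hfin', hmem⟩ := exists_linForms_of_quadric_mem hW1 hb₂' e₂
    replace hWW : W ≤ W' := le_sup_left.trans hWW
    exact PDLT_of_two_in_adjoin hW' (by omega) (hWW hxW) (hWW hyW) (hWW hl₁) (hWW hl₂) (hWW hl₃)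
      hmem (Algebra.adjoin_mono (R := k) hWW hb₃) hb₁' hb₂' hb₃' hy0 hx hJ

/-- Let `V` be spanned by the five given linear forms. If the `bᵢ` are regular modulo `V`, the bound
is `5 + 3`. If not, a combination lies in the ideal of `5 + 2` forms, hence is a polynomial in 14;
its cubic replaces one whose coefficient is nonzero. -/
theorem PDLT_of_square_pencil (hxh : x.IsHomogeneous 1) (hyh : y.IsHomogeneous 1)
    (hl₁ : l₁.IsHomogeneous 1) (hl₂ : l₂.IsHomogeneous 1) (hl₃ : l₃.IsHomogeneous 1)
    (hb₁ : b₁.IsHomogeneous 2) (hb₂ : b₂.IsHomogeneous 2) (hb₃ : b₃.IsHomogeneous 2)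
    (hy0 : y ≠ 0) (hx : ¬ y ∣ x)
    (hJ : ¬ Ideal.span {l₁ * x ^ 2 + y * b₁, l₂ * x ^ 2 + y * b₂, l₃ * x ^ 2 + y * b₃} ≤
      Ideal.span {y}) :
    PDLT (MvPolynomial (Fin n) k) (MvPolynomial (Fin n) k ⧸
      Ideal.span {l₁ * x ^ 2 + y * b₁, l₂ * x ^ 2 + y * b₂, l₃ * x ^ 2 + y * b₃}) 37 := by
  set V := Submodule.span k {l | l ∈ [x, y, l₁, l₂, l₃]} with hV
  have hVW : V ≤ linForms k n := span_le_linForms (by simpa using ⟨hxh, hyh, hl₁, hl₂, hl₃⟩)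
  have hVfin : Module.finrank k V ≤ 5 := finrank_span_list_le _
  have key : ∀ z ∈ [x, y, l₁, l₂, l₃], z ∈ V := fun z hz => Submodule.subset_span hz
  simp only [List.mem_cons, List.not_mem_nil, or_false, forall_eq_or_imp, forall_eq] at key
  obtain ⟨kx, ky, k1, k2, k3⟩ := key
  obtain ⟨c⟩ := exists_linCoords hVW
  by_cases H : ∀ c₁ c₂ c₃ : k, c₁ ≠ 0 ∨ c₂ ≠ 0 ∨ c₃ ≠ 0 → ∀ l l' : MvPolynomial (Fin c.t) k,
      l.IsHomogeneous 1 → l'.IsHomogeneous 1 →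
      c₁ • c.proj b₁ + c₂ • c.proj b₂ + c₃ • c.proj b₃ ∉ Ideal.span {l, l'}
  · have hreg := RegularModulo.triple (c.isHomogeneous_proj hb₁) (c.isHomogeneous_proj hb₂)
      (c.isHomogeneous_proj hb₃) H
    refine (PDLT_of_regular_mod c (s := 3) (e := 2) two_pos ![b₃, b₂, b₁] ?_
      (by simpa using hreg) _ ?_).mono (by omega)
    · intro i
      fin_cases i
      exacts [hb₃, hb₂, hb₁]
    have key : ∀ w ∈ V, w ∈ Algebra.adjoin k
      ((V : Set (MvPolynomial (Fin n) k)) ∪ Set.range ![b₃, b₂, b₁]) := fun w hw =>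
        Algebra.subset_adjoin (Or.inl hw)
    have key' : ∀ i, ![b₃, b₂, b₁] i ∈ Algebra.adjoin k
      ((V : Set (MvPolynomial (Fin n) k)) ∪ Set.range ![b₃, b₂, b₁]) := fun i =>
        Algebra.subset_adjoin (Or.inr ⟨i, rfl⟩)
    rintro p (rfl | rfl | rfl)
    · exact add_mem (mul_mem (key _ k1) (pow_mem (key _ kx) 2)) (mul_mem (key _ ky) (key' 2))
    · exact add_mem (mul_mem (key _ k2) (pow_mem (key _ kx) 2)) (mul_mem (key _ ky) (key' 1))
    · exact add_mem (mul_mem (key _ k3) (pow_mem (key _ kx) 2)) (mul_mem (key _ ky) (key' 0))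
  push Not at H
  obtain ⟨c₁, c₂, c₃, hc, l, l', hl, hl', hmem⟩ := H
  rw [← map_smul, ← map_smul, ← map_smul, ← map_add, ← map_add] at hmem
  have hmem' := c.mem_span_sup_of_proj_mem hmem
  set b := c₁ • b₁ + c₂ • b₂ + c₃ • b₃ with hb
  have hbh : b.IsHomogeneous 2 := (smul_add_smul_isHomogeneous hb₁ hb₂ c₁ c₂).add (by
    rw [smul_eq_C_mul]
    exact C_mul_isHomogeneous hb₃ c₃)
  rw [Set.image_pair] at hmem'
  have hV1 : V ⊔ Submodule.span k {c.lift l, c.lift l'} ≤ linForms k n :=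
    sup_le hVW (span_le_linForms (by
      rintro z (rfl | rfl)
      exacts [c.isHomogeneous_lift hl, c.isHomogeneous_lift hl']))
  have hV1fin : Module.finrank k (V ⊔ Submodule.span k {c.lift l, c.lift l'} : Submodule k _) ≤ 7 := by
    have e : V ⊔ Submodule.span k {c.lift l, c.lift l'} =
        V ⊔ Submodule.span k {c.lift l} ⊔ Submodule.span k {c.lift l'} := by
      rw [Submodule.span_insert, sup_assoc]
    rw [e]
    have h1 := finrank_sup_span_singleton_le hVW (c.lift l)
    have h2 := finrank_sup_span_singleton_le
      (sup_span_singleton_le hVW (c.isHomogeneous_lift hl)) (c.lift l')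
    omega
  obtain ⟨W, hVW', hW, hfin, hbW⟩ := exists_linForms_of_quadric_mem hV1 hbh hmem'
  replace hVW' : V ≤ W := le_sup_left.trans hVW'
  have kL : c₁ • l₁ + c₂ • l₂ + c₃ • l₃ ∈ W := hVW' (V.add_mem (V.add_mem (V.smul_mem _ k1)
    (V.smul_mem _ k2)) (V.smul_mem _ k3))
  have hg : (c₁ • l₁ + c₂ • l₂ + c₃ • l₃) * x ^ 2 + y * b =
      C c₁ * (l₁ * x ^ 2 + y * b₁) + C c₂ * (l₂ * x ^ 2 + y * b₂) +
        C c₃ * (l₃ * x ^ 2 + y * b₃) := by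
    simp only [hb, smul_eq_C_mul]
    ring
  have hunit : ∀ {a : k}, a ≠ 0 → IsUnit (C a : MvPolynomial (Fin n) k) := fun ha =>
    (isUnit_iff_ne_zero.2 ha).map C
  rcases hc with h | h | h
  · have e : Ideal.span {l₂ * x ^ 2 + y * b₂, l₃ * x ^ 2 + y * b₃,
        (c₁ • l₁ + c₂ • l₂ + c₃ • l₃) * x ^ 2 + y * b} =
        Ideal.span {l₁ * x ^ 2 + y * b₁, l₂ * x ^ 2 + y * b₂, l₃ * x ^ 2 + y * b₃} := by
      rw [hg, show C c₁ * (l₁ * x ^ 2 + y * b₁) + C c₂ * (l₂ * x ^ 2 + y * b₂) +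
        C c₃ * (l₃ * x ^ 2 + y * b₃) = C c₂ * (l₂ * x ^ 2 + y * b₂) +
        C c₃ * (l₃ * x ^ 2 + y * b₃) + C c₁ * (l₁ * x ^ 2 + y * b₁) by ring,
        Ideal.span_triple_combination _ _ _ _ _ (hunit h),
        Ideal.span_triple_rotate (l₁ * x ^ 2 + y * b₁)]
    rw [← e] at hJ ⊢
    exact PDLT_of_one_in_adjoin hW (by omega) (hVW' kx) (hVW' ky) (hVW' k2) (hVW' k3) kL hbW
      hb₂ hb₃ hbh hy0 hx hJ
  · have e : Ideal.span {l₁ * x ^ 2 + y * b₁, l₃ * x ^ 2 + y * b₃,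
        (c₁ • l₁ + c₂ • l₂ + c₃ • l₃) * x ^ 2 + y * b} =
        Ideal.span {l₁ * x ^ 2 + y * b₁, l₂ * x ^ 2 + y * b₂, l₃ * x ^ 2 + y * b₃} := by
      rw [hg, show C c₁ * (l₁ * x ^ 2 + y * b₁) + C c₂ * (l₂ * x ^ 2 + y * b₂) +
        C c₃ * (l₃ * x ^ 2 + y * b₃) = C c₁ * (l₁ * x ^ 2 + y * b₁) +
        C c₃ * (l₃ * x ^ 2 + y * b₃) + C c₂ * (l₂ * x ^ 2 + y * b₂) by ring,
        Ideal.span_triple_combination _ _ _ _ _ (hunit h), Ideal.span_triple_swap]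
    rw [← e] at hJ ⊢
    exact PDLT_of_one_in_adjoin hW (by omega) (hVW' kx) (hVW' ky) (hVW' k1) (hVW' k3) kL hbW
      hb₁ hb₃ hbh hy0 hx hJ
  · have e : Ideal.span {l₁ * x ^ 2 + y * b₁, l₂ * x ^ 2 + y * b₂,
        (c₁ • l₁ + c₂ • l₂ + c₃ • l₃) * x ^ 2 + y * b} =
        Ideal.span {l₁ * x ^ 2 + y * b₁, l₂ * x ^ 2 + y * b₂, l₃ * x ^ 2 + y * b₃} := by
      rw [hg, Ideal.span_triple_combination _ _ _ _ _ (hunit h)]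
    rw [← e] at hJ ⊢
    exact PDLT_of_one_in_adjoin hW (by omega) (hVW' kx) (hVW' ky) (hVW' k1) (hVW' k2) kL hbW
      hb₁ hb₂ hbh hy0 hx hJ

end MvPolynomial

/-! ### Length at the prime and rank of the coefficient matrix -/

/-- The element `d` becomes a unit at `P`, so the maximal ideal kills the class of 1, and the
localization is a quotient of the residue field. -/
theorem Module.length_localizedModule_quotient_le_one {R : Type*} [CommRing R] {I P : Ideal R}
    [P.IsPrime] {d : R} (hd : d ∉ P) (h : ∀ p ∈ P, d * p ∈ I) :
    Module.length (Localization.AtPrime P) (LocalizedModule P.primeCompl (R ⧸ I)) ≤ 1 := by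
  let A := Localization.AtPrime P
  let u : LocalizedModule P.primeCompl (R ⧸ I) := LocalizedModule.mk (Ideal.Quotient.mk I 1) 1
  let F : A →ₗ[A] LocalizedModule P.primeCompl (R ⧸ I) := LinearMap.toSpanSingleton A _ u
  have hF : ∀ (r : R) (s : P.primeCompl), F (Localization.mk r s) =
      LocalizedModule.mk (Ideal.Quotient.mk I r) s := by
    intro r s
    rw [LinearMap.toSpanSingleton_apply, LocalizedModule.mk_smul_mk, mul_one]
    congr 1
    rw [Algebra.smul_def, Ideal.Quotient.algebraMap_eq, ← map_mul, mul_one]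
  have hker : IsLocalRing.maximalIdeal A ≤ LinearMap.ker F := by
    intro a ha
    induction a using Localization.induction_on with
    | H y =>
      obtain ⟨r, s⟩ := y
      have hr : r ∈ P := by
        rw [Localization.mk_eq_mk'] at ha
        exact (IsLocalization.AtPrime.mk'_mem_maximal_iff A P r s).1 ha
      rw [LinearMap.mem_ker, hF, ← LocalizedModule.zero_mk s, LocalizedModule.mk_eq]
      refine ⟨⟨d, hd⟩, ?_⟩
      rw [smul_zero, smul_zero, smul_comm]
      have : (⟨d, hd⟩ : P.primeCompl) • (Ideal.Quotient.mk I r) = 0 := by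
        rw [Submonoid.smul_def, Algebra.smul_def, Ideal.Quotient.algebraMap_eq, ← map_mul]
        exact Ideal.Quotient.eq_zero_iff_mem.2 (h r hr)
      rw [this, smul_zero]
  have hsurj : Function.Surjective ((IsLocalRing.maximalIdeal A).liftQ F hker) := by
    intro z
    induction z using LocalizedModule.induction_on with
    | h m s =>
      obtain ⟨r, rfl⟩ := Ideal.Quotient.mk_surjective m
      exact ⟨Submodule.Quotient.mk (Localization.mk r s), hF r s⟩
  refine (Module.length_le_of_surjective _ hsurj).trans_eq ?_
  have : IsSimpleModule A (A ⧸ IsLocalRing.maximalIdeal A) :=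
    isSimpleModule_iff_isCoatom.2 (Ideal.isMaximal_def.1 inferInstance)
  exact Module.length_eq_one A _

theorem IsRelPrime.exists_eq_mul {R : Type*} [CommRing R] [IsDomain R] [DecompositionMonoid R]
    {u v a b : R} (h : IsRelPrime u v) (hu : u ≠ 0) (hab : u * b = v * a) :
    ∃ c, a = c * u ∧ b = c * v := by
  obtain ⟨c, rfl⟩ := h.dvd_of_dvd_mul_left ⟨b, hab.symm⟩
  exact ⟨c, mul_comm _ _, mul_left_cancel₀ hu (by linear_combination hab)⟩

namespace MvPolynomial

variable {k : Type u} [Field k] {n : ℕ}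
  {x y a₁ b₁ a₂ b₂ a₃ b₃ : MvPolynomial (Fin n) k}

theorem isRelPrime_or_dependent {p q : MvPolynomial (Fin n) k} (hp : p.IsHomogeneous 1)
    (hq : q.IsHomogeneous 1) :
    (∃ a b : k, (a ≠ 0 ∨ b ≠ 0) ∧ C a * p + C b * q = 0) ∨ IsRelPrime p q := by
  by_cases h0 : p = 0
  · exact Or.inl ⟨1, 0, Or.inl one_ne_zero, by simp [h0]⟩
  by_cases h : p ∣ q
  · obtain ⟨a, ha, rfl⟩ := exists_isHomogeneous_of_dvd (d := 0) hp hq h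
    obtain ⟨a, rfl⟩ := ha.exists_eq_C
    exact Or.inl ⟨a, -1, Or.inr (by simp), by simp⟩
  · exact Or.inr ((prime_of_isHomogeneous_one hp h0).irreducible.isRelPrime_iff_not_dvd.2 h)

/-- If the coefficients of `x` lie in `(x, y)`, the three cubics form a square pencil. -/
theorem PDLT_of_mem_left (hxh : x.IsHomogeneous 1) (hyh : y.IsHomogeneous 1)
    (hxy : LinearIndependent k ![x, y])
    (ha₁ : a₁.IsHomogeneous 2) (ha₂ : a₂.IsHomogeneous 2) (ha₃ : a₃.IsHomogeneous 2)
    (hb₁ : b₁.IsHomogeneous 2) (hb₂ : b₂.IsHomogeneous 2) (hb₃ : b₃.IsHomogeneous 2)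
    (h₁ : a₁ ∈ Ideal.span {x, y}) (h₂ : a₂ ∈ Ideal.span {x, y}) (h₃ : a₃ ∈ Ideal.span {x, y})
    (hJ : ∀ z : MvPolynomial (Fin n) k, z.IsHomogeneous 1 →
      ¬ Ideal.span {a₁ * x + b₁ * y, a₂ * x + b₂ * y, a₃ * x + b₃ * y} ≤ Ideal.span {z}) :
    PDLT (MvPolynomial (Fin n) k) (MvPolynomial (Fin n) k ⧸
      Ideal.span {a₁ * x + b₁ * y, a₂ * x + b₂ * y, a₃ * x + b₃ * y}) 37 := by
  obtain ⟨l₁, m₁, hl₁, hm₁, rfl⟩ := exists_isHomogeneous_pair hxh hyh ha₁ h₁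
  obtain ⟨l₂, m₂, hl₂, hm₂, rfl⟩ := exists_isHomogeneous_pair hxh hyh ha₂ h₂
  obtain ⟨l₃, m₃, hl₃, hm₃, rfl⟩ := exists_isHomogeneous_pair hxh hyh ha₃ h₃
  have e : ∀ l m b : MvPolynomial (Fin n) k,
      (l * x + m * y) * x + b * y = l * x ^ 2 + y * (m * x + b) := fun l m b => by ring
  specialize hJ y hyh
  rw [e, e, e] at hJ ⊢
  have hxy' := LinearIndependent.pair_iff.1 hxy
  refine PDLT_of_square_pencil hxh hyh hl₁ hl₂ hl₃ ((hm₁.mul hxh).add hb₁)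
    ((hm₂.mul hxh).add hb₂) ((hm₃.mul hxh).add hb₃) ?_ ?_ hJ
  · rintro rfl
    exact one_ne_zero (hxy' 0 1 (by simp)).2
  · intro h
    obtain ⟨a, ha, e⟩ := exists_isHomogeneous_of_dvd (d := 0) hyh hxh h
    obtain ⟨a, rfl⟩ := ha.exists_eq_C
    refine one_ne_zero (hxy' 1 (-a) ?_).1
    rw [one_smul, smul_eq_C_mul, e, C_neg]
    ring

/-- For `β ≠ 0` and `c = α / β` one has `a x + b y = (b + c a) y + a (x - c y)` with `b + c a` in
`(x, y)`. So `y` and `x - c y` take over the roles of `x` and `y`. -/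
theorem PDLT_of_dependent (hxh : x.IsHomogeneous 1) (hyh : y.IsHomogeneous 1)
    (hxy : LinearIndependent k ![x, y])
    (ha₁ : a₁.IsHomogeneous 2) (ha₂ : a₂.IsHomogeneous 2) (ha₃ : a₃.IsHomogeneous 2)
    (hb₁ : b₁.IsHomogeneous 2) (hb₂ : b₂.IsHomogeneous 2) (hb₃ : b₃.IsHomogeneous 2)
    {α β : k} (hαβ : α ≠ 0 ∨ β ≠ 0)
    (h₁ : C α * a₁ + C β * b₁ ∈ Ideal.span {x, y}) (h₂ : C α * a₂ + C β * b₂ ∈ Ideal.span {x, y})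
    (h₃ : C α * a₃ + C β * b₃ ∈ Ideal.span {x, y})
    (hJ : ∀ z : MvPolynomial (Fin n) k, z.IsHomogeneous 1 →
      ¬ Ideal.span {a₁ * x + b₁ * y, a₂ * x + b₂ * y, a₃ * x + b₃ * y} ≤ Ideal.span {z}) :
    PDLT (MvPolynomial (Fin n) k) (MvPolynomial (Fin n) k ⧸
      Ideal.span {a₁ * x + b₁ * y, a₂ * x + b₂ * y, a₃ * x + b₃ * y}) 37 := by
  have hinv : ∀ {c : k}, c ≠ 0 → C c⁻¹ * C c = (1 : MvPolynomial (Fin n) k) := fun hc => by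
    rw [← C_mul, inv_mul_cancel₀ hc, C_1]
  by_cases hβ : β = 0
  · subst hβ
    have hα : α ≠ 0 := hαβ.resolve_right (by simp)
    have key : ∀ {a b : MvPolynomial (Fin n) k}, C α * a + C 0 * b ∈ Ideal.span {x, y} →
        a ∈ Ideal.span {x, y} := by
      intro a b h
      have e : a = C α⁻¹ * (C α * a + C 0 * b) := by
        rw [C_0]
        linear_combination (-a) * hinv hα
      rw [e]
      exact Ideal.mul_mem_left _ _ h
    exact PDLT_of_mem_left hxh hyh hxy ha₁ ha₂ ha₃ hb₁ hb₂ hb₃ (key h₁) (key h₂) (key h₃) hJ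
  · set c : k := β⁻¹ * α with hc
    have hh : ∀ {a b : MvPolynomial (Fin n) k}, a.IsHomogeneous 2 → b.IsHomogeneous 2 →
        (b + C c * a).IsHomogeneous 2 := fun ha hb => hb.add (C_mul_isHomogeneous ha c)
    have hspan : Ideal.span {y, x - C c * y} = Ideal.span {x, y} := by
      refine le_antisymm (Ideal.span_le.2 ?_) (Ideal.span_le.2 ?_)
      · rintro p (rfl | rfl)
        · exact Ideal.mem_span_pair.2 ⟨0, 1, by ring⟩
        · exact Ideal.mem_span_pair.2 ⟨1, -C c, by ring⟩
      · rintro p (rfl | rfl)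
        · exact Ideal.mem_span_pair.2 ⟨C c, 1, by ring⟩
        · exact Ideal.mem_span_pair.2 ⟨1, 0, by ring⟩
    have key : ∀ {a b : MvPolynomial (Fin n) k}, C α * a + C β * b ∈ Ideal.span {x, y} →
        b + C c * a ∈ Ideal.span {y, x - C c * y} := by
      intro a b h
      have e : b + C c * a = C β⁻¹ * (C α * a + C β * b) := by
        rw [hc, C_mul]
        linear_combination (-b) * hinv hβ
      rw [hspan, e]
      exact Ideal.mul_mem_left _ _ h
    have e : ∀ a b : MvPolynomial (Fin n) k,
        a * x + b * y = (b + C c * a) * y + a * (x - C c * y) := fun a b => by ring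
    rw [e a₁, e a₂, e a₃] at hJ ⊢
    have hli : LinearIndependent k ![y, x - C c * y] := by
      rw [LinearIndependent.pair_iff] at hxy ⊢
      intro s t hst
      obtain ⟨ht, hs⟩ := hxy t (s - t * c) (by
        simp only [smul_eq_C_mul, C_sub, C_mul] at hst ⊢
        linear_combination hst)
      subst ht
      exact ⟨by simpa using hs, rfl⟩
    exact PDLT_of_mem_left hyh (sub_C_mul_isHomogeneous hxh hyh c) hli (hh ha₁ hb₁) (hh ha₂ hb₂)
      (hh ha₃ hb₃) ha₁ ha₂ ha₃ (key h₁) (key h₂) (key h₃) hJ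

theorem exists_eq_add_of_sub_mem {p q : MvPolynomial (Fin n) k} (hxh : x.IsHomogeneous 1)
    (hyh : y.IsHomogeneous 1) (hp : p.IsHomogeneous 2) (hq : q.IsHomogeneous 2)
    (h : p - q ∈ Ideal.span {x, y}) :
    ∃ l m : MvPolynomial (Fin n) k, l.IsHomogeneous 1 ∧ m.IsHomogeneous 1 ∧
      p = q + (l * x + m * y) := by
  obtain ⟨l, m, hl, hm, e⟩ := exists_isHomogeneous_pair (d := 1) hxh hyh (hp.sub hq) h
  exact ⟨l, m, hl, hm, by rw [← e]; ring⟩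

theorem PDLT_of_proportional_linear (hxh : x.IsHomogeneous 1) (hyh : y.IsHomogeneous 1)
    (ha₁ : a₁.IsHomogeneous 2) (ha₂ : a₂.IsHomogeneous 2) (ha₃ : a₃.IsHomogeneous 2)
    (hb₁ : b₁.IsHomogeneous 2) (hb₂ : b₂.IsHomogeneous 2) (hb₃ : b₃.IsHomogeneous 2)
    {u v c₁ c₂ c₃ : MvPolynomial (Fin n) k} (hu : u.IsHomogeneous 1) (hv : v.IsHomogeneous 1)
    (hc₁ : c₁.IsHomogeneous 1) (hc₂ : c₂.IsHomogeneous 1) (hc₃ : c₃.IsHomogeneous 1)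
    (ea₁ : a₁ - c₁ * u ∈ Ideal.span {x, y}) (eb₁ : b₁ - c₁ * v ∈ Ideal.span {x, y})
    (ea₂ : a₂ - c₂ * u ∈ Ideal.span {x, y}) (eb₂ : b₂ - c₂ * v ∈ Ideal.span {x, y})
    (ea₃ : a₃ - c₃ * u ∈ Ideal.span {x, y}) (eb₃ : b₃ - c₃ * v ∈ Ideal.span {x, y}) :
    PDLT (MvPolynomial (Fin n) k) (MvPolynomial (Fin n) k ⧸
      Ideal.span {a₁ * x + b₁ * y, a₂ * x + b₂ * y, a₃ * x + b₃ * y}) 37 := by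
  obtain ⟨l₁, m₁, hl₁, hm₁, rfl⟩ := exists_eq_add_of_sub_mem hxh hyh ha₁ (hc₁.mul hu) ea₁
  obtain ⟨l₂, m₂, hl₂, hm₂, rfl⟩ := exists_eq_add_of_sub_mem hxh hyh ha₂ (hc₂.mul hu) ea₂
  obtain ⟨l₃, m₃, hl₃, hm₃, rfl⟩ := exists_eq_add_of_sub_mem hxh hyh ha₃ (hc₃.mul hu) ea₃
  obtain ⟨p₁, q₁, hp₁, hq₁, rfl⟩ := exists_eq_add_of_sub_mem hxh hyh hb₁ (hc₁.mul hv) eb₁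
  obtain ⟨p₂, q₂, hp₂, hq₂, rfl⟩ := exists_eq_add_of_sub_mem hxh hyh hb₂ (hc₂.mul hv) eb₂
  obtain ⟨p₃, q₃, hp₃, hq₃, rfl⟩ := exists_eq_add_of_sub_mem hxh hyh hb₃ (hc₃.mul hv) eb₃
  refine PDLT_of_list (L := [x, y, u, v, c₁, c₂, c₃, l₁, l₂, l₃, m₁, m₂, m₃, p₁, p₂, p₃, q₁, q₂,
    q₃]) ?_ (by simp) ?_
  · simp only [List.mem_cons, List.not_mem_nil, or_false, forall_eq_or_imp, forall_eq]
    tauto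
  · have key : ∀ z ∈ [x, y, u, v, c₁, c₂, c₃, l₁, l₂, l₃, m₁, m₂, m₃, p₁, p₂, p₃, q₁, q₂, q₃],
        z ∈ Algebra.adjoin k {l | l ∈ [x, y, u, v, c₁, c₂, c₃, l₁, l₂, l₃, m₁, m₂, m₃,
          p₁, p₂, p₃, q₁, q₂, q₃]} := fun z hz => Algebra.subset_adjoin hz
    generalize Algebra.adjoin k {l | l ∈ [x, y, u, v, c₁, c₂, c₃, l₁, l₂, l₃, m₁, m₂, m₃,
          p₁, p₂, p₃, q₁, q₂, q₃]} = S at key ⊢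
    simp only [List.mem_cons, List.not_mem_nil, or_false, forall_eq_or_imp, forall_eq] at key
    obtain ⟨_, _, _, _, _, _, _, _, _, _, _, _, _, _, _, _, _, _, _⟩ := key
    rintro g (rfl | rfl | rfl) <;>
    repeat' first | assumption | apply add_mem | apply mul_mem

theorem PDLT_of_proportional_const (hxh : x.IsHomogeneous 1) (hyh : y.IsHomogeneous 1)
    (ha₁ : a₁.IsHomogeneous 2) (ha₂ : a₂.IsHomogeneous 2) (ha₃ : a₃.IsHomogeneous 2)
    (hb₁ : b₁.IsHomogeneous 2) (hb₂ : b₂.IsHomogeneous 2) (hb₃ : b₃.IsHomogeneous 2) {c₂ c₃ : k}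
    (ea₂ : a₂ - C c₂ * a₁ ∈ Ideal.span {x, y}) (eb₂ : b₂ - C c₂ * b₁ ∈ Ideal.span {x, y})
    (ea₃ : a₃ - C c₃ * a₁ ∈ Ideal.span {x, y}) (eb₃ : b₃ - C c₃ * b₁ ∈ Ideal.span {x, y}) :
    PDLT (MvPolynomial (Fin n) k) (MvPolynomial (Fin n) k ⧸
      Ideal.span {a₁ * x + b₁ * y, a₂ * x + b₂ * y, a₃ * x + b₃ * y}) 37 := by
  obtain ⟨l₂, m₂, hl₂, hm₂, rfl⟩ :=
    exists_eq_add_of_sub_mem hxh hyh ha₂ (C_mul_isHomogeneous ha₁ c₂) ea₂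
  obtain ⟨l₃, m₃, hl₃, hm₃, rfl⟩ :=
    exists_eq_add_of_sub_mem hxh hyh ha₃ (C_mul_isHomogeneous ha₁ c₃) ea₃
  obtain ⟨p₂, q₂, hp₂, hq₂, rfl⟩ :=
    exists_eq_add_of_sub_mem hxh hyh hb₂ (C_mul_isHomogeneous hb₁ c₂) eb₂
  obtain ⟨p₃, q₃, hp₃, hq₃, rfl⟩ :=
    exists_eq_add_of_sub_mem hxh hyh hb₃ (C_mul_isHomogeneous hb₁ c₃) eb₃
  have e : ∀ c l m p q : MvPolynomial (Fin n) k,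
      (c * a₁ + (l * x + m * y)) * x + (c * b₁ + (p * x + q * y)) * y =
        c * (a₁ * x + b₁ * y) + (l * x * x + (m + p) * x * y + q * y * y) :=
    fun c l m p q => by ring
  rw [e, e]
  -- The forms `m` and `p` enter only through their sum, which keeps the count at the permitted 8.
  refine PDLT_of_list_two (L := [x, y, l₂, l₃, m₂ + p₂, m₃ + p₃, q₂, q₃]) ?_ (by simp) ha₁ hb₁ ?_
  · simp only [List.mem_cons, List.not_mem_nil, or_false, forall_eq_or_imp, forall_eq]
    exact ⟨hxh, hyh, hl₂, hl₃, hm₂.add hp₂, hm₃.add hp₃, hq₂, hq₃⟩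
  · have key : ∀ z ∈ [x, y, l₂, l₃, m₂ + p₂, m₃ + p₃, q₂, q₃], z ∈
        Algebra.adjoin k ({l | l ∈ [x, y, l₂, l₃, m₂ + p₂, m₃ + p₃, q₂, q₃]} ∪ {a₁, b₁}) :=
      fun z hz => Algebra.subset_adjoin (Or.inl hz)
    have key₁ : a₁ ∈
        Algebra.adjoin k ({l | l ∈ [x, y, l₂, l₃, m₂ + p₂, m₃ + p₃, q₂, q₃]} ∪ {a₁, b₁}) :=
      Algebra.subset_adjoin (by simp)
    have key₂ : b₁ ∈
        Algebra.adjoin k ({l | l ∈ [x, y, l₂, l₃, m₂ + p₂, m₃ + p₃, q₂, q₃]} ∪ {a₁, b₁}) :=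
      Algebra.subset_adjoin (by simp)
    generalize Algebra.adjoin k ({l | l ∈ [x, y, l₂, l₃, m₂ + p₂, m₃ + p₃, q₂, q₃]} ∪
      {a₁, b₁}) = S at key key₁ key₂ ⊢
    have hC : ∀ c : k, C c ∈ S := S.algebraMap_mem
    have h₂ := hC c₂
    have h₃ := hC c₃
    simp only [List.mem_cons, List.not_mem_nil, or_false, forall_eq_or_imp, forall_eq] at key
    obtain ⟨_, _, _, _, _, _, _, _⟩ := key
    rintro g (rfl | rfl | rfl) <;>
    repeat' first | assumption | apply add_mem | apply mul_mem

/-- The first row is nonzero modulo `(x, y)`, and the other rows are proportional to it. The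
trichotomy for its entries separates a constant relation, a common linear factor with coprime linear
cofactors, and coprime quadrics. -/
theorem PDLT_of_minors_mem_of_notMem (hxh : x.IsHomogeneous 1) (hyh : y.IsHomogeneous 1)
    (hxy : LinearIndependent k ![x, y])
    (ha₁ : a₁.IsHomogeneous 2) (ha₂ : a₂.IsHomogeneous 2) (ha₃ : a₃.IsHomogeneous 2)
    (hb₁ : b₁.IsHomogeneous 2) (hb₂ : b₂.IsHomogeneous 2) (hb₃ : b₃.IsHomogeneous 2)
    (h₀ : ¬ (a₁ ∈ Ideal.span {x, y} ∧ b₁ ∈ Ideal.span {x, y}))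
    (h₁₂ : a₁ * b₂ - b₁ * a₂ ∈ Ideal.span {x, y}) (h₁₃ : a₁ * b₃ - b₁ * a₃ ∈ Ideal.span {x, y})
    (hJ : ∀ z : MvPolynomial (Fin n) k, z.IsHomogeneous 1 →
      ¬ Ideal.span {a₁ * x + b₁ * y, a₂ * x + b₂ * y, a₃ * x + b₃ * y} ≤ Ideal.span {z}) :
    PDLT (MvPolynomial (Fin n) k) (MvPolynomial (Fin n) k ⧸
      Ideal.span {a₁ * x + b₁ * y, a₂ * x + b₂ * y, a₃ * x + b₃ * y}) 37 := by
  obtain ⟨c⟩ := exists_linCoords (W := Submodule.span k {x, y}) (span_le_linForms (by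
    rintro l (rfl | rfl)
    exacts [hxh, hyh]))
  have hc : ∀ {p : MvPolynomial (Fin n) k}, c.proj p = 0 ↔ p ∈ Ideal.span {x, y} := by
    intro p
    rw [c.proj_eq_zero_iff, ideal_span_span]
  have hc' : ∀ {p : MvPolynomial (Fin n) k} {q : MvPolynomial (Fin c.t) k}, c.proj p = q →
      p - c.lift q ∈ Ideal.span {x, y} := by
    rintro p q rfl
    rw [← hc, map_sub, c.proj_lift, sub_self]
  rw [← hc, ← hc] at h₀
  rw [← hc, map_sub, map_mul, map_mul, sub_eq_zero] at h₁₂ h₁₃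
  by_cases hdep : ∃ α β : k, (α ≠ 0 ∨ β ≠ 0) ∧ C α * c.proj a₁ + C β * c.proj b₁ = 0
  · obtain ⟨α, β, hαβ, h⟩ := hdep
    -- Rank one transfers a constant relation from the nonzero first row to every row.
    have key : ∀ {a b : MvPolynomial (Fin n) k}, c.proj a₁ * c.proj b = c.proj b₁ * c.proj a →
        C α * a + C β * b ∈ Ideal.span {x, y} := by
      intro a b hab
      rw [← hc, map_add, map_mul, map_mul, algHom_C, algHom_C]
      simp only [algebraMap_eq]
      by_contra h0
      refine h₀ ⟨(mul_eq_zero.1 (?_ : c.proj a₁ * _ = 0)).resolve_right h0,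
        (mul_eq_zero.1 (?_ : c.proj b₁ * _ = 0)).resolve_right h0⟩
      · linear_combination c.proj a * h + C β * hab
      · linear_combination c.proj b * h - C α * hab
    exact PDLT_of_dependent hxh hyh hxy ha₁ ha₂ ha₃ hb₁ hb₂ hb₃ hαβ (key (mul_comm _ _)) (key h₁₂)
      (key h₁₃) hJ
  have hA := c.isHomogeneous_proj ha₁
  rcases quadrics_trichotomy hA (c.isHomogeneous_proj hb₁) with
    ⟨α, β, h, e⟩ | ⟨l, u, v, hl, hu, hv, eu, ev⟩ | hrel
  · exact absurd ⟨α, β, h, by simpa only [smul_eq_C_mul] using e⟩ hdep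
  · have hl0 : l ≠ 0 := by
      rintro rfl
      exact h₀ ⟨by rw [eu, mul_zero], by rw [ev, mul_zero]⟩
    rcases isRelPrime_or_dependent hu hv with ⟨α, β, h, e⟩ | hrel
    · refine absurd ⟨α, β, h, ?_⟩ hdep
      rw [eu, ev]
      linear_combination l * e
    · have hu0 : u ≠ 0 := by
        rintro rfl
        exact hdep ⟨1, 0, Or.inl one_ne_zero, by simp [eu]⟩
      have key : ∀ {a b : MvPolynomial (Fin n) k}, a.IsHomogeneous 2 →
          c.proj a₁ * c.proj b = c.proj b₁ * c.proj a →
          ∃ r : MvPolynomial (Fin n) k, r.IsHomogeneous 1 ∧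
            a - r * c.lift u ∈ Ideal.span {x, y} ∧ b - r * c.lift v ∈ Ideal.span {x, y} := by
        intro a b ha hab
        rw [eu, ev] at hab
        obtain ⟨r, er, es⟩ := hrel.exists_eq_mul hu0
          (mul_left_cancel₀ hl0 (by linear_combination hab) : u * c.proj b = v * c.proj a)
        obtain ⟨s, hs, er'⟩ := exists_isHomogeneous_of_dvd (d := 1) hu (c.isHomogeneous_proj ha)
          ⟨r, by rw [er, mul_comm]⟩
        obtain rfl : r = s := mul_right_cancel₀ hu0 (er.symm.trans er')
        refine ⟨c.lift r, c.isHomogeneous_lift hs, ?_, ?_⟩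
        · rw [← map_mul]
          exact hc' er
        · rw [← map_mul]
          exact hc' es
      obtain ⟨c₁, hc₁, ea₁, eb₁⟩ := key ha₁ (mul_comm _ _)
      obtain ⟨c₂, hc₂, ea₂, eb₂⟩ := key ha₂ h₁₂
      obtain ⟨c₃, hc₃, ea₃, eb₃⟩ := key ha₃ h₁₃
      exact PDLT_of_proportional_linear hxh hyh ha₁ ha₂ ha₃ hb₁ hb₂ hb₃ (c.isHomogeneous_lift hu)
        (c.isHomogeneous_lift hv) hc₁ hc₂ hc₃ ea₁ eb₁ ea₂ eb₂ ea₃ eb₃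
  · have hu0 : c.proj a₁ ≠ 0 := fun h =>
      hdep ⟨1, 0, Or.inl one_ne_zero, by simp [h]⟩
    have key : ∀ {a b : MvPolynomial (Fin n) k}, a.IsHomogeneous 2 →
        c.proj a₁ * c.proj b = c.proj b₁ * c.proj a →
        ∃ r : k, a - C r * a₁ ∈ Ideal.span {x, y} ∧ b - C r * b₁ ∈ Ideal.span {x, y} := by
      intro a b ha hab
      obtain ⟨r, er, es⟩ := hrel.exists_eq_mul hu0 hab
      obtain ⟨s, hs, er'⟩ := exists_isHomogeneous_of_dvd (d := 0) hA
        (by simpa using c.isHomogeneous_proj ha) ⟨r, by rw [er, mul_comm]⟩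
      obtain rfl : r = s := mul_right_cancel₀ hu0 (er.symm.trans er')
      obtain ⟨r, rfl⟩ := hs.exists_eq_C
      have hr : c.proj (C r) = C r := c.proj.commutes r
      exact ⟨r, by rw [← hc, map_sub, map_mul, hr, er, sub_self],
        by rw [← hc, map_sub, map_mul, hr, es, sub_self]⟩
    obtain ⟨c₂, ea₂, eb₂⟩ := key ha₂ h₁₂
    obtain ⟨c₃, ea₃, eb₃⟩ := key ha₃ h₁₃
    exact PDLT_of_proportional_const hxh hyh ha₁ ha₂ ha₃ hb₁ hb₂ hb₃ ea₂ eb₂ ea₃ eb₃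

theorem PDLT_of_minors_mem (hxh : x.IsHomogeneous 1) (hyh : y.IsHomogeneous 1)
    (hxy : LinearIndependent k ![x, y])
    (ha₁ : a₁.IsHomogeneous 2) (ha₂ : a₂.IsHomogeneous 2) (ha₃ : a₃.IsHomogeneous 2)
    (hb₁ : b₁.IsHomogeneous 2) (hb₂ : b₂.IsHomogeneous 2) (hb₃ : b₃.IsHomogeneous 2)
    (h₁₂ : a₁ * b₂ - b₁ * a₂ ∈ Ideal.span {x, y}) (h₁₃ : a₁ * b₃ - b₁ * a₃ ∈ Ideal.span {x, y})
    (h₂₃ : a₂ * b₃ - b₂ * a₃ ∈ Ideal.span {x, y})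
    (hJ : ∀ z : MvPolynomial (Fin n) k, z.IsHomogeneous 1 →
      ¬ Ideal.span {a₁ * x + b₁ * y, a₂ * x + b₂ * y, a₃ * x + b₃ * y} ≤ Ideal.span {z}) :
    PDLT (MvPolynomial (Fin n) k) (MvPolynomial (Fin n) k ⧸
      Ideal.span {a₁ * x + b₁ * y, a₂ * x + b₂ * y, a₃ * x + b₃ * y}) 37 := by
  have hneg : ∀ {a b a' b' : MvPolynomial (Fin n) k}, a * b' - b * a' ∈ Ideal.span {x, y} →
      a' * b - b' * a ∈ Ideal.span {x, y} := by
    intro a b a' b' h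
    rw [show a' * b - b' * a = -(a * b' - b * a') by ring]
    exact neg_mem h
  by_cases h₁ : a₁ ∈ Ideal.span {x, y} ∧ b₁ ∈ Ideal.span {x, y}
  · by_cases h₂ : a₂ ∈ Ideal.span {x, y} ∧ b₂ ∈ Ideal.span {x, y}
    · by_cases h₃ : a₃ ∈ Ideal.span {x, y} ∧ b₃ ∈ Ideal.span {x, y}
      · exact PDLT_of_mem_left hxh hyh hxy ha₁ ha₂ ha₃ hb₁ hb₂ hb₃ h₁.1 h₂.1 h₃.1 hJ
      · rw [← Ideal.span_triple_rotate (a₃ * x + b₃ * y)] at hJ ⊢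
        exact PDLT_of_minors_mem_of_notMem hxh hyh hxy ha₃ ha₁ ha₂ hb₃ hb₁ hb₂ h₃ (hneg h₁₃)
          (hneg h₂₃) hJ
    · rw [Ideal.span_triple_rotate] at hJ ⊢
      exact PDLT_of_minors_mem_of_notMem hxh hyh hxy ha₂ ha₃ ha₁ hb₂ hb₃ hb₁ h₂ h₂₃ (hneg h₁₂) hJ
  · exact PDLT_of_minors_mem_of_notMem hxh hyh hxy ha₁ ha₂ ha₃ hb₁ hb₂ hb₃ h₁ h₁₂ h₁₃ hJ

end MvPolynomial

/-- If the localization at `(x, y)` is not simple, the minors of the coefficients lie in `(x, y)`. -/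
theorem Ideal.minor_mem_of_two_le_length {R : Type*} [CommRing R] {I P : Ideal R} [P.IsPrime]
    {x y a b a' b' : R} (hP : P = Ideal.span {x, y}) (h₁ : a * x + b * y ∈ I)
    (h₂ : a' * x + b' * y ∈ I)
    (hlength : 2 ≤ Module.length (Localization.AtPrime P) (LocalizedModule P.primeCompl (R ⧸ I))) :
    a * b' - b * a' ∈ P := by
  by_contra hd
  refine absurd (hlength.trans (Module.length_localizedModule_quotient_le_one hd ?_)) (by norm_num)
  intro p hp
  rw [hP] at hp
  obtain ⟨r, s, rfl⟩ := Ideal.mem_span_pair.1 hp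
  -- Cramer's rule: the minor times any element of `(x, y)` is a combination of the two generators.
  have e : (a * b' - b * a') * (r * x + s * y) =
      (r * b' - s * a') * (a * x + b * y) + (s * a - r * b) * (a' * x + b' * y) := by ring
  rw [e]
  exact add_mem (Ideal.mul_mem_left _ _ h₁) (Ideal.mul_mem_left _ _ h₂)

theorem mainTheorem4 {k : Type*} [Field k] {n : ℕ}
    -- three cubic forms
    (f g h : MvPolynomial (Fin n) k)
    (hf : f.IsHomogeneous 3) (hg : g.IsHomogeneous 3) (hh : h.IsHomogeneous 3)
    -- which minimally generate an ideal: none of the generators is redundant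
    (hmin_f : f ∉ Ideal.span {g, h})
    (hmin_g : g ∉ Ideal.span {f, h})
    (hmin_h : h ∉ Ideal.span {f, g})
    -- of height two
    (hheight : (Ideal.span {f, g, h}).height = 2)
    -- the prime `P = (x, y)` with independent linear forms `x`, `y`
    (x y : MvPolynomial (Fin n) k)
    (hx : x.IsHomogeneous 1) (hy : y.IsHomogeneous 1)
    (hxy : LinearIndependent k ![x, y])
    (P : Ideal (MvPolynomial (Fin n) k)) [P.IsPrime] (hP : P = Ideal.span {x, y})
    -- some minimal primary decomposition has a `P`-primary component
    (hcomp : ∃ t : Finset (Ideal (MvPolynomial (Fin n) k)),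
      Submodule.IsMinimalPrimaryDecomposition (Ideal.span {f, g, h}) t ∧ ∃ Q ∈ t, Q.radical = P)
    -- the localization of `R / (f, g, h)` at `P` has length at least two
    (hlength : 2 ≤ Module.length (Localization.AtPrime P)
      (LocalizedModule P.primeCompl
        (MvPolynomial (Fin n) k ⧸ (Ideal.span {f, g, h} : Ideal (MvPolynomial (Fin n) k))))) :
    CategoryTheory.projectiveDimension
      (ModuleCat.of (MvPolynomial (Fin n) k)
        (MvPolynomial (Fin n) k ⧸ (Ideal.span {f, g, h} : Ideal (MvPolynomial (Fin n) k)))) ≤ 36 := by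
  have hJP : Ideal.span {f, g, h} ≤ Ideal.span {x, y} := by
    obtain ⟨t, ht, Q, hQ, hQP⟩ := hcomp
    rw [← hP, ← hQP, ← ht.inf_eq]
    exact (Finset.inf_le (f := id) hQ).trans Ideal.le_radical
  have hJ : ∀ z : MvPolynomial (Fin n) k, z.IsHomogeneous 1 →
      ¬ Ideal.span {f, g, h} ≤ Ideal.span {z} := by
    intro z hz hle
    -- By Krull's principal ideal theorem, an ideal of height two is not contained in a proper
    -- principal ideal.
    have h1 := (Ideal.height_mono hle).trans (Ideal.height_span_singleton_le_one fun hu =>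
      one_ne_zero (hz.eq_zero_of_isUnit hu))
    rw [hheight] at h1
    exact absurd h1 (by norm_num)
  obtain ⟨a₁, b₁, ha₁, hb₁, rfl⟩ :=
    MvPolynomial.exists_isHomogeneous_pair (d := 2) hx hy hf (hJP (Ideal.subset_span (by simp)))
  obtain ⟨a₂, b₂, ha₂, hb₂, rfl⟩ :=
    MvPolynomial.exists_isHomogeneous_pair (d := 2) hx hy hg (hJP (Ideal.subset_span (by simp)))
  obtain ⟨a₃, b₃, ha₃, hb₃, rfl⟩ :=
    MvPolynomial.exists_isHomogeneous_pair (d := 2) hx hy hh (hJP (Ideal.subset_span (by simp)))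
  have hm : ∀ {a b a' b' : MvPolynomial (Fin n) k},
      a * x + b * y ∈ Ideal.span {a₁ * x + b₁ * y, a₂ * x + b₂ * y, a₃ * x + b₃ * y} →
      a' * x + b' * y ∈ Ideal.span {a₁ * x + b₁ * y, a₂ * x + b₂ * y, a₃ * x + b₃ * y} →
      a * b' - b * a' ∈ Ideal.span {x, y} := fun h₁ h₂ => by
    have := Ideal.minor_mem_of_two_le_length hP h₁ h₂ hlength
    rwa [hP] at this
  have h₁ : a₁ * x + b₁ * y ∈
      Ideal.span {a₁ * x + b₁ * y, a₂ * x + b₂ * y, a₃ * x + b₃ * y} :=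
    Ideal.subset_span (by simp)
  have h₂ : a₂ * x + b₂ * y ∈
      Ideal.span {a₁ * x + b₁ * y, a₂ * x + b₂ * y, a₃ * x + b₃ * y} :=
    Ideal.subset_span (by simp)
  have h₃ : a₃ * x + b₃ * y ∈
      Ideal.span {a₁ * x + b₁ * y, a₂ * x + b₂ * y, a₃ * x + b₃ * y} :=
    Ideal.subset_span (by simp)
  exact (projectiveDimension_le_iff _ 36).2
    (MvPolynomial.PDLT_of_minors_mem hx hy hxy ha₁ ha₂ ha₃ hb₁ hb₂ hb₃ (hm h₁ h₂) (hm h₁ h₃)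
      (hm h₂ h₃) hJ)
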